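/- **Setting.** Let $\mathbb G$ be a finite metric tree. Its edges (pipes) $P$ are identified with segments $[0,\ell_P]$, $\ell_P>0$; its boundary points are the vertices of degree one, the other vertices are the junctions $\mathbb J$. At an end of a pipe let $\nu=+1$ if the end is $x=0$ and $\nu=-1$ if it is $x=\ell_P$. Let $a,g>0$ be constants and let the area $A$ be, on each pipe, of bounded variation and bounded away from $0$. One boundary point $x_0$ is inaccessible; $x_1,\dots,x_N$ are the other ones. At $x_0$ smooth functions $\alpha,\beta:\mathbb R\to\mathbb R$ are given with $\alpha(t)\,\nu(x_0)\,\frac{gA(x_0)}{a}+\beta(t)\neq0$ for all $t$ (the boundary condition at $x_0$ creates no wave without an incident one). A pair $H,Q$ satisfies the *network wave model with boundary flow* $F$ if, on each pipe, in the sense of distributions in $t$ depending weakly continuously on $x\in[0,\ell_P]$, $$\partial_x Q=-\frac{gA}{a^2}\,\partial_t H,\qquad \partial_x H=-\frac1{gA}\,\partial_t Q,$$ $H$ has a single value at each vertex, $\sum\nu Q=0$ over the pipe ends at each junction, $H=Q=F=0$ for $t<0$, $\nu Q=F$ at $x_1,\dots,x_N$, and $\alpha Q+\beta H=0$ at $x_0$.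 The *impulse-response matrix* $K=(K_{ij})_{i,j=1}^N$ is given by $K_{ij}=H(\cdot,x_j)/V_0$, where $H,Q$ satisfy the model with boundary flow $V_0\delta_0(t)$ at $x_i$ and $0$ at the other $x_l$, $l\ne 0$ ($V_0>0$). Let $\operatorname{TT}$ be the distance along $\mathbb G$ divided by $a$. **Theorem.** Assume that $A$ is constant near each boundary point of $\mathbb G$. 1. There are distributions $k_{ij}$ that vanish for $t<\varepsilon$, for some $\varepsilon>0$, such that $$K_{ij}(t)=\frac{a}{A(x_i)g}\,\delta_0(t)\,\delta_{ij}+k_{ij}(t).$$ Moreover $k_{ij}=k_{ji}$ on $t<\operatorname{TT}(x_i,x_0)+\operatorname{TT}(x_0,x_j)$, and $k_{ij}=k_{ji}$ on all of $\mathbb R$ if the boundary condition at $x_0$ does not depend on time (that is, $\alpha(s)\beta(t)=\alpha(t)\beta(s)$ for all $s,t$; in particular if $\alpha,\beta$ are constants). 2. Let $p$ be a point of $\mathbb G$ that is not a vertex, and let $D_p$ be the part of $\mathbb G\setminus\{p\}$ that is not connected to $x_0$. Put $f(x_j)=\operatorname{TT}(x_j,p)$ if $x_j\in D_p$ and $f(x_j)=0$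 otherwise. Let $\tau\ge\max f$, $h_0\in\mathbb R$, and let $Q_p(\cdot,x_j)$, $1\le j\le N$, be locally integrable functions on $\mathbb R$ such that, in the sense of distributions in $t$, $$h_0=\frac{a}{A(x_j)g}\,\nu(x_j)Q_p(t,x_j)+\sum_{i=1}^N\frac{\nu(x_i)}2\int_0^\tau Q_p(s,x_i)\big(k_{ij}(|t-s|)+k_{ij}(2\tau-t-s)\big)\,ds$$ for $\tau-f(x_j)<t<\tau$, and $Q_p(t,x_j)=0$ for $0\le t\le\tau-f(x_j)$. Let $H,Q$ be measurable functions, locally integrable in $t$ at every $x$ and continuous in $t$ with values in $L^1(P)$ for every pipe $P$, that satisfy the network wave model with boundary flow $\nu Q_p$. Then, for almost every $x\in\mathbb G$, $$H(\tau,x)=\begin{cases}h_0,&x\in D_p,\\0,&x\notin D_p.\end{cases}$$ -/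

import Mathlib

open MeasureTheory Set Filter Topology TopologicalSpace
open scoped Distributions LineDeriv ContDiff

noncomputable section

/-! ### Distributions in the time variable -/

/-- Smooth compactly supported functions of time. -/
abbrev TimeTest := 𝓓((⊤ : Opens ℝ), ℝ)

/-- Distributions of time. -/
abbrev TimeDist := 𝓓'((⊤ : Opens ℝ), ℝ)

namespace TimeDist

/-- The distribution `φ ↦ ∫ u φ` of a locally integrable function `u`. -/
def ofFun (u : ℝ → ℝ) : TimeDist :=
  (TestFunction.integralAgainstBilinCLM (ContinuousLinearMap.mul ℝ ℝ) volume u :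
    TimeTest →L[ℝ] ℝ)

/-- The time derivative of a distribution. -/
def timeDeriv (T : TimeDist) : TimeDist := ∂_{(1 : ℝ)} T

end TimeDist

namespace TimeTest

/-- The test function `t ↦ φ (c - t)`. -/
def reflect (c : ℝ) (φ : TimeTest) : TimeTest where
  toFun t := φ (c - t)
  contDiff' := φ.contDiff.comp (contDiff_const.sub contDiff_id)
  hasCompactSupport' := φ.hasCompactSupport.comp_homeomorph (Homeomorph.subLeft c)
  tsupport_subset' := fun _ _ => trivial

/-- The product of a test function with a smooth function. -/
def mulSmooth (α : ℝ → ℝ) (hα : ContDiff ℝ ∞ α) (φ : TimeTest) : TimeTest where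
  toFun t := α t * φ t
  contDiff' := hα.mul φ.contDiff
  hasCompactSupport' := φ.hasCompactSupport.mul_left
  tsupport_subset' := fun _ _ => trivial

theorem smear_eq_convolution (u : ℝ → ℝ) (φ : ℝ → ℝ) :
    (fun r => ∫ s, u s * φ (s + r)) =
      convolution (fun s => u (-s)) φ (ContinuousLinearMap.mul ℝ ℝ) volume := by
  funext r
  rw [convolution_def, ← integral_neg_eq_self]
  simp [add_comm, sub_eq_add_neg]

open Classical in
/-- The test function `r ↦ ∫ u(s) φ(s + r) ds`, for `u` integrable with compact support. -/
def smear (u : ℝ → ℝ) (φ : TimeTest) : TimeTest :=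
  if h : LocallyIntegrable u ∧ HasCompactSupport u then
    { toFun := fun r => ∫ s, u s * φ (s + r)
      contDiff' := by
        rw [smear_eq_convolution]
        refine φ.hasCompactSupport.contDiff_convolution_right _ ?_ φ.contDiff
        have hu : Integrable u := by
          rw [← integrableOn_iff_integrable_of_support_subset (subset_tsupport u)]
          exact h.1.integrableOn_isCompact h.2
        exact hu.comp_neg.locallyIntegrable
      hasCompactSupport' := by
        rw [smear_eq_convolution]
        exact HasCompactSupport.convolution _
          (h.2.comp_homeomorph (Homeomorph.neg ℝ)) φ.hasCompactSupport
      tsupport_subset' := fun _ _ => trivial }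
  else 0

end TimeTest

namespace TimeDist

/-- The distribution `t ↦ ∫ u(s) k(|t - s|) ds`, paired with the test function `φ`, for an
integrable compactly supported `u` and a distribution `k` that vanishes for negative times and
near `0`; for such `k` one has `k(|r|) = k(r) + k(-r)`. -/
def convAbs (k : TimeDist) (u : ℝ → ℝ) (φ : TimeTest) : ℝ :=
  k (TimeTest.smear u φ) + k (TimeTest.reflect 0 (TimeTest.smear u φ))

/-- The distribution `t ↦ ∫ u(s) k(c - t - s) ds`, paired with the test function `φ`:
it is the value of `k` at `r ↦ ∫ u(s) φ(c - s - r) ds`. -/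
def convReflect (k : TimeDist) (c : ℝ) (u : ℝ → ℝ) (φ : TimeTest) : ℝ :=
  k (TimeTest.smear u (TimeTest.reflect c φ))

end TimeDist

/-! ### Networks -/

/-- A tree network of pipes. Its pipes are the edges of a tree; the pipe `e` is the segment from
`0` to `length e`, it starts (`x = 0`) at the vertex `node e false` and ends (`x = length e`) at
`node e true`. The cross-sectional area is of bounded variation and bounded away from `0` on each
pipe; the wave speed is constant. -/
structure PipeNetwork (V : Type*) where
  /-- the underlying combinatorial tree -/
  graph : SimpleGraph V
  isTree : graph.IsTree
  /-- the vertex at the beginning (`false`) or at the end (`true`) of a pipe -/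
  node : graph.edgeSet → Bool → V
  node_spec : ∀ e, s(node e false, node e true) = (e : Sym2 V)
  length : graph.edgeSet → ℝ
  length_pos : ∀ e, 0 < length e
  /-- the cross-sectional area -/
  area : graph.edgeSet → ℝ → ℝ
  area_bv : ∀ e, BoundedVariationOn (area e) (Icc 0 (length e))
  area_lower : ∀ e, ∃ c > 0, ∀ x ∈ Icc 0 (length e), c ≤ area e x
  /-- the wave speed `a` -/
  speed : ℝ
  speed_pos : 0 < speed
  /-- the gravitational acceleration `g` -/
  gravity : ℝ
  gravity_pos : 0 < gravity

namespace PipeNetwork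

variable {V : Type*} (N : PipeNetwork V)

/-- The pipes. -/
abbrev Pipe := N.graph.edgeSet

/-- The pipe ends. -/
abbrev End := N.Pipe × Bool

instance [Finite V] : Fintype N.Pipe := Fintype.ofFinite _

/-- The vertex to which a pipe end is attached. -/
def vertex (z : N.End) : V := N.node z.1 z.2

/-- The coordinate (`0` or the length) of a pipe end on its pipe. -/
def coord (z : N.End) : ℝ := if z.2 then N.length z.1 else 0

/-- The internal normal at a pipe end. -/
def normal (z : N.End) : ℝ := if z.2 then -1 else 1

/-- The area at a pipe end. -/
def endArea (z : N.End) : ℝ := N.area z.1 (N.coord z)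

/-- Boundary points are the vertices that belong to one pipe end only; the other vertices are the
junctions. -/
def IsBoundary (v : V) : Prop := ∃! z : N.End, N.vertex z = v

/-- The area is constant near each boundary point of the network. -/
def AreaConstNearBoundary : Prop :=
  ∀ z : N.End, N.IsBoundary (N.vertex z) →
    ∃ ε > 0, ∀ x ∈ Icc 0 (N.length z.1), |x - N.coord z| < ε → N.area z.1 x = N.endArea z

/-- The inaccessible boundary point `x₀` together with the boundary condition
`α(t) Q + β(t) H = 0` imposed there. The condition is inactive: a wave that travels from `x₀` into
the network, with no wave incident on `x₀`, has `ν Q = (g A / a) H` at `x₀`, so that the boundary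
condition reads `(α ν g A / a + β) H = 0`, and this has to force `H = 0`. -/
structure Outlet where
  /-- the pipe end at `x₀` -/
  pos : N.End
  isBoundary : N.IsBoundary (N.vertex pos)
  α : ℝ → ℝ
  β : ℝ → ℝ
  α_smooth : ContDiff ℝ ∞ α
  β_smooth : ContDiff ℝ ∞ β
  inactive : ∀ t, α t * N.normal pos * (N.gravity * N.endArea pos / N.speed) + β t ≠ 0

variable {N}
variable (O : N.Outlet)

namespace Outlet

/-- The vertex `x₀`. -/
def vertex : V := N.vertex O.pos

/-- The accessible boundary points, that is, all boundary points except `x₀`. -/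
abbrev Port := {v : V // N.IsBoundary v ∧ v ≠ O.vertex}

instance [Finite V] : Fintype O.Port := Fintype.ofFinite _

variable {O} in
/-- The only pipe end at an accessible boundary point. -/
def Port.pos (v : O.Port) : N.End := v.2.1.choose

/-! ### The network wave model -/

open Classical in
/-- The network wave model with boundary flow `F`. The pressure `H` and the discharge `Q` are
weak solutions, seen as families of distributions of time that depend continuously on the position
along each (closed) pipe; the two wave equations
`∂ₓ Q = -(g A / a²) ∂ₜ H` and `∂ₓ H = -(1 / (g A)) ∂ₜ Q` are integrated in `x`. -/
structure IsWave [Finite V] (H Q : N.Pipe → ℝ → TimeDist) (F : O.Port → TimeDist) : Prop where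
  continuous_H : ∀ e, ∀ φ : TimeTest, ContinuousOn (fun x => H e x φ) (Icc 0 (N.length e))
  continuous_Q : ∀ e, ∀ φ : TimeTest, ContinuousOn (fun x => Q e x φ) (Icc 0 (N.length e))
  equation_Q : ∀ e, ∀ φ : TimeTest, ∀ x ∈ Icc 0 (N.length e),
    Q e x φ - Q e 0 φ =
      ∫ y in (0)..x, -(N.gravity * N.area e y / N.speed ^ 2) * (H e y).timeDeriv φ
  equation_H : ∀ e, ∀ φ : TimeTest, ∀ x ∈ Icc 0 (N.length e),
    H e x φ - H e 0 φ =
      ∫ y in (0)..x, -(1 / (N.gravity * N.area e y)) * (Q e y).timeDeriv φ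
  /-- the pressure has a unique value at each vertex -/
  scalar_H : ∀ z z' : N.End, N.vertex z = N.vertex z' →
    H z.1 (N.coord z) = H z'.1 (N.coord z')
  /-- mass conservation at the junctions -/
  kirchhoff : ∀ v, ¬ N.IsBoundary v →
    ∑ z : N.End with N.vertex z = v, N.normal z • Q z.1 (N.coord z) = 0
  /-- zero initial conditions -/
  initial_H : ∀ e, ∀ x ∈ Icc 0 (N.length e), Distribution.IsVanishingOn (H e x) (Iio 0)
  initial_Q : ∀ e, ∀ x ∈ Icc 0 (N.length e), Distribution.IsVanishingOn (Q e x) (Iio 0)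
  /-- the boundary flow is zero for negative times -/
  initial_F : ∀ v, Distribution.IsVanishingOn (F v) (Iio 0)
  /-- `ν Q = F` at the accessible boundary points -/
  flow : ∀ v : O.Port, N.normal v.pos • Q v.pos.1 (N.coord v.pos) = F v
  /-- `α Q + β H = 0` at `x₀` -/
  outlet : ∀ φ : TimeTest,
    Q O.pos.1 (N.coord O.pos) (TimeTest.mulSmooth O.α O.α_smooth φ) +
      H O.pos.1 (N.coord O.pos) (TimeTest.mulSmooth O.β O.β_smooth φ) = 0

open Classical in
/-- `K` is the impulse-response matrix: `K i j` is the pressure at `x_j` divided by `V₀`, when the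
boundary flow is `V₀ δ₀` at `x_i` and zero at the other accessible boundary points. -/
def IsImpulseResponse [Finite V] (V₀ : ℝ) (K : O.Port → O.Port → TimeDist) : Prop :=
  ∀ i, ∃ H Q : N.Pipe → ℝ → TimeDist,
    O.IsWave H Q (fun v => if v = i then V₀ • Distribution.delta 0 else 0) ∧
    ∀ j, K i j = V₀⁻¹ • H j.pos.1 (N.coord j.pos)

/-- Waves `H e t x`, `Q e t x` that are functions: measurable, locally integrable in time at every
position, and continuous in time with values in `L¹` of every pipe (so that the pressure profile
at a given time is well defined, as a function up to null sets), which satisfy the network wave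
model with boundary flow `F`. -/
structure IsFunctionWave [Finite V] (H Q : N.Pipe → ℝ → ℝ → ℝ) (F : O.Port → ℝ → ℝ) :
    Prop where
  measurable_H : ∀ e, AEStronglyMeasurable (fun w : ℝ × ℝ => H e w.1 w.2)
    (volume.restrict (univ ×ˢ Icc 0 (N.length e)))
  measurable_Q : ∀ e, AEStronglyMeasurable (fun w : ℝ × ℝ => Q e w.1 w.2)
    (volume.restrict (univ ×ˢ Icc 0 (N.length e)))
  trace_H : ∀ e, ∀ x ∈ Icc 0 (N.length e), LocallyIntegrable (fun t => H e t x)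
  trace_Q : ∀ e, ∀ x ∈ Icc 0 (N.length e), LocallyIntegrable (fun t => Q e t x)
  slice_H : ∀ e t, IntegrableOn (H e t) (Icc 0 (N.length e))
  slice_Q : ∀ e t, IntegrableOn (Q e t) (Icc 0 (N.length e))
  time_continuous_H : ∀ e t₀,
    Tendsto (fun t => ∫ x in Icc 0 (N.length e), |H e t x - H e t₀ x|) (𝓝 t₀) (𝓝 0)
  time_continuous_Q : ∀ e t₀,
    Tendsto (fun t => ∫ x in Icc 0 (N.length e), |Q e t x - Q e t₀ x|) (𝓝 t₀) (𝓝 0)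
  locallyIntegrable_F : ∀ v, LocallyIntegrable (F v)
  wave : O.IsWave (fun e x => TimeDist.ofFun fun t => H e t x)
    (fun e x => TimeDist.ofFun fun t => Q e t x) (fun v => TimeDist.ofFun (F v))

end Outlet

/-! ### Travel times and admissible sets -/

variable (N)

/-- The length of a walk through the network. -/
def walkLength {u v : V} (w : N.graph.Walk u v) : ℝ :=
  (w.darts.map fun d => N.length ⟨d.edge, d.edge_mem⟩).sum

/-- The distance of two vertices along the network. -/
def nodeDist (u v : V) : ℝ := ⨅ w : N.graph.Walk u v, N.walkLength w

/-- The travel time between two vertices. -/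
def nodeTT (u v : V) : ℝ := N.nodeDist u v / N.speed

/-- The travel time between the vertex `v` and the point with coordinate `x` on the pipe `e`. -/
def TT (v : V) (e : N.Pipe) (x : ℝ) : ℝ :=
  min (N.nodeDist v (N.node e false) + x) (N.nodeDist v (N.node e true) + (N.length e - x)) /
    N.speed

/-- A point of the network that is not a vertex. -/
structure InnerPoint where
  pipe : N.Pipe
  x : ℝ
  mem : x ∈ Ioo 0 (N.length pipe)

variable {N}

namespace Outlet

/-- The vertex `v` is cut off from `x₀` when the point `p` is removed from the network. -/
def IsCutOff (p : N.InnerPoint) (v : V) : Prop :=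
  ¬ (N.graph.deleteEdges {(p.pipe : Sym2 V)}).Reachable O.vertex v

open Classical in
/-- The admissible set `D_p`: the points of the network that are cut off from `x₀` when `p` is
removed (given by a pipe and a coordinate on it). -/
def admissibleSet (p : N.InnerPoint) : Set (N.Pipe × ℝ) :=
  {q | q.2 ∈ Icc 0 (N.length q.1) ∧
    if q.1 = p.pipe then
      (if O.IsCutOff p (N.node p.pipe false) then q.2 < p.x else p.x < q.2)
    else O.IsCutOff p (N.node q.1 false)}

open Classical in
/-- The action time: the travel time to `p` at the boundary points of `D_p`, and `0` at the other
ones. -/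
def actionTime (p : N.InnerPoint) (v : O.Port) : ℝ :=
  if O.IsCutOff p v then N.TT v p.pipe p.x else 0

/-- The boundary integral equation
`h₀ = (a / (A(x_j) g)) ν(x_j) Q(t, x_j)
  + ∑ᵢ (ν(x_i) / 2) ∫₀^τ Q(s, x_i) (k_ij(|t - s|) + k_ij(2τ - t - s)) ds`
for `τ - f(x_j) < t < τ`, in the sense of distributions of `t`. -/
def IntegralEquation [Finite V] (k : O.Port → O.Port → TimeDist) (f : O.Port → ℝ) (τ h₀ : ℝ)
    (Qp : O.Port → ℝ → ℝ) : Prop :=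
  ∀ j : O.Port, ∀ φ : TimeTest, tsupport φ ⊆ Ioo (τ - f j) τ →
    ∫ t, h₀ * φ t =
      (∫ t, N.speed / (N.endArea j.pos * N.gravity) * N.normal j.pos * Qp j t * φ t) +
      ∑ i : O.Port, N.normal i.pos / 2 *
        ((k i j).convAbs ((Icc 0 τ).indicator (Qp i)) φ +
          (k i j).convReflect (2 * τ) ((Icc 0 τ).indicator (Qp i)) φ)

end Outlet

end PipeNetwork

end

/-! Pairing a weak solution with the translates `φ (· - t)` of a test function gives functions of
`(t, x)` that are continuously differentiable in `t` and satisfy the same pipe and junction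
equations (`IsWave.isNetWave`). Estimates are proved for such functions and read back at `t = 0`.
The area is only of bounded variation, so `x`-derivatives exist off a countable set; this suffices
for the fundamental theorem of calculus.

Three facts about these waves carry the proof. Finite speed: the energy on a surface `t = s + θ(x)`
with `|θ'| < 1/a` changes only by the flux through the boundary points, since the junction fluxes
cancel (`vanish_of_lt`). The condition at `x₀` has no sign, so the outlet is treated by a bootstrap:
with constant area near `x₀`, the wave incident there was inside the pipe a fixed time earlier, and
without an incident wave nothing is emitted (`vanish_of_strict`, `vanish`). Reciprocity: the time
convolution of `h Q - q H` is the same at both ends of a pipe, hence its boundary terms sum to zero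
(`IsNetWave.reciprocity`). Sideways uniqueness: with the roles of `x` and `t` exchanged, zero
pressure and flow at one end of a pipe for `|t - τ| < r` force the wave to vanish in a cone
(`sideways`). The weighted energy is taken with a frozen impedance, and the total variation of the
impedance pays for the changes of the frozen value.

Impulse responses: before an echo can return to `x_j`, the wave there is purely outgoing, which
gives the instantaneous term and the delay `ε` of `k`. The asymmetry of `k` is a convolution at
`x₀`. It vanishes until both waves can have reached `x₀`, and it vanishes identically if both waves
satisfy one time-independent linear relation there.

Focusing: the flow at `x_j` starts only `f(x_j)` before `τ`, so until shortly after `τ` nothing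
reaches `x₀`, and points outside `D_p` other than `p` and the vertices are still at rest. Hence up
to that time the wave is a superposition of impulse responses (`exists_eq_superpose`); with an
outlet condition that varies in time this would fail in general. Let `W` be the superposition for
the flow on `[0, τ]` extended evenly about `τ`. The integral equation says that `W(t) + W(2τ - t) =
2 h₀` at the ports of `D_p` for `|t - τ| < f`, on each side of `τ`; the point `τ` itself is harmless
because the pressure is a function. The flows of `W` and of its time reversal cancel at the ports.
Thus `W` plus its time reversal minus the constant `2 h₀` has zero pressure and flow at these ports,
and sideways uniqueness, applied pipe by pipe from the ports towards `p` (`vanish_cutOff`), makes it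
vanish near `t = τ` in all of `D_p`. There `W` is still the actual pressure, so `H(t) + H(2τ - t) =
2 h₀` near `τ`, and continuity in time with values in `L¹` gives the profile at `τ`
(`ae_eq_of_even`). -/

open MeasureTheory Set Filter Topology TopologicalSpace
open scoped Distributions LineDeriv ContDiff

noncomputable section

/-! ### Translates of test functions and the continuity of distributions -/

namespace TimeTest

/-- The translate `s ↦ φ (s - t)` of a test function. -/
def shift (t : ℝ) (φ : TimeTest) : TimeTest where
  toFun s := φ (s - t)
  contDiff' := φ.contDiff.comp (contDiff_id.sub contDiff_const)
  hasCompactSupport' := φ.hasCompactSupport.comp_homeomorph (Homeomorph.subRight t)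
  tsupport_subset' := fun _ _ => trivial

@[simp] theorem shift_apply (t : ℝ) (φ : TimeTest) (s : ℝ) : shift t φ s = φ (s - t) := rfl

@[simp] theorem reflect_apply (c : ℝ) (φ : TimeTest) (s : ℝ) : reflect c φ s = φ (c - s) := rfl

@[simp] theorem mulSmooth_apply (α : ℝ → ℝ) (hα : ContDiff ℝ ∞ α) (φ : TimeTest) (s : ℝ) :
    mulSmooth α hα φ s = α s * φ s := rfl

@[simp] theorem shift_zero (φ : TimeTest) : shift 0 φ = φ := by
  ext s; simp

/-- The derivative of a test function. -/
def der (φ : TimeTest) : TimeTest := ∂_{(1 : ℝ)} φ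

theorem differentiable (φ : TimeTest) : Differentiable ℝ φ :=
  φ.contDiff.differentiable (by simp)

theorem der_apply (φ : TimeTest) (s : ℝ) : der φ s = deriv φ s := by
  have h : der φ s = lineDeriv ℝ φ s 1 :=
    TestFunction.lineDerivCLM_apply_of_le (𝕜 := ℝ) (n := ⊤) (k := ⊤) (by simp)
  rw [h, (differentiable φ s).lineDeriv_eq_fderiv, fderiv_apply_one_eq_deriv]

theorem hasDerivAt (φ : TimeTest) (s : ℝ) : HasDerivAt φ (der φ s) s := by
  rw [der_apply]
  exact (differentiable φ s).hasDerivAt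

theorem der_shift (t : ℝ) (φ : TimeTest) : der (shift t φ) = shift t (der φ) := by
  ext s
  have h : HasDerivAt (shift t φ) (der φ (s - t)) s := by
    exact (hasDerivAt φ (s - t)).comp_sub_const s t
  rw [der_apply, h.deriv, shift_apply]

theorem iterate_der_shift (n : ℕ) (t : ℝ) (φ : TimeTest) :
    der^[n] (shift t φ) = shift t (der^[n] φ) :=
  (Function.Commute.iterate_left (f := der) (g := shift t) (fun ψ => der_shift t ψ) n) φ

theorem iterate_der_apply (n : ℕ) (φ : TimeTest) (s : ℝ) :
    der^[n] φ s = iteratedDeriv n φ s := by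
  induction n generalizing s with
  | zero => simp
  | succ n ih =>
    rw [Function.iterate_succ_apply', der_apply, iteratedDeriv_succ, funext ih]

theorem tsupport_shift (t : ℝ) (φ : TimeTest) :
    tsupport (shift t φ) = (fun s => s - t) ⁻¹' tsupport φ :=
  (tsupport_comp_eq_preimage φ (Homeomorph.subRight t)).symm ▸ rfl

theorem tsupport_reflect (c : ℝ) (φ : TimeTest) :
    tsupport (reflect c φ) = (fun s => c - s) ⁻¹' tsupport φ :=
  (tsupport_comp_eq_preimage φ (Homeomorph.subLeft c)).symm ▸ rfl

/-- Test functions as bounded continuous functions. -/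
def toBCF : TimeTest →ₗ[ℝ] BoundedContinuousFunction ℝ ℝ :=
  (TestFunction.toBoundedContinuousFunctionCLM ℝ : TimeTest →L[ℝ] _).toLinearMap

@[simp] theorem toBCF_apply (φ : TimeTest) (s : ℝ) : toBCF φ s = φ s := rfl

/-- The derivative as a linear map. -/
def derLM : TimeTest →ₗ[ℝ] TimeTest where
  toFun := der
  map_add' φ ψ := by
    ext s
    rw [der_apply]
    simpa using ((hasDerivAt φ s).add (hasDerivAt ψ s)).deriv
  map_smul' c φ := by
    ext s
    rw [der_apply]
    exact ((hasDerivAt φ s).const_mul c).deriv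

/-- The jet `(φ, φ', …, φ⁽ⁿ⁾)` of a test function. -/
def jet (n : ℕ) : TimeTest →ₗ[ℝ] (Fin (n + 1) → BoundedContinuousFunction ℝ ℝ) :=
  LinearMap.pi fun i => toBCF ∘ₗ (derLM ^ (i : ℕ))

theorem jet_apply (n : ℕ) (φ : TimeTest) (i : Fin (n + 1)) :
    jet n φ i = toBCF (der^[i] φ) := by
  simp only [jet, LinearMap.pi_apply, LinearMap.comp_apply, Module.End.pow_apply]
  rfl

theorem jet_injective (n : ℕ) : Function.Injective (jet n) := by
  intro φ ψ h
  ext s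
  have := congrFun h 0
  rw [jet_apply, jet_apply] at this
  simpa using DFunLike.congr_fun this s

theorem continuous_toBCF_shift (φ : TimeTest) : Continuous fun t => toBCF (shift t φ) := by
  rw [Metric.continuous_iff]
  intro t ε hε
  obtain ⟨δ, hδ, h⟩ := Metric.uniformContinuous_iff.1
    (φ.hasCompactSupport.uniformContinuous_of_continuous φ.continuous) (ε / 2) (by positivity)
  refine ⟨δ, hδ, fun r hr => ?_⟩
  refine lt_of_le_of_lt ((BoundedContinuousFunction.dist_le (by positivity : 0 ≤ ε / 2)).2
    fun s => ?_) (half_lt_self hε)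
  exact (h (a := s - r) (b := s - t) (by simpa [dist_eq_norm, norm_sub_rev] using hr)).le

theorem continuous_jet_shift (n : ℕ) (φ : TimeTest) : Continuous fun t => jet n (shift t φ) := by
  refine continuous_pi fun i => ?_
  simp only [jet_apply, iterate_der_shift]
  exact continuous_toBCF_shift _

theorem norm_jet_shift_le (n : ℕ) (φ : TimeTest) (t : ℝ) : ‖jet n (shift t φ)‖ ≤ ‖jet n φ‖ := by
  refine (pi_norm_le_iff_of_nonneg (norm_nonneg _)).2 fun i => ?_
  refine le_trans ?_ (norm_le_pi_norm _ i)
  simp only [jet_apply, iterate_der_shift]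
  refine (BoundedContinuousFunction.norm_le (norm_nonneg _)).2 fun s => ?_
  simpa using (toBCF (der^[i] φ)).norm_coe_le_norm (s - t)

theorem smear_apply {u : ℝ → ℝ} (hu : LocallyIntegrable u) (hc : HasCompactSupport u)
    (φ : TimeTest) (r : ℝ) : smear u φ r = ∫ s, u s * φ (s + r) := by
  rw [smear, dif_pos ⟨hu, hc⟩]
  rfl

theorem integrable_of_hasCompactSupport {u : ℝ → ℝ} (hu : LocallyIntegrable u)
    (hc : HasCompactSupport u) : Integrable u := by
  rw [← integrableOn_iff_integrable_of_support_subset (subset_tsupport u)]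
  exact hu.integrableOn_isCompact hc

theorem integrable_mul {u : ℝ → ℝ} (hu : Integrable u) (φ : TimeTest) :
    Integrable fun s => u s * φ s := by
  simpa [mul_comm] using hu.bdd_mul (c := ‖toBCF φ‖) φ.continuous.aestronglyMeasurable
    (ae_of_all _ fun s => (toBCF φ).norm_coe_le_norm s)

theorem locallyIntegrable_mul {u : ℝ → ℝ} (hu : LocallyIntegrable u) (φ : TimeTest) :
    Integrable fun s => u s * φ s := by
  simpa using hu.integrable_smul_right_of_hasCompactSupport φ.continuous φ.hasCompactSupport

theorem der_smear {u : ℝ → ℝ} (hu : LocallyIntegrable u) (hc : HasCompactSupport u)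
    (φ : TimeTest) : der (smear u φ) = smear u (der φ) := by
  have hl : LocallyIntegrable fun s => u (-s) :=
    (integrable_of_hasCompactSupport hu hc).comp_neg.locallyIntegrable
  ext r
  have h1 : (smear u φ : ℝ → ℝ) = fun r => ∫ s, u s * φ (s + r) := funext (smear_apply hu hc φ)
  have hd : (der φ : ℝ → ℝ) = deriv φ := funext (der_apply φ)
  have h2 := HasCompactSupport.hasDerivAt_convolution_right (ContinuousLinearMap.mul ℝ ℝ)
    (μ := volume) hl φ.hasCompactSupport (φ.contDiff.of_le (by simp)) r
  rw [der_apply, h1, smear_eq_convolution, h2.deriv, smear_apply hu hc, hd]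
  exact (congrFun (smear_eq_convolution u (deriv φ)) r).symm

theorem iterate_der_smear {u : ℝ → ℝ} (hu : LocallyIntegrable u) (hc : HasCompactSupport u)
    (φ : TimeTest) (n : ℕ) : der^[n] (smear u φ) = smear u (der^[n] φ) :=
  (Function.Commute.iterate_left (f := der) (g := smear u) (fun ψ => der_smear hu hc ψ) n) φ

/-- The test functions supported in a closed set. -/
def supportedIn (K : Set ℝ) : Submodule ℝ TimeTest where
  carrier := {φ | ∀ s ∉ K, φ s = 0}
  add_mem' {φ ψ} hφ hψ s hs := by simp [hφ s hs, hψ s hs]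
  zero_mem' s _ := by simp
  smul_mem' c φ hφ s hs := by simp [hφ s hs]

end TimeTest

/-! ### Distributions as functionals of jets; joint continuity in position and translation. -/

namespace TimeDist

open TimeTest

/-- A continuous functional on the test functions with support in a fixed compact set is bounded by
finitely many of the seminorms of derivatives that define the topology. -/
theorem exists_jet_bound (T : TimeDist) {K : Set ℝ} (hK : IsCompact K) :
    ∃ (n : ℕ) (C : ℝ), ∀ φ ∈ supportedIn K, |T φ| ≤ C * ‖jet n φ‖ := by
  let K' : Compacts ℝ := ⟨K, hK⟩
  have hT : Continuous T := T.continuous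
  let L : 𝓓_{K'}(ℝ, ℝ) →ₗ[ℝ] ℝ :=
    { toFun := fun f => T (TestFunction.ofSupportedIn (Ω := ⊤) (fun _ _ => trivial) f)
      map_add' := fun f g => by rw [← map_add]; rfl
      map_smul' := fun c f => by rw [RingHom.id_apply, ← map_smul]; rfl }
  have hL : Continuous L := hT.comp (TestFunction.continuous_ofSupportedIn _)
  obtain ⟨s, C, -, hC⟩ := Seminorm.bound_of_continuous
    (ContDiffMapSupportedIn.withSeminorms ℝ ℝ ℝ ⊤ K') ((normSeminorm ℝ ℝ).comp L)
    (continuous_norm.comp hL)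
  obtain ⟨n, hn⟩ := s.exists_nat_subset_range
  refine ⟨n, C, fun φ hφ => ?_⟩
  let f : 𝓓_{K'}(ℝ, ℝ) := ⟨φ, φ.contDiff, fun s hs => hφ s hs⟩
  have h1 : T φ = L f := rfl
  have h2 := hC f
  rw [h1]
  refine h2.trans ?_
  change C * (s.sup (ContDiffMapSupportedIn.seminorm ℝ ℝ ℝ ⊤ K')) f ≤ _
  gcongr
  refine Seminorm.finset_sup_apply_le (norm_nonneg _) fun i hi => ?_
  have hi' : i < n + 1 := (Finset.mem_range.1 (hn hi)).trans (Nat.lt_succ_self n)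
  rw [ContDiffMapSupportedIn.seminorm_top_le_iff ℝ (norm_nonneg _)]
  intro x _
  rw [norm_iteratedFDeriv_eq_norm_iteratedDeriv]
  have h3 : iteratedDeriv i f x = jet n φ ⟨i, hi'⟩ x := by
    rw [jet_apply, toBCF_apply, iterate_der_apply]
    rfl
  rw [h3]
  exact ((jet n φ ⟨i, hi'⟩).norm_coe_le_norm x).trans (norm_le_pi_norm (jet n φ) ⟨i, hi'⟩)

/-- By Hahn–Banach the bounded functional on the space of jets extends to a Banach space of tuples
of bounded continuous functions. There Bochner integrals are available and commute with the
functional. -/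
theorem exists_dual_jet (T : TimeDist) {K : Set ℝ} (hK : IsCompact K) :
    ∃ (n : ℕ) (Λ : (Fin (n + 1) → BoundedContinuousFunction ℝ ℝ) →L[ℝ] ℝ),
      ∀ φ ∈ supportedIn K, T φ = Λ (jet n φ) := by
  obtain ⟨n, C, hC⟩ := exists_jet_bound T hK
  let e := Submodule.equivMapOfInjective (jet n) (jet_injective n) (supportedIn K)
  let L : Submodule.map (jet n) (supportedIn K) →ₗ[ℝ] ℝ :=
    { toFun := fun y => T (e.symm y)
      map_add' := fun y z => by simp
      map_smul' := fun c y => by simp }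
  have hL : ∀ y, ‖L y‖ ≤ C * ‖y‖ := by
    intro y
    obtain ⟨φ, rfl⟩ := e.surjective y
    have : L (e φ) = T φ := by simp [L]
    rw [this]
    exact hC φ φ.2
  obtain ⟨Λ, hΛ, -⟩ := exists_extension_norm_eq (𝕜 := ℝ)
    (Submodule.map (jet n) (supportedIn K)) (L.mkContinuous C hL)
  refine ⟨n, Λ, fun φ hφ => ?_⟩
  have h1 := hΛ (e ⟨φ, hφ⟩)
  have h2 : ((e ⟨φ, hφ⟩ : Submodule.map (jet n) (supportedIn K)) : _) = jet n φ := rfl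
  rw [h2] at h1
  rw [h1]
  simp [L]

theorem exists_interval (φ : TimeTest) : ∃ R > 0, ∀ s, R < |s| → φ s = 0 := by
  obtain ⟨R, hR⟩ := φ.hasCompactSupport.isBounded.subset_closedBall 0
  refine ⟨max R 1, by positivity, fun s hs => ?_⟩
  by_contra h
  have := hR (subset_tsupport φ h)
  simp at this
  exact absurd (hs.trans_le (this.trans (le_max_left _ _))) (lt_irrefl _)

theorem shift_mem_supportedIn {φ : TimeTest} {R M t : ℝ} (hR : ∀ s, R < |s| → φ s = 0)
    (ht : |t| ≤ M) : shift t φ ∈ supportedIn (Icc (-(R + M)) (R + M)) := by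
  intro s hs
  refine hR _ ?_
  rw [mem_Icc, ← abs_le, not_le] at hs
  have := abs_sub_abs_le_abs_sub s t
  linarith

theorem continuous_shift (T : TimeDist) (φ : TimeTest) : Continuous fun t => T (shift t φ) := by
  obtain ⟨R, -, hR⟩ := exists_interval φ
  rw [continuous_iff_continuousAt]
  intro t
  obtain ⟨n, Λ, hΛ⟩ := exists_dual_jet T (isCompact_Icc (a := -(R + (|t| + 1))) (b := R + (|t| + 1)))
  have h : Continuous fun r => Λ (jet n (shift r φ)) := Λ.continuous.comp (continuous_jet_shift n φ)
  refine h.continuousAt.congr ?_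
  filter_upwards [Metric.ball_mem_nhds t one_pos] with r hr
  refine (hΛ _ (shift_mem_supportedIn hR ?_)).symm
  have := abs_sub_abs_le_abs_sub r t
  rw [Metric.mem_ball, Real.dist_eq] at hr
  linarith

/-- The jet of `smear u φ` is the Bochner integral of `u s` times the jet of the translate `shift
(-s) φ`, because `smear` commutes with differentiation. The functional of `exists_dual_jet` passes
through this integral. -/
theorem apply_smear (T : TimeDist) {u : ℝ → ℝ} (hu : LocallyIntegrable u)
    (hc : HasCompactSupport u) (φ : TimeTest) :
    T (smear u φ) = ∫ s, u s * T (shift (-s) φ) := by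
  obtain ⟨R, hR0, hR⟩ := exists_interval φ
  obtain ⟨M, hM⟩ := hc.isBounded.subset_closedBall 0
  have hu' : Integrable u := integrable_of_hasCompactSupport hu hc
  have hM' : ∀ s, u s ≠ 0 → |s| ≤ M := fun s hs => by
    simpa using hM (subset_tsupport u hs)
  obtain ⟨n, Λ, hΛ⟩ := exists_dual_jet T (isCompact_Icc (a := -(R + M)) (b := R + M))
  let γ : ℝ → (Fin (n + 1) → BoundedContinuousFunction ℝ ℝ) := fun s => jet n (shift (-s) φ)
  have hγ : Continuous γ := (continuous_jet_shift n φ).comp continuous_neg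
  have hI : Integrable (u • γ) := hu'.smul_bdd ‖jet n φ‖ hγ.aestronglyMeasurable
    (ae_of_all _ fun s => norm_jet_shift_le n φ (-s))
  have h1 : ∀ s, u s * T (shift (-s) φ) = Λ ((u • γ) s) := by
    intro s
    by_cases hs : u s = 0
    · simp [hs]
    · rw [Pi.smul_apply', map_smul, smul_eq_mul, hΛ _ (shift_mem_supportedIn hR ?_)]
      rw [abs_neg]
      exact hM' s hs
  simp only [h1]
  rw [ContinuousLinearMap.integral_comp_comm Λ hI]
  have hmem : smear u φ ∈ supportedIn (Icc (-(R + M)) (R + M)) := by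
    intro r hr
    rw [smear_apply hu hc]
    refine integral_eq_zero_of_ae (ae_of_all _ fun s => ?_)
    by_cases hs : u s = 0
    · simp [hs]
    · have := shift_mem_supportedIn hR (t := -s) (by rw [abs_neg]; exact hM' s hs) r hr
      simp only [shift_apply, sub_neg_eq_add] at this
      simp [add_comm s r, this]
  rw [hΛ _ hmem]
  congr 1
  ext i r
  have e1 : (∫ s, (u • γ) s) i r = ∫ s, ((u • γ) s) i r :=
    (((BoundedContinuousFunction.evalCLM ℝ r).comp
      (ContinuousLinearMap.proj (R := ℝ)
        (φ := fun _ : Fin (n + 1) => BoundedContinuousFunction ℝ ℝ) i)).integral_comp_comm hI).symm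
  rw [e1, jet_apply, iterate_der_smear hu hc, toBCF_apply, smear_apply hu hc]
  refine integral_congr_ae (ae_of_all _ fun s => ?_)
  simp [γ, jet_apply, iterate_der_shift, add_comm]

theorem timeDeriv_apply (T : TimeDist) (φ : TimeTest) : T.timeDeriv φ = -T (der φ) := by
  rw [timeDeriv, Distribution.lineDerivOp_apply_apply, map_neg]
  rfl

/-- The difference of two translates is the `smear` of the derivative with an indicator function.
The interval is `(-b, -a]` because `smear` translates by `-s`. -/
theorem sub_shift_eq_integral (T : TimeDist) (φ : TimeTest) {a b : ℝ} (hab : a ≤ b) :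
    T (shift a φ) - T (shift b φ) = ∫ s in a..b, T (shift s (der φ)) := by
  let u : ℝ → ℝ := (Ioc (-b) (-a)).indicator 1
  have hu : Integrable u := (integrable_indicator_iff measurableSet_Ioc).2
    continuous_one.integrableOn_Ioc
  have hc : HasCompactSupport u :=
    HasCompactSupport.of_support_subset_isCompact (isCompact_Icc (a := -b) (b := -a))
      (fun s hs => Ioc_subset_Icc_self (by_contra fun h => hs (indicator_of_notMem h _)))
  have h1 : smear u (der φ) = shift a φ - shift b φ := by
    ext r
    rw [smear_apply hu.locallyIntegrable hc]
    have : ∀ s, u s * der φ (s + r) = (Ioc (-b) (-a)).indicator (fun s => der φ (s + r)) s := by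
      intro s
      by_cases h : s ∈ Ioc (-b) (-a) <;> simp [u, h]
    simp only [this]
    rw [integral_indicator measurableSet_Ioc, ← intervalIntegral.integral_of_le (by linarith),
      intervalIntegral.integral_eq_sub_of_hasDerivAt (f := fun s => φ (s + r))]
    · simp [sub_eq_add_neg, add_comm]
    · intro s _
      simpa using (hasDerivAt φ (s + r)).comp_add_const s r
    · exact ((der φ).continuous.comp (continuous_id.add continuous_const)).intervalIntegrable _ _
  rw [← map_sub, ← h1, apply_smear T hu.locallyIntegrable hc]
  have : ∀ s, u s * T (shift (-s) (der φ)) =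
      (Ioc (-b) (-a)).indicator (fun s => T (shift (-s) (der φ))) s := by
    intro s
    by_cases h : s ∈ Ioc (-b) (-a) <;> simp [u, h]
  simp only [this]
  rw [integral_indicator measurableSet_Ioc, ← intervalIntegral.integral_of_le (by linarith),
    intervalIntegral.integral_comp_neg (fun s => T (shift s (der φ)))]
  simp

theorem hasDerivAt_shift (T : TimeDist) (φ : TimeTest) (t : ℝ) :
    HasDerivAt (fun t => T (shift t φ)) (T.timeDeriv (shift t φ)) t := by
  have hc := continuous_shift T (der φ)
  have h : (fun t => T (shift t φ)) = fun t =>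
      T (shift 0 φ) - ∫ s in (0 : ℝ)..t, T (shift s (der φ)) := by
    funext r
    rcases le_total 0 r with hr | hr
    · rw [← sub_shift_eq_integral T φ hr]; ring
    · rw [intervalIntegral.integral_symm, ← sub_shift_eq_integral T φ hr]; ring
  rw [h, timeDeriv_apply, der_shift]
  exact (intervalIntegral.integral_hasDerivAt_right (hc.intervalIntegrable _ _)
    (hc.stronglyMeasurableAtFilter _ _) hc.continuousAt).const_sub _

/-- Integration against a bounded continuous function, as a functional on `L¹`. -/
def pairL1 (μ : Measure ℝ) (g : ℝ → ℝ) (hg : Continuous g) (C : ℝ)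
    (hC : ∀ᵐ s ∂μ, ‖g s‖ ≤ C) : Lp ℝ 1 μ →L[ℝ] ℝ :=
  LinearMap.mkContinuous
    { toFun := fun f => ∫ s, g s * f s ∂μ
      map_add' := fun f₁ f₂ => by
        rw [← integral_add ((L1.integrable_coeFn f₁).bdd_mul hg.aestronglyMeasurable hC)
          ((L1.integrable_coeFn f₂).bdd_mul hg.aestronglyMeasurable hC)]
        refine integral_congr_ae ?_
        filter_upwards [Lp.coeFn_add f₁ f₂] with s hs
        rw [hs, Pi.add_apply, mul_add]
      map_smul' := fun c f => by
        rw [RingHom.id_apply, smul_eq_mul, ← integral_const_mul]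
        refine integral_congr_ae ?_
        filter_upwards [Lp.coeFn_smul c f] with s hs
        rw [hs, Pi.smul_apply, smul_eq_mul]
        ring }
    C (fun f => by
      rw [L1.norm_eq_integral_norm, ← integral_const_mul]
      refine norm_integral_le_of_norm_le ((L1.integrable_coeFn f).norm.const_mul C) ?_
      filter_upwards [hC] with s hs
      rw [norm_mul]
      gcongr)

theorem pairL1_apply (μ : Measure ℝ) (g : ℝ → ℝ) (hg : Continuous g) (C : ℝ)
    (hC : ∀ᵐ s ∂μ, ‖g s‖ ≤ C) (f : Lp ℝ 1 μ) :
    pairL1 μ g hg C hC f = ∫ s, g s * f s ∂μ := rfl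

/-- Testing with indicators bounds the averages of `g` over all measurable sets, so the bound holds
almost everywhere. The set where a continuous function exceeds it is open, hence empty inside the
interval. -/
theorem le_norm_pairL1 {M : ℝ} (g : ℝ → ℝ) (hg : Continuous g) (C : ℝ)
    (hC : ∀ᵐ s ∂(volume.restrict (Icc (-M) M)), ‖g s‖ ≤ C) {s : ℝ} (hs : s ∈ Ioo (-M) M) :
    g s ≤ ‖pairL1 _ g hg C hC‖ := by
  set μ := volume.restrict (Icc (-M) M) with hμ
  set B := ‖pairL1 _ g hg C hC‖ with hB
  have hae : g ≤ᵐ[μ] fun _ => B := by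
    refine ae_le_of_forall_setIntegral_le (hg.integrableOn_Icc) (integrable_const _)
      fun A hA hAμ => ?_
    have h1 := (le_abs_self _).trans
      ((pairL1 _ g hg C hC).le_opNorm (indicatorConstLp 1 hA hAμ.ne (1 : ℝ)))
    have h2 : pairL1 _ g hg C hC (indicatorConstLp 1 hA hAμ.ne (1 : ℝ)) = ∫ s in A, g s ∂μ := by
      rw [pairL1_apply, ← integral_indicator hA]
      refine integral_congr_ae ?_
      filter_upwards [indicatorConstLp_coeFn (p := 1) (hs := hA) (hμs := hAμ.ne) (c := (1 : ℝ))]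
        with r hr
      rw [hr]
      by_cases h : r ∈ A <;> simp [h]
    rw [h2, norm_indicatorConstLp one_ne_zero ENNReal.one_ne_top] at h1
    simpa [mul_comm] using h1
  by_contra h
  have hopen : IsOpen (Ioo (-M) M ∩ {r | B < g r}) :=
    isOpen_Ioo.inter (isOpen_lt continuous_const hg)
  have hpos := hopen.measure_pos volume ⟨s, hs, not_le.1 h⟩
  have hz : μ {r | ¬ g r ≤ B} = 0 := hae
  rw [hμ, Measure.restrict_apply' measurableSet_Icc] at hz
  refine hpos.ne' (measure_mono_null (fun r hr => ?_) hz)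
  exact ⟨not_le.2 hr.2, Ioo_subset_Icc_self hr.1⟩

/-- Weak continuity in `x` bounds `T x (smear u φ)` for each fixed integrable `u`. Read as
functionals of `u ∈ L¹`, these are pointwise bounded in `x`, hence uniformly bounded by
Banach–Steinhaus; their norms control the values at the translates by `le_norm_pairL1`. -/
theorem exists_uniform_bound {ℓ : ℝ} {T : ℝ → TimeDist}
    (hT : ∀ φ, ContinuousOn (fun x => T x φ) (Icc 0 ℓ)) (φ : TimeTest) (M : ℝ) :
    ∃ B, ∀ x ∈ Icc 0 ℓ, ∀ t, |t| < M → |T x (shift t φ)| ≤ B := by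
  let g : ℝ → ℝ → ℝ := fun x s => T x (shift (-s) φ)
  have hg : ∀ x, Continuous (g x) := fun x => (continuous_shift (T x) φ).comp continuous_neg
  have hbd : ∀ x, ∃ C, ∀ᵐ s ∂(volume.restrict (Icc (-M) M)), ‖g x s‖ ≤ C := by
    intro x
    obtain ⟨C, hC⟩ := isCompact_Icc.exists_bound_of_continuousOn (hg x).continuousOn
    exact ⟨C, (ae_restrict_mem measurableSet_Icc).mono hC⟩
  choose C hC using hbd
  let Λ : Icc 0 ℓ → Lp ℝ 1 (volume.restrict (Icc (-M) M)) →L[ℝ] ℝ :=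
    fun x => pairL1 _ (g x) (hg x) (C x) (hC x)
  have hΛ : ∀ f, ∃ B, ∀ x, ‖Λ x f‖ ≤ B := by
    intro f
    let u : ℝ → ℝ := (Icc (-M) M).indicator f
    have hu : Integrable u := (integrable_indicator_iff measurableSet_Icc).2 (L1.integrable_coeFn f)
    have hc : HasCompactSupport u :=
      HasCompactSupport.of_support_subset_isCompact (isCompact_Icc (a := -M) (b := M))
        support_indicator_subset
    obtain ⟨B, hB⟩ := isCompact_Icc.exists_bound_of_continuousOn (hT (smear u φ))
    refine ⟨B, fun x => ?_⟩
    have : Λ x f = T x (smear u φ) := by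
      rw [apply_smear (T x) hu.locallyIntegrable hc, pairL1_apply,
        ← integral_indicator measurableSet_Icc]
      refine integral_congr_ae (ae_of_all _ fun s => ?_)
      by_cases h : s ∈ Icc (-M) M
      · simp [u, h, g, mul_comm]
      · simp [u, h]
    rw [this]
    exact hB x x.2
  obtain ⟨B, hB⟩ := banach_steinhaus hΛ
  have hneg : ∀ x, ∀ᵐ s ∂(volume.restrict (Icc (-M) M)), ‖-g x s‖ ≤ C x := fun x => by
    simpa using hC x
  refine ⟨B, fun x hx t ht => ?_⟩
  have ht' : -t ∈ Ioo (-M) M := by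
    rw [abs_lt] at ht
    constructor <;> linarith [ht.1, ht.2]
  rw [abs_le']
  have e : T x (shift t φ) = g x (-t) := by simp [g]
  have hn : ‖pairL1 _ (fun s => -g x s) (hg x).neg (C x) (hneg x)‖ = ‖Λ ⟨x, hx⟩‖ := by
    rw [← norm_neg]
    congr 1
    ext f
    simp [Λ, pairL1_apply, integral_neg]
  constructor
  · rw [e]
    exact (le_norm_pairL1 (g x) (hg x) (C x) (hC x) ht').trans (hB ⟨x, hx⟩)
  · rw [e]
    exact (le_norm_pairL1 (fun s => -g x s) (hg x).neg (C x) (hneg x) ht').trans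
      (hn.le.trans (hB ⟨x, hx⟩))

/-- Distributions that depend weakly continuously on `x` depend jointly continuously on `x` and on
a translation. -/
theorem continuousOn_shift {ℓ : ℝ} {T : ℝ → TimeDist}
    (hT : ∀ φ, ContinuousOn (fun x => T x φ) (Icc 0 ℓ)) (φ : TimeTest) :
    ContinuousOn (fun w : ℝ × ℝ => T w.2 (shift w.1 φ)) (univ ×ˢ Icc 0 ℓ) := by
  rintro ⟨t₀, x₀⟩ ⟨-, hx₀⟩
  obtain ⟨B, hB⟩ := exists_uniform_bound hT (der φ) (|t₀| + 1)
  rw [ContinuousWithinAt, tendsto_iff_norm_sub_tendsto_zero]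
  have h1 : Tendsto (fun w : ℝ × ℝ => B * |w.1 - t₀| + ‖T w.2 (shift t₀ φ) - T x₀ (shift t₀ φ)‖)
      (𝓝[univ ×ˢ Icc 0 ℓ] (t₀, x₀)) (𝓝 (B * |t₀ - t₀| + 0)) := by
    refine Tendsto.add ?_ ?_
    · refine Tendsto.mono_left ?_ nhdsWithin_le_nhds
      exact Continuous.tendsto (by fun_prop) (t₀, x₀)
    · have h2 := tendsto_iff_norm_sub_tendsto_zero.1 (hT (shift t₀ φ) x₀ hx₀)
      refine h2.comp ?_
      refine tendsto_nhdsWithin_iff.2 ⟨?_, ?_⟩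
      · exact (continuous_snd.tendsto (t₀, x₀)).mono_left nhdsWithin_le_nhds
      · filter_upwards [self_mem_nhdsWithin] with w hw using hw.2
  simp only [sub_self, abs_zero, mul_zero, add_zero] at h1
  refine squeeze_zero' (Eventually.of_forall fun _ => norm_nonneg _) ?_ h1
  have hball : ∀ᶠ w : ℝ × ℝ in 𝓝[univ ×ˢ Icc 0 ℓ] (t₀, x₀), |w.1 - t₀| < 1 := by
    refine nhdsWithin_le_nhds ?_
    exact (continuous_fst.tendsto (t₀, x₀)).eventually (Metric.ball_mem_nhds t₀ one_pos)
  filter_upwards [self_mem_nhdsWithin, hball] with w hw hw1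
  -- The time derivative is the pairing with `-φ'`, so the uniform bound for `der φ` is a Lipschitz
  -- constant in time that does not depend on the position.
  have key : ‖T w.2 (shift w.1 φ) - T w.2 (shift t₀ φ)‖ ≤ B * ‖w.1 - t₀‖ := by
    refine (convex_ball t₀ 1).norm_image_sub_le_of_norm_hasDerivWithin_le
      (f := fun t => T w.2 (shift t φ)) (f' := fun t => (T w.2).timeDeriv (shift t φ))
      (fun t _ => (hasDerivAt_shift (T w.2) φ t).hasDerivWithinAt) (fun t ht => ?_)
      (Metric.mem_ball_self one_pos) (by simpa [Real.dist_eq] using hw1)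
    rw [timeDeriv_apply, der_shift, norm_neg]
    refine hB _ hw.2 _ ?_
    have := abs_sub_abs_le_abs_sub t t₀
    rw [Metric.mem_ball, Real.dist_eq] at ht
    linarith
  calc ‖T w.2 (shift w.1 φ) - T x₀ (shift t₀ φ)‖
      ≤ ‖T w.2 (shift w.1 φ) - T w.2 (shift t₀ φ)‖ + ‖T w.2 (shift t₀ φ) - T x₀ (shift t₀ φ)‖ :=
        norm_sub_le_norm_sub_add_norm_sub _ _ _
    _ ≤ _ := by gcongr; exact key

end TimeDist

/-! ### Waves on a single pipe -/

/-- A positive function of bounded variation that is bounded away from `0`. -/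
structure IsProfile (Z : ℝ → ℝ) : Prop where
  lower : ∃ c > 0, ∀ x, c ≤ Z x
  bv : BoundedVariationOn Z univ

namespace IsProfile

variable {Z : ℝ → ℝ}

theorem pos (hZ : IsProfile Z) (x : ℝ) : 0 < Z x := by
  obtain ⟨c, hc, h⟩ := hZ.lower
  exact hc.trans_le (h x)

theorem upper (hZ : IsProfile Z) : ∃ C > 0, ∀ x, Z x ≤ C := by
  refine ⟨Z 0 + (eVariationOn Z univ).toReal, ?_, fun x => ?_⟩
  · have := hZ.pos 0
    positivity
  · have := hZ.bv.sub_le (mem_univ x) (mem_univ 0)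
    linarith

theorem exists_sub (hZ : IsProfile Z) : ∃ p q : ℝ → ℝ, Monotone p ∧ Monotone q ∧ Z = p - q := by
  obtain ⟨p, q, hp, hq, h⟩ := hZ.bv.locallyBoundedVariationOn.exists_monotoneOn_sub_monotoneOn
  exact ⟨p, q, monotoneOn_univ.1 hp, monotoneOn_univ.1 hq, h⟩

theorem measurable (hZ : IsProfile Z) : Measurable Z := by
  obtain ⟨p, q, hp, hq, rfl⟩ := hZ.exists_sub
  exact hp.measurable.sub hq.measurable

/-- This is why all identities in `x` can be integrated: the differential equations hold pointwise
off a countable set. -/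
theorem countable (hZ : IsProfile Z) : {x | ¬ ContinuousAt Z x}.Countable := by
  obtain ⟨p, q, hp, hq, rfl⟩ := hZ.exists_sub
  refine (hp.countable_not_continuousAt.union hq.countable_not_continuousAt).mono fun x hx => ?_
  by_contra h
  simp only [mem_union, mem_ofPred_eq, not_or, not_not] at h
  exact hx (h.1.sub h.2)

theorem inv_le (hZ : IsProfile Z) : ∃ C > 0, ∀ x, (Z x)⁻¹ ≤ C := by
  obtain ⟨c, hc, h⟩ := hZ.lower
  exact ⟨c⁻¹, by positivity, fun x => inv_anti₀ hc (h x)⟩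

theorem reflect (hZ : IsProfile Z) (ℓ : ℝ) : IsProfile fun x => Z (ℓ - x) := by
  obtain ⟨c, hc, h⟩ := hZ.lower
  refine ⟨⟨c, hc, fun x => h _⟩, ?_⟩
  have : Antitone fun x : ℝ => ℓ - x := fun x y hxy => by dsimp; linarith
  exact ne_top_of_le_ne_top hZ.bv
    (eVariationOn.comp_le_of_antitoneOn Z _ (this.antitoneOn univ) (mapsTo_univ _ _))

/-- Every integrand met below has this form: the impedance enters only through `Z` and `Z⁻¹`, with
continuous coefficients. -/
theorem integrable_combination (hZ : IsProfile Z) {A B C : ℝ → ℝ → ℝ} (hA : Continuous (Function.uncurry A))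
    (hB : Continuous (Function.uncurry B)) (hC : Continuous (Function.uncurry C))
    (t₁ t₂ x₁ x₂ : ℝ) :
    Integrable (fun w : ℝ × ℝ => Z w.2 * A w.1 w.2 + (Z w.2)⁻¹ * B w.1 w.2 + C w.1 w.2)
      ((volume.restrict (Ioc t₁ t₂)).prod (volume.restrict (Ioc x₁ x₂))) := by
  have key : ∀ F : ℝ × ℝ → ℝ, Continuous F →
      Integrable F ((volume.restrict (Ioc t₁ t₂)).prod (volume.restrict (Ioc x₁ x₂))) := by
    intro F hF
    rw [Measure.prod_restrict]
    refine (hF.locallyIntegrable.integrableOn_isCompact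
      (isCompact_Icc.prod isCompact_Icc : IsCompact (Icc t₁ t₂ ×ˢ Icc x₁ x₂))).mono_set ?_
    exact prod_mono Ioc_subset_Icc_self Ioc_subset_Icc_self
  obtain ⟨c, hc, hc'⟩ := hZ.upper
  obtain ⟨d, hd, hd'⟩ := hZ.inv_le
  refine ((Integrable.bdd_mul (c := c) (key _ hA)
    (hZ.measurable.comp measurable_snd).aestronglyMeasurable ?_).add
    (Integrable.bdd_mul (c := d) (key _ hB)
      (hZ.measurable.inv.comp measurable_snd).aestronglyMeasurable ?_)).add (key _ hC)
  · refine ae_of_all _ fun w => ?_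
    rw [Function.comp_apply, Real.norm_of_nonneg (hZ.pos _).le]
    exact hc' _
  · refine ae_of_all _ fun w => ?_
    rw [Function.comp_apply, Pi.inv_apply, Real.norm_of_nonneg (inv_pos.2 (hZ.pos _)).le]
    exact hd' _

theorem intervalIntegrable_combination (hZ : IsProfile Z) {A B C : ℝ → ℝ} (hA : Continuous A)
    (hB : Continuous B) (hC : Continuous C) (x₁ x₂ : ℝ) :
    IntervalIntegrable (fun x => Z x * A x + (Z x)⁻¹ * B x + C x) volume x₁ x₂ := by
  have key : ∀ x₁ x₂, IntegrableOn (fun x => Z x * A x + (Z x)⁻¹ * B x + C x) (Ioc x₁ x₂) := by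
    intro x₁ x₂
    obtain ⟨c, hc, hc'⟩ := hZ.upper
    obtain ⟨d, hd, hd'⟩ := hZ.inv_le
    refine ((Integrable.bdd_mul (c := c) hA.integrableOn_Ioc
      hZ.measurable.aestronglyMeasurable ?_).add
      (Integrable.bdd_mul (c := d) hB.integrableOn_Ioc
        hZ.measurable.inv.aestronglyMeasurable ?_)).add hC.integrableOn_Ioc
    · refine ae_of_all _ fun w => ?_
      rw [Real.norm_of_nonneg (hZ.pos _).le]
      exact hc' _
    · refine ae_of_all _ fun w => ?_
      rw [Pi.inv_apply, Real.norm_of_nonneg (inv_pos.2 (hZ.pos _)).le]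
      exact hd' _
  exact ⟨key _ _, key _ _⟩

/-- The fundamental theorem of calculus in `x`, integrated over a time interval. -/
theorem integral_sub_integral (hZ : IsProfile Z) {f A B C : ℝ → ℝ → ℝ}
    (hf : Continuous (Function.uncurry f)) (hA : Continuous (Function.uncurry A))
    (hB : Continuous (Function.uncurry B)) (hC : Continuous (Function.uncurry C))
    {t₁ t₂ x₁ x₂ : ℝ} (ht : t₁ ≤ t₂) (hx : x₁ ≤ x₂)
    (hd : ∀ t, ∀ x ∈ Ioo x₁ x₂, ContinuousAt Z x →
      HasDerivAt (fun y => f t y) (Z x * A t x + (Z x)⁻¹ * B t x + C t x) x) :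
    (∫ t in t₁..t₂, f t x₂) - ∫ t in t₁..t₂, f t x₁ =
      ∫ x in x₁..x₂, ∫ t in t₁..t₂, (Z x * A t x + (Z x)⁻¹ * B t x + C t x) := by
  have hsec : ∀ t, f t x₂ - f t x₁ =
      ∫ x in x₁..x₂, (Z x * A t x + (Z x)⁻¹ * B t x + C t x) := by
    intro t
    -- Continuity everywhere together with differentiability off the countable set of jumps of `Z`
    -- suffices here.
    refine (integral_eq_of_hasDerivAt_off_countable_of_le _ _ hx
      hZ.countable ?_ (fun x hx' => hd t x hx'.1 (not_not.1 hx'.2)) ?_).symm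
    · exact (hf.comp (Continuous.prodMk_right t)).continuousOn
    · exact hZ.intervalIntegrable_combination (hA.comp (Continuous.prodMk_right t))
        (hB.comp (Continuous.prodMk_right t)) (hC.comp (Continuous.prodMk_right t)) _ _
  have hcf : ∀ x, Continuous fun t => f t x := fun x => hf.comp (Continuous.prodMk_left x)
  rw [← intervalIntegral.integral_sub ((hcf _).intervalIntegrable _ _)
    ((hcf _).intervalIntegrable _ _)]
  simp only [hsec]
  simp only [intervalIntegral.integral_of_le ht, intervalIntegral.integral_of_le hx]
  exact integral_integral_swap (hZ.integrable_combination hA hB hC _ _ _ _)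

end IsProfile

/-- Waves on the segment from `0` to `ℓ` with impedance `Z = g A / a`: continuous functions
`H t x`, `Q t x` with continuous time derivatives `H'`, `Q'`, such that
`∂ₓ H = -Q' / (a Z)` and `∂ₓ Q = -Z H' / a`. -/
structure IsPipeWave (a ℓ : ℝ) (Z : ℝ → ℝ) (H Q H' Q' : ℝ → ℝ → ℝ) : Prop where
  continuous_H : Continuous (Function.uncurry H)
  continuous_Q : Continuous (Function.uncurry Q)
  continuous_H' : Continuous (Function.uncurry H')
  continuous_Q' : Continuous (Function.uncurry Q')
  deriv_H : ∀ t x, HasDerivAt (fun s => H s x) (H' t x) t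
  deriv_Q : ∀ t x, HasDerivAt (fun s => Q s x) (Q' t x) t
  eq_H : ∀ t, ∀ x ∈ Icc 0 ℓ, H t x - H t 0 = ∫ y in (0)..x, -(a⁻¹ * ((Z y)⁻¹ * Q' t y))
  eq_Q : ∀ t, ∀ x ∈ Icc 0 ℓ, Q t x - Q t 0 = ∫ y in (0)..x, -(a⁻¹ * (Z y * H' t y))

/-- The `x`-derivative is known at isolated points only, so joint differentiability is not
available. Instead the change in time is written as `(y - x) * m y` with `m` continuous, which uses
the continuity of the time derivative alone. -/
theorem hasDerivAt_slant {F F' : ℝ → ℝ → ℝ} (hF' : Continuous (Function.uncurry F'))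
    (hd : ∀ t x, HasDerivAt (fun s => F s x) (F' t x) t) {s σ x D : ℝ}
    (hD : HasDerivAt (fun y => F (s + σ * x) y) D x) :
    HasDerivAt (fun y => F (s + σ * y) y) (σ * F' (s + σ * x) x + D) x := by
  let m : ℝ → ℝ := fun y => ∫ r in (0 : ℝ)..1, σ * F' (s + σ * x + r * (σ * (y - x))) y
  have hm : Continuous m := by
    refine intervalIntegral.continuous_parametric_intervalIntegral_of_continuous' ?_ _ _
    exact continuous_const.mul (hF'.comp (by fun_prop : Continuous fun p : ℝ × ℝ =>
      ((s + σ * x + p.2 * (σ * (p.1 - x)), p.1) : ℝ × ℝ)))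
  have h1 : ∀ y, F (s + σ * y) y - F (s + σ * x) y = (y - x) * m y := by
    intro y
    have h2 : ∀ r ∈ uIcc (0 : ℝ) 1, HasDerivAt (fun r => F (s + σ * x + r * (σ * (y - x))) y)
        (F' (s + σ * x + r * (σ * (y - x))) y * (σ * (y - x))) r := by
      intro r _
      have := (hd (s + σ * x + r * (σ * (y - x))) y).comp r
        (((hasDerivAt_id r).mul_const (σ * (y - x))).const_add (s + σ * x))
      rw [one_mul] at this
      exact this
    have h3 := intervalIntegral.integral_eq_sub_of_hasDerivAt h2 (by
      refine Continuous.intervalIntegrable ?_ _ _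
      exact (hF'.comp (by fun_prop : Continuous fun r : ℝ =>
        ((s + σ * x + r * (σ * (y - x)), y) : ℝ × ℝ))).mul continuous_const)
    have e1 : s + σ * x + 1 * (σ * (y - x)) = s + σ * y := by ring
    have e2 : s + σ * x + 0 * (σ * (y - x)) = s + σ * x := by ring
    rw [e1, e2] at h3
    rw [← h3, ← intervalIntegral.integral_const_mul]
    congr 1
    funext r
    ring
  have h4 : HasDerivAt (fun y => (y - x) * m y) (m x) x := by
    rw [hasDerivAt_iff_tendsto_slope]
    refine (hm.continuousAt.tendsto.mono_left nhdsWithin_le_nhds).congr' ?_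
    filter_upwards [self_mem_nhdsWithin] with y hy
    have : y - x ≠ 0 := sub_ne_zero.2 hy
    simp [slope_def_field]
    field_simp
  have h5 : m x = σ * F' (s + σ * x) x := by simp [m]
  have h6 : (fun y => F (s + σ * y) y) = fun y => (y - x) * m y + F (s + σ * x) y := by
    funext y
    rw [← h1]; ring
  rw [h6, ← h5]
  exact h4.add hD

/-! ### Pointwise wave equations, also along slanted lines, and reversal of a pipe. -/

namespace IsPipeWave

variable {a ℓ : ℝ} {Z : ℝ → ℝ} {H Q H' Q' : ℝ → ℝ → ℝ}

theorem hasDerivAt_H (hZ : IsProfile Z) (w : IsPipeWave a ℓ Z H Q H' Q')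
    (t : ℝ) {x : ℝ} (hx : x ∈ Ioo 0 ℓ) (hc : ContinuousAt Z x) :
    HasDerivAt (fun y => H t y) (-(a⁻¹ * ((Z x)⁻¹ * Q' t x))) x := by
  have hQ' : Continuous fun y => Q' t y := w.continuous_Q'.comp (Continuous.prodMk_right t)
  have hmeas : Measurable fun y => -(a⁻¹ * ((Z y)⁻¹ * Q' t y)) :=
    ((hZ.measurable.inv.mul hQ'.measurable).const_mul _).neg
  have h := intervalIntegral.integral_hasDerivAt_right
    (f := fun y => -(a⁻¹ * ((Z y)⁻¹ * Q' t y))) (a := 0) (b := x)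
    (by
      have := hZ.intervalIntegrable_combination (A := 0) (B := fun y => -(a⁻¹ * Q' t y)) (C := 0)
        continuous_const (continuous_const.mul hQ').neg continuous_const 0 x
      refine this.congr (fun y _ => ?_)
      simp; ring)
    hmeas.stronglyMeasurable.stronglyMeasurableAtFilter
    ((continuousAt_const.mul ((hc.inv₀ (hZ.pos x).ne').mul hQ'.continuousAt)).neg)
  refine (h.const_add (H t 0)).congr_of_eventuallyEq ?_
  filter_upwards [Ioo_mem_nhds hx.1 hx.2] with y hy
  rw [← w.eq_H t y (Ioo_subset_Icc_self hy)]
  ring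

theorem hasDerivAt_Q (hZ : IsProfile Z) (w : IsPipeWave a ℓ Z H Q H' Q')
    (t : ℝ) {x : ℝ} (hx : x ∈ Ioo 0 ℓ) (hc : ContinuousAt Z x) :
    HasDerivAt (fun y => Q t y) (-(a⁻¹ * (Z x * H' t x))) x := by
  have hH' : Continuous fun y => H' t y := w.continuous_H'.comp (Continuous.prodMk_right t)
  have hmeas : Measurable fun y => -(a⁻¹ * (Z y * H' t y)) :=
    ((hZ.measurable.mul hH'.measurable).const_mul _).neg
  have h := intervalIntegral.integral_hasDerivAt_right
    (f := fun y => -(a⁻¹ * (Z y * H' t y))) (a := 0) (b := x)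
    (by
      have := hZ.intervalIntegrable_combination (B := 0) (A := fun y => -(a⁻¹ * H' t y)) (C := 0)
        (continuous_const.mul hH').neg continuous_const continuous_const 0 x
      refine this.congr (fun y _ => ?_)
      simp; ring)
    hmeas.stronglyMeasurable.stronglyMeasurableAtFilter
    ((continuousAt_const.mul (hc.mul hH'.continuousAt)).neg)
  refine (h.const_add (Q t 0)).congr_of_eventuallyEq ?_
  filter_upwards [Ioo_mem_nhds hx.1 hx.2] with y hy
  rw [← w.eq_Q t y (Ioo_subset_Icc_self hy)]
  ring

theorem hasDerivAt_slant_H (hZ : IsProfile Z) (w : IsPipeWave a ℓ Z H Q H' Q')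
    (s σ : ℝ) {x : ℝ} (hx : x ∈ Ioo 0 ℓ) (hc : ContinuousAt Z x) :
    HasDerivAt (fun y => H (s + σ * y) y)
      (σ * H' (s + σ * x) x + -(a⁻¹ * ((Z x)⁻¹ * Q' (s + σ * x) x))) x :=
  hasDerivAt_slant w.continuous_H' w.deriv_H (w.hasDerivAt_H hZ _ hx hc)

theorem hasDerivAt_slant_Q (hZ : IsProfile Z) (w : IsPipeWave a ℓ Z H Q H' Q')
    (s σ : ℝ) {x : ℝ} (hx : x ∈ Ioo 0 ℓ) (hc : ContinuousAt Z x) :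
    HasDerivAt (fun y => Q (s + σ * y) y)
      (σ * Q' (s + σ * x) x + -(a⁻¹ * (Z x * H' (s + σ * x) x))) x :=
  hasDerivAt_slant w.continuous_Q' w.deriv_Q (w.hasDerivAt_Q hZ _ hx hc)

/-- The same wave, with the coordinate measured from the other end. -/
theorem reverse (w : IsPipeWave a ℓ Z H Q H' Q') (hZ : IsProfile Z) :
    IsPipeWave a ℓ (fun x => Z (ℓ - x)) (fun t x => H t (ℓ - x)) (fun t x => -Q t (ℓ - x))
      (fun t x => H' t (ℓ - x)) (fun t x => -Q' t (ℓ - x)) where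
  continuous_H := w.continuous_H.comp
    (by fun_prop : Continuous fun p : ℝ × ℝ => ((p.1, ℓ - p.2) : ℝ × ℝ))
  continuous_Q := (w.continuous_Q.comp
    (by fun_prop : Continuous fun p : ℝ × ℝ => ((p.1, ℓ - p.2) : ℝ × ℝ))).neg
  continuous_H' := w.continuous_H'.comp
    (by fun_prop : Continuous fun p : ℝ × ℝ => ((p.1, ℓ - p.2) : ℝ × ℝ))
  continuous_Q' := (w.continuous_Q'.comp
    (by fun_prop : Continuous fun p : ℝ × ℝ => ((p.1, ℓ - p.2) : ℝ × ℝ))).neg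
  deriv_H t x := w.deriv_H t _
  deriv_Q t x := (w.deriv_Q t _).neg
  eq_H t x hx := by
    have hQ' : Continuous fun y => Q' t y := w.continuous_Q'.comp (Continuous.prodMk_right t)
    have hI : ∀ x₁ x₂, IntervalIntegrable (fun y => -(a⁻¹ * ((Z y)⁻¹ * Q' t y))) volume x₁ x₂ := by
      intro x₁ x₂
      have := hZ.intervalIntegrable_combination (A := 0) (B := fun y => -(a⁻¹ * Q' t y)) (C := 0)
        continuous_const (continuous_const.mul hQ').neg continuous_const x₁ x₂
      refine this.congr (fun y _ => ?_)
      simp; ring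
    have h1 := w.eq_H t (ℓ - x) ⟨by linarith [hx.2], by linarith [hx.1]⟩
    have h2 := w.eq_H t ℓ ⟨hx.1.trans hx.2, le_rfl⟩
    have h3 := intervalIntegral.integral_add_adjacent_intervals (hI 0 (ℓ - x)) (hI (ℓ - x) ℓ)
    have h4 := intervalIntegral.integral_comp_sub_left (a := 0) (b := x)
      (fun y => (a⁻¹ * ((Z y)⁻¹ * Q' t y))) ℓ
    simp only [mul_neg, neg_neg, sub_zero] at h4 ⊢
    rw [h4]
    simp only [intervalIntegral.integral_neg] at h1 h2 h3
    linarith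
  eq_Q t x hx := by
    have hH' : Continuous fun y => H' t y := w.continuous_H'.comp (Continuous.prodMk_right t)
    have hI : ∀ x₁ x₂, IntervalIntegrable (fun y => -(a⁻¹ * (Z y * H' t y))) volume x₁ x₂ := by
      intro x₁ x₂
      have := hZ.intervalIntegrable_combination (B := 0) (A := fun y => -(a⁻¹ * H' t y)) (C := 0)
        (continuous_const.mul hH').neg continuous_const continuous_const x₁ x₂
      refine this.congr (fun y _ => ?_)
      simp; ring
    have h1 := w.eq_Q t (ℓ - x) ⟨by linarith [hx.2], by linarith [hx.1]⟩
    have h2 := w.eq_Q t ℓ ⟨hx.1.trans hx.2, le_rfl⟩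
    have h3 := intervalIntegral.integral_add_adjacent_intervals (hI 0 (ℓ - x)) (hI (ℓ - x) ℓ)
    have h4 := intervalIntegral.integral_comp_sub_left (a := 0) (b := x)
      (fun y => -(a⁻¹ * (Z y * H' t y))) ℓ
    simp only [sub_zero] at h4 ⊢
    rw [h4]
    linarith

end IsPipeWave

/-! ### Energy, reciprocity and transport on one pipe. -/

namespace IsPipeWave

variable {a ℓ : ℝ} {Z : ℝ → ℝ} {H Q H' Q' : ℝ → ℝ → ℝ}

theorem slice_continuous {F : ℝ → ℝ → ℝ} (hF : Continuous (Function.uncurry F)) (σ : ℝ) :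
    Continuous (Function.uncurry fun s x => F (s + σ * x) x) :=
  hF.comp (by fun_prop : Continuous fun p : ℝ × ℝ => ((p.1 + σ * p.2, p.2) : ℝ × ℝ))

/-- The energy density on the line `t = s + σ x`. -/
def energyDensity (a σ : ℝ) (Z : ℝ → ℝ) (H Q : ℝ → ℝ → ℝ) (s x : ℝ) : ℝ :=
  Z x * ((2 * a)⁻¹ * H (s + σ * x) x ^ 2) + (Z x)⁻¹ * ((2 * a)⁻¹ * Q (s + σ * x) x ^ 2) +
    -(σ * (H (s + σ * x) x * Q (s + σ * x) x))

theorem intervalIntegrable_energyDensity (hZ : IsProfile Z) (w : IsPipeWave a ℓ Z H Q H' Q')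
    (σ s x₁ x₂ : ℝ) : IntervalIntegrable (energyDensity a σ Z H Q s) volume x₁ x₂ := by
  have h1 : Continuous fun x => H (s + σ * x) x :=
    (slice_continuous w.continuous_H σ).comp (Continuous.prodMk_right s)
  have h2 : Continuous fun x => Q (s + σ * x) x :=
    (slice_continuous w.continuous_Q σ).comp (Continuous.prodMk_right s)
  exact hZ.intervalIntegrable_combination (continuous_const.mul (h1.pow 2))
    (continuous_const.mul (h2.pow 2)) (continuous_const.mul (h1.mul h2)).neg _ _

/-- The energy on the line `t = s + σ x` changes by the flux at the ends. -/
theorem energy_sub (hZ : IsProfile Z) (w : IsPipeWave a ℓ Z H Q H' Q') (hℓ : 0 ≤ ℓ)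
    (σ : ℝ) {s₁ s₂ : ℝ} (hs : s₁ ≤ s₂) :
    (∫ x in (0)..ℓ, energyDensity a σ Z H Q s₂ x) - ∫ x in (0)..ℓ, energyDensity a σ Z H Q s₁ x =
      (∫ s in s₁..s₂, H (s + σ * 0) 0 * Q (s + σ * 0) 0) -
        ∫ s in s₁..s₂, H (s + σ * ℓ) ℓ * Q (s + σ * ℓ) ℓ := by
  have cH := slice_continuous w.continuous_H σ
  have cQ := slice_continuous w.continuous_Q σ
  have cH' := slice_continuous w.continuous_H' σ
  have cQ' := slice_continuous w.continuous_Q' σ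
  -- In the coordinates `(s, x)` the `x`-derivative of `H Q` is minus the `s`-derivative of the
  -- energy density. After exchanging the integrals, the inner one is evaluated by the fundamental
  -- theorem.
  have key := hZ.integral_sub_integral
    (f := fun s x => H (s + σ * x) x * Q (s + σ * x) x)
    (A := fun s x => -(a⁻¹ * (H (s + σ * x) x * H' (s + σ * x) x)))
    (B := fun s x => -(a⁻¹ * (Q (s + σ * x) x * Q' (s + σ * x) x)))
    (C := fun s x => σ * (H' (s + σ * x) x * Q (s + σ * x) x + H (s + σ * x) x * Q' (s + σ * x) x))
    (cH.mul cQ) (continuous_const.mul (cH.mul cH')).neg (continuous_const.mul (cQ.mul cQ')).neg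
    (continuous_const.mul ((cH'.mul cQ).add (cH.mul cQ'))) hs hℓ
    (fun t x hx hc => by
      refine ((w.hasDerivAt_slant_H hZ t σ hx hc).mul
        (w.hasDerivAt_slant_Q hZ t σ hx hc)).congr_deriv ?_
      ring)
  rw [← neg_sub, ← neg_sub (∫ s in s₁..s₂, H (s + σ * ℓ) ℓ * Q (s + σ * ℓ) ℓ)]
  congr 1
  rw [key, ← intervalIntegral.integral_sub (w.intervalIntegrable_energyDensity hZ _ _ _ _)
    (w.intervalIntegrable_energyDensity hZ _ _ _ _)]
  refine intervalIntegral.integral_congr fun x _ => ?_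
  have hH : ∀ s, HasDerivAt (fun s => H (s + σ * x) x) (H' (s + σ * x) x) s := fun s =>
    (w.deriv_H (s + σ * x) x).comp_add_const s (σ * x)
  have hQ : ∀ s, HasDerivAt (fun s => Q (s + σ * x) x) (Q' (s + σ * x) x) s := fun s =>
    (w.deriv_Q (s + σ * x) x).comp_add_const s (σ * x)
  have hd : ∀ s ∈ uIcc s₁ s₂, HasDerivAt (fun s => -energyDensity a σ Z H Q s x)
      (Z x * -(a⁻¹ * (H (s + σ * x) x * H' (s + σ * x) x)) +
        (Z x)⁻¹ * -(a⁻¹ * (Q (s + σ * x) x * Q' (s + σ * x) x)) +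
        σ * (H' (s + σ * x) x * Q (s + σ * x) x + H (s + σ * x) x * Q' (s + σ * x) x)) s := by
    intro s _
    have := (((((hH s).pow 2).const_mul (2 * a)⁻¹).const_mul (Z x)).add
      ((((hQ s).pow 2).const_mul (2 * a)⁻¹).const_mul (Z x)⁻¹)).add
      ((((hH s).mul (hQ s)).const_mul σ).neg)
    refine this.neg.congr_deriv ?_
    rw [mul_inv]
    push_cast
    ring
  have c1 : ∀ {F : ℝ → ℝ → ℝ}, Continuous (Function.uncurry F) → Continuous fun s => F s x :=
    fun hF => hF.comp (Continuous.prodMk_left x)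
  rw [intervalIntegral.integral_eq_sub_of_hasDerivAt hd]
  · ring
  · refine Continuous.intervalIntegrable ?_ _ _
    have h1 := c1 cH
    have h2 := c1 cQ
    have h3 := c1 cH'
    have h4 := c1 cQ'
    exact (((h1.mul h3).const_smul a⁻¹).neg.const_smul (Z x) |>.add
      (((h2.mul h4).const_smul a⁻¹).neg.const_smul (Z x)⁻¹)).add
      (((h3.mul h2).add (h1.mul h4)).const_smul σ)

/-- The cross term is dominated by `2 |H Q| ≤ Z H² + Z⁻¹ Q²`. The line is slower than the waves by
the factor `lam`, so the fraction `1 - lam` of the energy survives. -/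
theorem energyDensity_ge (hZ : IsProfile Z) (ha : 0 < a) {lam σ : ℝ} (hσ : |σ| ≤ lam / a)
    (H Q : ℝ → ℝ → ℝ) (s x : ℝ) :
    (1 - lam) * (2 * a)⁻¹ * (Z x * H (s + σ * x) x ^ 2 + (Z x)⁻¹ * Q (s + σ * x) x ^ 2) ≤
      energyDensity a σ Z H Q s x := by
  have hz := hZ.pos x
  set u := H (s + σ * x) x
  set v := Q (s + σ * x) x
  have h1 : 2 * |u * v| ≤ Z x * u ^ 2 + (Z x)⁻¹ * v ^ 2 := by
    rw [abs_mul]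
    have h2 : Z x * u ^ 2 + (Z x)⁻¹ * v ^ 2 - 2 * (|u| * |v|) =
        (Z x)⁻¹ * (Z x * |u| - |v|) ^ 2 := by
      rw [← sq_abs u, ← sq_abs v]
      field_simp
      ring
    have : 0 ≤ (Z x)⁻¹ * (Z x * |u| - |v|) ^ 2 := by positivity
    linarith
  have h3 : σ * (u * v) ≤ lam / a * |u * v| :=
    (le_abs_self _).trans (by rw [abs_mul]; gcongr)
  have h4 : lam / a * |u * v| ≤ lam * (2 * a)⁻¹ * (Z x * u ^ 2 + (Z x)⁻¹ * v ^ 2) := by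
    have hl : 0 ≤ lam / a := (abs_nonneg σ).trans hσ
    have e : lam * (2 * a)⁻¹ = lam / a * (1 / 2) := by field_simp
    rw [e, mul_assoc]
    gcongr
    linarith
  unfold energyDensity
  nlinarith

theorem energy_nonneg (hZ : IsProfile Z) (ha : 0 < a) (hℓ : 0 ≤ ℓ) {lam σ : ℝ} (hl : lam < 1)
    (hσ : |σ| ≤ lam / a) (H Q : ℝ → ℝ → ℝ) (s : ℝ) :
    0 ≤ ∫ x in (0)..ℓ, energyDensity a σ Z H Q s x := by
  refine intervalIntegral.integral_nonneg hℓ fun x _ =>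
    le_trans ?_ (energyDensity_ge hZ ha hσ H Q s x)
  have := hZ.pos x
  have : 0 < 1 - lam := by linarith
  positivity

/-- Since `Z` may jump, the density need not be continuous. Replacing `Z` and `Z⁻¹` by constant
lower bounds gives a continuous nonnegative minorant with zero integral, which vanishes at every
point. -/
theorem eq_zero_of_energy (hZ : IsProfile Z) (w : IsPipeWave a ℓ Z H Q H' Q') (ha : 0 < a)
    (hℓ : 0 < ℓ) {lam σ : ℝ} (hl : lam < 1) (hσ : |σ| ≤ lam / a) {s : ℝ}
    (hE : ∫ x in (0)..ℓ, energyDensity a σ Z H Q s x = 0) {x : ℝ} (hx : x ∈ Icc 0 ℓ) :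
    H (s + σ * x) x = 0 ∧ Q (s + σ * x) x = 0 := by
  obtain ⟨c, hc, hcZ⟩ := hZ.lower
  obtain ⟨C, hC, hCZ⟩ := hZ.upper
  have hl' : 0 < 1 - lam := by linarith
  let κ := (1 - lam) * (2 * a)⁻¹
  have hκ : 0 < κ := by positivity
  let F : ℝ → ℝ := fun x => κ * (c * H (s + σ * x) x ^ 2 + C⁻¹ * Q (s + σ * x) x ^ 2)
  have h1 : Continuous fun x => H (s + σ * x) x :=
    (slice_continuous w.continuous_H σ).comp (Continuous.prodMk_right s)
  have h2 : Continuous fun x => Q (s + σ * x) x :=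
    (slice_continuous w.continuous_Q σ).comp (Continuous.prodMk_right s)
  have hF : Continuous F :=
    continuous_const.mul ((continuous_const.mul (h1.pow 2)).add (continuous_const.mul (h2.pow 2)))
  have hF0 : ∀ x, 0 ≤ F x := fun x => by positivity
  have hle : ∀ x, F x ≤ energyDensity a σ Z H Q s x := by
    intro x
    refine le_trans ?_ (energyDensity_ge hZ ha hσ H Q s x)
    have := hZ.pos x
    have hi : C⁻¹ ≤ (Z x)⁻¹ := inv_anti₀ this (hCZ x)
    change κ * _ ≤ κ * _
    have := hcZ x
    gcongr
  have hint : ∫ x in (0)..ℓ, F x ≤ 0 :=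
    (intervalIntegral.integral_mono_on hℓ.le (hF.intervalIntegrable _ _)
      (w.intervalIntegrable_energyDensity hZ _ _ _ _) fun x _ => hle x).trans_eq hE
  have hzero : F x = 0 := by
    by_contra hne
    have := intervalIntegral.integral_pos hℓ hF.continuousOn (fun y _ => hF0 y)
      ⟨x, hx, lt_of_le_of_ne (hF0 x) (Ne.symm hne)⟩
    linarith
  have h3 : c * H (s + σ * x) x ^ 2 + C⁻¹ * Q (s + σ * x) x ^ 2 = 0 :=
    (mul_eq_zero.1 hzero).resolve_left hκ.ne'
  have h4 : 0 ≤ c * H (s + σ * x) x ^ 2 := by positivity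
  have h5 : 0 ≤ C⁻¹ * Q (s + σ * x) x ^ 2 := by positivity
  have h6 : c * H (s + σ * x) x ^ 2 = 0 := by linarith
  have h7 : C⁻¹ * Q (s + σ * x) x ^ 2 = 0 := by linarith
  constructor
  · simpa [hc.ne'] using h6
  · simpa [hC.ne'] using h7

/-- The time convolution of the flux of two waves does not depend on the position. -/
theorem reciprocity {h q h' q' : ℝ → ℝ → ℝ} (hZ : IsProfile Z)
    (w₁ : IsPipeWave a ℓ Z h q h' q') (w₂ : IsPipeWave a ℓ Z H Q H' Q') (hℓ : 0 ≤ ℓ)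
    (t : ℝ) {s₁ s₂ : ℝ} (hs : s₁ ≤ s₂)
    (h₁ : ∀ x ∈ Icc 0 ℓ, h s₁ x = 0 ∧ q s₁ x = 0)
    (h₂ : ∀ x ∈ Icc 0 ℓ, H (t - s₂) x = 0 ∧ Q (t - s₂) x = 0) :
    ∫ s in s₁..s₂, (h s ℓ * Q (t - s) ℓ - q s ℓ * H (t - s) ℓ) =
      ∫ s in s₁..s₂, (h s 0 * Q (t - s) 0 - q s 0 * H (t - s) 0) := by
  have back : ∀ {F : ℝ → ℝ → ℝ}, Continuous (Function.uncurry F) →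
      Continuous (Function.uncurry fun s x => F (t - s) x) := fun hF =>
    hF.comp (by fun_prop : Continuous fun p : ℝ × ℝ => ((t - p.1, p.2) : ℝ × ℝ))
  have ch := w₁.continuous_H
  have cq := w₁.continuous_Q
  have ch' := w₁.continuous_H'
  have cq' := w₁.continuous_Q'
  have cH := back w₂.continuous_H
  have cQ := back w₂.continuous_Q
  have cH' := back w₂.continuous_H'
  have cQ' := back w₂.continuous_Q'
  -- The `x`-derivative of the flux is the `s`-derivative of `a⁻¹ (Z h H - Z⁻¹ q Q)`, with the
  -- second wave taken at time `t - s`. Its time integral vanishes because one of the two waves is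
  -- at rest at either end of the time interval.
  have key := hZ.integral_sub_integral
    (f := fun s x => h s x * Q (t - s) x - q s x * H (t - s) x)
    (A := fun s x => a⁻¹ * (h' s x * H (t - s) x - h s x * H' (t - s) x))
    (B := fun s x => a⁻¹ * (q s x * Q' (t - s) x - q' s x * Q (t - s) x))
    (C := fun _ _ => 0)
    ((ch.mul cQ).sub (cq.mul cH)) (continuous_const.mul ((ch'.mul cH).sub (ch.mul cH')))
    (continuous_const.mul ((cq.mul cQ').sub (cq'.mul cQ))) continuous_const hs hℓ
    (fun s x hx hc => by
      refine (((w₁.hasDerivAt_H hZ s hx hc).mul (w₂.hasDerivAt_Q hZ (t - s) hx hc)).sub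
        ((w₁.hasDerivAt_Q hZ s hx hc).mul (w₂.hasDerivAt_H hZ (t - s) hx hc))).congr_deriv ?_
      ring)
  rw [← sub_eq_zero, key]
  refine intervalIntegral.integral_zero_ae (ae_of_all _ fun x hx => ?_)
  have hx' : x ∈ Icc 0 ℓ := by
    rw [uIoc_of_le hℓ] at hx
    exact Ioc_subset_Icc_self hx
  have hd : ∀ s ∈ uIcc s₁ s₂, HasDerivAt
      (fun s => a⁻¹ * (Z x * (h s x * H (t - s) x) - (Z x)⁻¹ * (q s x * Q (t - s) x)))
      (Z x * (a⁻¹ * (h' s x * H (t - s) x - h s x * H' (t - s) x)) +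
        (Z x)⁻¹ * (a⁻¹ * (q s x * Q' (t - s) x - q' s x * Q (t - s) x)) + 0) s := by
    intro s _
    have d1 := (w₁.deriv_H s x).mul ((w₂.deriv_H (t - s) x).comp_const_sub t s)
    have d2 := (w₁.deriv_Q s x).mul ((w₂.deriv_Q (t - s) x).comp_const_sub t s)
    refine (((d1.const_mul (Z x)).sub (d2.const_mul (Z x)⁻¹)).const_mul a⁻¹).congr_deriv ?_
    ring
  have c1 : ∀ {F : ℝ → ℝ → ℝ}, Continuous (Function.uncurry F) → Continuous fun s => F s x :=
    fun hF => hF.comp (Continuous.prodMk_left x)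
  rw [intervalIntegral.integral_eq_sub_of_hasDerivAt hd]
  · simp [h₁ x hx', h₂ x hx']
  · refine Continuous.intervalIntegrable ?_ _ _
    exact ((((c1 ch').mul (c1 cH)).sub ((c1 ch).mul (c1 cH'))).const_smul a⁻¹ |>.const_smul (Z x)
      |>.add ((((c1 cq).mul (c1 cQ')).sub ((c1 cq').mul (c1 cQ))).const_smul a⁻¹
      |>.const_smul (Z x)⁻¹)).add continuous_const

/-- On a segment of constant impedance the wave that runs towards `x = 0` is transported. -/
theorem transport (hZ : IsProfile Z) (w : IsPipeWave a ℓ Z H Q H' Q') {y c : ℝ} (hy : 0 ≤ y)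
    (hyℓ : y ≤ ℓ) (hc : ∀ x ∈ Icc 0 y, Z x = c) (t : ℝ) :
    H t 0 - c⁻¹ * Q t 0 = H (t - y / a) y - c⁻¹ * Q (t - y / a) y := by
  have hc0 : c ≠ 0 := by
    rw [← hc 0 ⟨le_rfl, hy⟩]
    exact (hZ.pos 0).ne'
  have h1 : Continuous fun x => H (t + -a⁻¹ * x) x :=
    (slice_continuous w.continuous_H (-a⁻¹)).comp (Continuous.prodMk_right t)
  have h2 : Continuous fun x => Q (t + -a⁻¹ * x) x :=
    (slice_continuous w.continuous_Q (-a⁻¹)).comp (Continuous.prodMk_right t)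
  -- With constant impedance the combination `H - c⁻¹ Q` has zero derivative along the
  -- characteristic of slope `-1/a`.
  have key := integral_eq_of_hasDerivAt_off_countable_of_le
    (fun x => H (t + -a⁻¹ * x) x - c⁻¹ * Q (t + -a⁻¹ * x) x) (fun _ => 0) hy countable_empty
    (h1.sub (continuous_const.mul h2)).continuousOn (fun x hx => by
      have hx' : x ∈ Ioo 0 y := hx.1
      have hx'' : x ∈ Ioo 0 ℓ := ⟨hx'.1, hx'.2.trans_le hyℓ⟩
      have hcont : ContinuousAt Z x := by
        refine (continuousAt_const (y := c)).congr ?_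
        filter_upwards [Ioo_mem_nhds hx'.1 hx'.2] with r hr
        exact (hc r (Ioo_subset_Icc_self hr)).symm
      refine ((w.hasDerivAt_slant_H hZ t (-a⁻¹) hx'' hcont).sub
        ((w.hasDerivAt_slant_Q hZ t (-a⁻¹) hx'' hcont).const_mul c⁻¹)).congr_deriv ?_
      rw [hc x (Ioo_subset_Icc_self hx')]
      field_simp
      ring) intervalIntegrable_const
  simp only [intervalIntegral.integral_zero, mul_zero, add_zero] at key
  have e : t - y / a = t + -a⁻¹ * y := by ring
  rw [e]
  linarith

end IsPipeWave

/-! ### Sideways uniqueness -/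

theorem continuous_slice_time {F : ℝ → ℝ → ℝ} (hF : Continuous (Function.uncurry F)) (x : ℝ) :
    Continuous fun t => F t x :=
  hF.comp (Continuous.prodMk_left x)

/-- Over `n` equal steps the increments of `m` telescope, so the total error is `M y (m y - m 0) /
n`, which tends to `0`. No continuity of `Φ` or `m` is needed, so jumps of the impedance are
allowed. -/
theorem le_of_le_add_mul_sub {Φ m : ℝ → ℝ} {M y : ℝ} (hy : 0 ≤ y)
    (h : ∀ x₁ x₂, 0 ≤ x₁ → x₁ ≤ x₂ → x₂ ≤ y → Φ x₂ ≤ Φ x₁ + M * (x₂ - x₁) * (m x₂ - m x₁)) :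
    Φ y ≤ Φ 0 := by
  have key : ∀ n : ℕ, 0 < n → Φ y ≤ Φ 0 + M * y * (m y - m 0) / n := by
    intro n hn
    have hn' : (0 : ℝ) < n := by exact_mod_cast hn
    let x : ℕ → ℝ := fun k => k * (y / n)
    have step : ∀ k, k ≤ n → Φ (x k) ≤ Φ 0 + M * (y / n) * (m (x k) - m 0) := by
      intro k
      induction k with
      | zero => intro _; simp [x]
      | succ k ih =>
        intro hk
        have h1 := ih (Nat.le_of_succ_le hk)
        have hxx : x (k + 1) - x k = y / n := by simp only [x]; push_cast; ring
        have hyn : 0 ≤ y / n := by positivity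
        have h2 := h (x k) (x (k + 1)) (by positivity) (by linarith) (by
          have : ((k + 1 : ℕ) : ℝ) ≤ n := by exact_mod_cast hk
          calc x (k + 1) = ((k + 1 : ℕ) : ℝ) * (y / n) := rfl
            _ ≤ n * (y / n) := by gcongr
            _ = y := by field_simp)
        rw [hxx] at h2
        linarith
    have hxn : x n = y := by simp only [x]; field_simp
    have := step n le_rfl
    rw [hxn] at this
    calc Φ y ≤ _ := this
      _ = _ := by ring
  have lim : Tendsto (fun n : ℕ => Φ 0 + M * y * (m y - m 0) / n) atTop (𝓝 (Φ 0 + 0)) :=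
    tendsto_const_nhds.add (tendsto_const_div_atTop_nhds_zero_nat _)
  rw [add_zero] at lim
  exact ge_of_tendsto lim (eventually_atTop.2 ⟨1, fun n hn => key n hn⟩)

theorem hasDerivAt_sq_max (s : ℝ) : HasDerivAt (fun s => max s 0 ^ 2) (2 * max s 0) s := by
  rcases lt_trichotomy s 0 with hs | rfl | hs
  · refine ((hasDerivAt_const s (0 : ℝ)).congr_of_eventuallyEq ?_).congr_deriv ?_
    · filter_upwards [Iio_mem_nhds hs] with r hr
      rw [max_eq_right (le_of_lt hr)]
      norm_num
    · rw [max_eq_right hs.le]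
      norm_num
  · rw [hasDerivAt_iff_isLittleO_nhds_zero]
    simp only [zero_add, max_self, mul_zero, smul_zero, sub_zero, ne_eq, OfNat.ofNat_ne_zero,
      not_false_eq_true, zero_pow]
    refine Asymptotics.IsBigO.trans_isLittleO (g := fun h : ℝ => h ^ 2) ?_ ?_
    · refine Asymptotics.IsBigO.of_bound 1 (Eventually.of_forall fun h => ?_)
      rw [one_mul, norm_pow, norm_pow]
      gcongr
      rw [Real.norm_eq_abs, Real.norm_eq_abs, abs_of_nonneg (le_max_right _ _)]
      exact max_le (le_abs_self _) (abs_nonneg _)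
    · exact Asymptotics.isLittleO_pow_id one_lt_two
  · refine (((hasDerivAt_id s).pow 2).congr_of_eventuallyEq ?_).congr_deriv ?_
    · filter_upwards [Ioi_mem_nhds hs] with r hr
      rw [max_eq_left (le_of_lt hr)]
      rfl
    · rw [max_eq_left hs.le]
      simp

/-! ### A weighted energy for evolution in `x`, with frozen impedance. -/

namespace IsPipeWave

/-- A weight supported in the cone `|t - τ| ≤ r - x / a`. -/
def coneWeight (a τ r t x : ℝ) : ℝ := max ((r - x / a) ^ 2 - (t - τ) ^ 2) 0 ^ 2

/-- The slope of the weight `coneWeight`. -/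
def coneSlope (a τ r t x : ℝ) : ℝ := 2 * max ((r - x / a) ^ 2 - (t - τ) ^ 2) 0

theorem hasDerivAt_coneWeight_time (a τ r t x : ℝ) :
    HasDerivAt (fun s => coneWeight a τ r s x) (coneSlope a τ r t x * -(2 * (t - τ))) t := by
  have h : HasDerivAt (fun s => (r - x / a) ^ 2 - (s - τ) ^ 2) (-(2 * (t - τ))) t := by
    refine ((((hasDerivAt_id t).sub_const τ).pow 2).const_sub _).congr_deriv ?_
    simp
  exact (hasDerivAt_sq_max _).comp t h

theorem hasDerivAt_coneWeight_space (a τ r t x : ℝ) :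
    HasDerivAt (fun y => coneWeight a τ r t y)
      (coneSlope a τ r t x * (-(2 * (r - x / a)) * a⁻¹)) x := by
  have h : HasDerivAt (fun y => (r - y / a) ^ 2 - (t - τ) ^ 2) (-(2 * (r - x / a)) * a⁻¹) x := by
    refine (((((hasDerivAt_id x).div_const a).const_sub r).pow 2).sub_const _).congr_deriv ?_
    simp
  exact (hasDerivAt_sq_max _).comp x h

theorem continuous_coneWeight (a τ r : ℝ) : Continuous (Function.uncurry (coneWeight a τ r)) := by
  unfold Function.uncurry coneWeight
  fun_prop

theorem continuous_coneSlope (a τ r : ℝ) : Continuous (Function.uncurry (coneSlope a τ r)) := by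
  unfold Function.uncurry coneSlope
  fun_prop

theorem coneSlope_nonneg (a τ r t x : ℝ) : 0 ≤ coneSlope a τ r t x :=
  mul_nonneg zero_le_two (le_max_right _ _)

theorem coneWeight_nonneg (a τ r t x : ℝ) : 0 ≤ coneWeight a τ r t x := sq_nonneg _

/-- Where the slope is nonzero, the point lies in the cone. -/
theorem coneSlope_mul_le {a τ r x : ℝ} (hx : 0 ≤ r - x / a) (t : ℝ) :
    coneSlope a τ r t x * |t - τ| ≤ coneSlope a τ r t x * (r - x / a) := by
  by_cases h : (r - x / a) ^ 2 - (t - τ) ^ 2 ≤ 0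
  · simp [coneSlope, max_eq_right h]
  · have : |t - τ| ≤ r - x / a := abs_le_of_sq_le_sq (by linarith) hx
    exact mul_le_mul_of_nonneg_left this (coneSlope_nonneg _ _ _ _ _)

/-- The energy density with impedance `c`, weighted. -/
def coneEnergy (a τ r c : ℝ) (H Q : ℝ → ℝ → ℝ) (t x : ℝ) : ℝ :=
  coneWeight a τ r t x * (2⁻¹ * (c * H t x ^ 2 + c⁻¹ * Q t x ^ 2))

theorem two_abs_mul_le {c : ℝ} (hc : 0 < c) (u v : ℝ) :
    |u * v| ≤ 2⁻¹ * (c * u ^ 2 + c⁻¹ * v ^ 2) := by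
  rw [abs_mul]
  have h2 : c * u ^ 2 + c⁻¹ * v ^ 2 - 2 * (|u| * |v|) = c⁻¹ * (c * |u| - |v|) ^ 2 := by
    rw [← sq_abs u, ← sq_abs v]
    field_simp
    ring
  have : 0 ≤ c⁻¹ * (c * |u| - |v|) ^ 2 := by positivity
  linarith

variable {a ℓ : ℝ} {Z : ℝ → ℝ} {H Q H' Q' : ℝ → ℝ → ℝ}

theorem continuous_coneEnergy (w : IsPipeWave a ℓ Z H Q H' Q') (τ r c : ℝ) :
    Continuous (Function.uncurry (coneEnergy a τ r c H Q)) :=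
  (continuous_coneWeight a τ r).mul (continuous_const.mul
    ((continuous_const.mul (w.continuous_H.pow 2)).add
      (continuous_const.mul (w.continuous_Q.pow 2))))

theorem coneEnergy_nonneg {c : ℝ} (hc : 0 < c) (a τ r : ℝ) (H Q : ℝ → ℝ → ℝ) (t x : ℝ) :
    0 ≤ coneEnergy a τ r c H Q t x := by
  have := coneWeight_nonneg a τ r t x
  unfold coneEnergy
  positivity

/-- If `z = c`, the change of the weighted energy in `x` is an exact time derivative plus terms from
the weight. The narrowing of the cone at speed `a` dominates the latter, by `coneSlope_mul_le` and
`|u v| ≤ 2⁻¹ (c u² + c⁻¹ v²)`. A mismatch of the impedances leaves an error proportional to `|z -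
c|`. -/
theorem coneEnergy_integrand_le {a c c₀ z τ r t x : ℝ} (ha : 0 < a) (hc₀ : 0 < c₀) (hc : c₀ ≤ c)
    (hz : c₀ ≤ z) (hx : 0 ≤ r - x / a) (u v u' v' : ℝ) :
    z * (coneWeight a τ r t x * -(a⁻¹ * (c⁻¹ * (v * u')))) +
      z⁻¹ * (coneWeight a τ r t x * -(a⁻¹ * (c * (u * v')))) +
      coneSlope a τ r t x * (-(2 * (r - x / a)) * a⁻¹) * (2⁻¹ * (c * u ^ 2 + c⁻¹ * v ^ 2)) ≤
    -a⁻¹ * (coneSlope a τ r t x * -(2 * (t - τ)) * (u * v) +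
      coneWeight a τ r t x * (u' * v + u * v')) +
      |z - c| * (a⁻¹ * c₀⁻¹ * (coneWeight a τ r t x * (|v * u'| + |u * v'|))) := by
  have hcp : 0 < c := hc₀.trans_le hc
  have hzp : 0 < z := hc₀.trans_le hz
  set χ := coneWeight a τ r t x
  set ψ := coneSlope a τ r t x
  have hχ : 0 ≤ χ := coneWeight_nonneg _ _ _ _ _
  have hψ : 0 ≤ ψ := coneSlope_nonneg _ _ _ _ _
  set e := 2⁻¹ * (c * u ^ 2 + c⁻¹ * v ^ 2) with he
  have he0 : 0 ≤ e := by positivity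
  have h1 : |u * v| ≤ e := two_abs_mul_le hcp u v
  have h2 : ψ * |t - τ| ≤ ψ * (r - x / a) := coneSlope_mul_le hx t
  have h3 : -(ψ * (t - τ) * (u * v)) ≤ ψ * (r - x / a) * e := by
    calc -(ψ * (t - τ) * (u * v)) ≤ |ψ * (t - τ) * (u * v)| := neg_le_abs _
      _ = ψ * |t - τ| * |u * v| := by rw [abs_mul, abs_mul, abs_of_nonneg hψ]
      _ ≤ ψ * (r - x / a) * e := by gcongr
  have h4 : -((z - c) * c⁻¹ * (v * u')) ≤ |z - c| * c₀⁻¹ * |v * u'| := by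
    calc -((z - c) * c⁻¹ * (v * u')) ≤ |(z - c) * c⁻¹ * (v * u')| := neg_le_abs _
      _ = |z - c| * c⁻¹ * |v * u'| := by
        rw [abs_mul, abs_mul, abs_of_nonneg (inv_pos.2 hcp).le]
      _ ≤ _ := by gcongr
  have h5 : (z - c) * z⁻¹ * (u * v') ≤ |z - c| * c₀⁻¹ * |u * v'| := by
    calc (z - c) * z⁻¹ * (u * v') ≤ |(z - c) * z⁻¹ * (u * v')| := le_abs_self _
      _ = |z - c| * z⁻¹ * |u * v'| := by
        rw [abs_mul, abs_mul, abs_of_nonneg (inv_pos.2 hzp).le]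
      _ ≤ _ := by gcongr
  have e4 : (z - c) * c⁻¹ = z * c⁻¹ - 1 := by field_simp
  have e5 : (z - c) * z⁻¹ = 1 - z⁻¹ * c := by field_simp
  rw [e4] at h4
  rw [e5] at h5
  have h6 := mul_le_mul_of_nonneg_left (add_le_add h4 h5) hχ
  have h7 : χ * (-((z * c⁻¹ - 1) * (v * u')) + (1 - z⁻¹ * c) * (u * v')) - 2 * (ψ * (r - x / a) * e)
      ≤ χ * (|z - c| * c₀⁻¹ * |v * u'| + |z - c| * c₀⁻¹ * |u * v'|) + 2 * (ψ * (t - τ) * (u * v)) := by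
    linarith
  have h8 := mul_le_mul_of_nonneg_left h7 (inv_pos.2 ha).le
  calc _ = a⁻¹ * (χ * (-((z * c⁻¹ - 1) * (v * u')) + (1 - z⁻¹ * c) * (u * v'))
        - 2 * (ψ * (r - x / a) * e)) - a⁻¹ * χ * (u' * v + u * v') := by ring
    _ ≤ a⁻¹ * (χ * (|z - c| * c₀⁻¹ * |v * u'| + |z - c| * c₀⁻¹ * |u * v'|)
        + 2 * (ψ * (t - τ) * (u * v))) - a⁻¹ * χ * (u' * v + u * v') := by linarith
    _ = _ := by ring

/-- Integrating `coneEnergy_integrand_le`, the exact time derivative drops out since the weight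
vanishes at `t = τ ± r`. The constant `M` does not depend on the frozen impedance `c ≥ c₀`, so the
estimate can be used on arbitrarily short steps. -/
theorem coneEnergy_growth (hZ : IsProfile Z) (w : IsPipeWave a ℓ Z H Q H' Q') (ha : 0 < a)
    {c₀ : ℝ} (hc₀ : 0 < c₀) (hlow : ∀ x, c₀ ≤ Z x) (τ : ℝ) {r y : ℝ} (hr : 0 ≤ r) (hyℓ : y ≤ ℓ)
    (hyr : y / a ≤ r) :
    ∃ M ≥ 0, ∀ c ≥ c₀, ∀ x₁ x₂ D, 0 ≤ x₁ → x₁ ≤ x₂ → x₂ ≤ y →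
      (∀ x ∈ Icc x₁ x₂, |Z x - c| ≤ D) →
      (∫ t in (τ - r)..(τ + r), coneEnergy a τ r c H Q t x₂) ≤
        (∫ t in (τ - r)..(τ + r), coneEnergy a τ r c H Q t x₁) + M * (x₂ - x₁) * D := by
  have cχ := continuous_coneWeight a τ r
  have cψ := continuous_coneSlope a τ r
  let E : ℝ → ℝ → ℝ := fun t x =>
    a⁻¹ * c₀⁻¹ * (coneWeight a τ r t x * (|Q t x * H' t x| + |H t x * Q' t x|))
  have cE : Continuous (Function.uncurry E) :=
    continuous_const.mul (cχ.mul ((w.continuous_Q.mul w.continuous_H').abs.add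
      (w.continuous_H.mul w.continuous_Q').abs))
  obtain ⟨M, hM⟩ := ((isCompact_Icc (a := τ - r) (b := τ + r)).prod
    (isCompact_Icc (a := 0) (b := y))).exists_bound_of_continuousOn cE.continuousOn
  have hM' : ∀ t ∈ Icc (τ - r) (τ + r), ∀ x ∈ Icc 0 y, E t x ≤ |M| := fun t ht x hx =>
    (le_abs_self _).trans ((hM (t, x) ⟨ht, hx⟩).trans (le_abs_self M))
  -- A bound for the error density, times the length of the time interval.
  refine ⟨|M| * (2 * r), by positivity, fun c hc x₁ x₂ D hx₁ hx₁₂ hx₂ hD => ?_⟩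
  have hcp : 0 < c := hc₀.trans_le hc
  have hD0 : 0 ≤ D := (abs_nonneg _).trans (hD x₁ ⟨le_rfl, hx₁₂⟩)
  let A : ℝ → ℝ → ℝ := fun t x => coneWeight a τ r t x * -(a⁻¹ * (c⁻¹ * (Q t x * H' t x)))
  let B : ℝ → ℝ → ℝ := fun t x => coneWeight a τ r t x * -(a⁻¹ * (c * (H t x * Q' t x)))
  let C : ℝ → ℝ → ℝ := fun t x => coneSlope a τ r t x * (-(2 * (r - x / a)) * a⁻¹) *
    (2⁻¹ * (c * H t x ^ 2 + c⁻¹ * Q t x ^ 2))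
  have cA : Continuous (Function.uncurry A) :=
    cχ.mul (continuous_const.mul (continuous_const.mul (w.continuous_Q.mul w.continuous_H'))).neg
  have cB : Continuous (Function.uncurry B) :=
    cχ.mul (continuous_const.mul (continuous_const.mul (w.continuous_H.mul w.continuous_Q'))).neg
  have cC : Continuous (Function.uncurry C) :=
    (cψ.mul (by fun_prop : Continuous fun p : ℝ × ℝ => (-(2 * (r - p.2 / a)) * a⁻¹))).mul
      (continuous_const.mul ((continuous_const.mul (w.continuous_H.pow 2)).add
      (continuous_const.mul (w.continuous_Q.pow 2))))
  have key := hZ.integral_sub_integral (f := coneEnergy a τ r c H Q) (A := A) (B := B) (C := C)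
    (w.continuous_coneEnergy τ r c) cA cB cC (by linarith : τ - r ≤ τ + r) hx₁₂
    (fun t x hx hcont => by
      have hx' : x ∈ Ioo 0 ℓ := ⟨hx₁.trans_lt hx.1, hx.2.trans_le (hx₂.trans hyℓ)⟩
      refine ((hasDerivAt_coneWeight_space a τ r t x).mul
        (((((w.hasDerivAt_H hZ t hx' hcont).pow 2).const_mul c).add
        (((w.hasDerivAt_Q hZ t hx' hcont).pow 2).const_mul c⁻¹)).const_mul 2⁻¹)).congr_deriv ?_
      simp only [A, B, C, Pi.add_apply, Pi.pow_apply]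
      push_cast
      ring)
  have c1 : ∀ {F : ℝ → ℝ → ℝ} (x : ℝ), Continuous (Function.uncurry F) →
    Continuous fun s => F s x := fun x hF => hF.comp (Continuous.prodMk_left x)
  have inner : ∀ x ∈ Icc x₁ x₂, ∫ t in (τ - r)..(τ + r),
      (Z x * A t x + (Z x)⁻¹ * B t x + C t x) ≤ |M| * (2 * r) * D := by
    intro x hx
    have hxr : 0 ≤ r - x / a := by
      have : x / a ≤ y / a := by gcongr; exact hx.2.trans hx₂
      linarith
    let P : ℝ → ℝ := fun t => coneSlope a τ r t x * -(2 * (t - τ)) * (H t x * Q t x) +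
      coneWeight a τ r t x * (H' t x * Q t x + H t x * Q' t x)
    have cP : Continuous P :=
      (((c1 x cψ).mul (by fun_prop)).mul ((c1 x w.continuous_H).mul (c1 x w.continuous_Q))).add
        ((c1 x cχ).mul (((c1 x w.continuous_H').mul (c1 x w.continuous_Q)).add
          ((c1 x w.continuous_H).mul (c1 x w.continuous_Q'))))
    have hP : ∫ t in (τ - r)..(τ + r), P t = 0 := by
      have hd : ∀ t ∈ uIcc (τ - r) (τ + r),
          HasDerivAt (fun t => coneWeight a τ r t x * (H t x * Q t x)) (P t) t := fun t _ =>
        (hasDerivAt_coneWeight_time a τ r t x).mul ((w.deriv_H t x).mul (w.deriv_Q t x))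
      have hx0 : 0 ≤ x / a := div_nonneg (hx₁.trans hx.1) ha.le
      have hz : (r - x / a) ^ 2 - r ^ 2 ≤ 0 := by nlinarith
      have e1 : coneWeight a τ r (τ + r) x = 0 := by
        simp [coneWeight, max_eq_right hz]
      have e2 : coneWeight a τ r (τ - r) x = 0 := by
        simp [coneWeight, max_eq_right hz]
      rw [intervalIntegral.integral_eq_sub_of_hasDerivAt hd (cP.intervalIntegrable _ _), e1, e2]
      simp
    calc ∫ t in (τ - r)..(τ + r), (Z x * A t x + (Z x)⁻¹ * B t x + C t x)
        ≤ ∫ t in (τ - r)..(τ + r), (-a⁻¹ * P t + D * |M|) := by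
          refine intervalIntegral.integral_mono_on (by linarith) ?_ ?_ fun t ht => ?_
          · exact ((((c1 x cA).const_smul (Z x)).add ((c1 x cB).const_smul (Z x)⁻¹)).add
              (c1 x cC)).intervalIntegrable _ _
          · exact ((continuous_const.mul cP).add continuous_const).intervalIntegrable _ _
          · refine (coneEnergy_integrand_le ha hc₀ hc (hlow x) hxr (H t x) (Q t x) (H' t x)
              (Q' t x)).trans ?_
            have h1 : E t x ≤ |M| := hM' t ht x ⟨hx₁.trans hx.1, hx.2.trans hx₂⟩
            have h0 : 0 ≤ E t x := by
              have := coneWeight_nonneg a τ r t x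
              positivity
            have h2 : |Z x - c| * E t x ≤ D * |M| :=
              mul_le_mul (hD x hx) h1 h0 hD0
            exact add_le_add le_rfl h2
      _ = |M| * (2 * r) * D := by
          have hI : IntervalIntegrable (fun t => -a⁻¹ * P t) volume (τ - r) (τ + r) :=
            (continuous_const.mul cP).intervalIntegrable _ _
          rw [intervalIntegral.integral_add hI intervalIntegrable_const, intervalIntegral.integral_const_mul, hP]
          simp
          ring
  have outer : ∫ x in x₁..x₂, ∫ t in (τ - r)..(τ + r),
      (Z x * A t x + (Z x)⁻¹ * B t x + C t x) ≤ |M| * (2 * r) * (x₂ - x₁) * D := by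
    have hI : IntervalIntegrable (fun x => ∫ t in (τ - r)..(τ + r),
        (Z x * A t x + (Z x)⁻¹ * B t x + C t x)) volume x₁ x₂ := by
      rw [intervalIntegrable_iff_integrableOn_Ioc_of_le hx₁₂]
      simp only [intervalIntegral.integral_of_le (by linarith : τ - r ≤ τ + r)]
      exact (hZ.integrable_combination cA cB cC (τ - r) (τ + r) x₁ x₂).integral_prod_right
    calc _ ≤ ∫ x in x₁..x₂, |M| * (2 * r) * D :=
          intervalIntegral.integral_mono_on hx₁₂ hI intervalIntegrable_const inner
      _ = _ := by simp; ring
  linarith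

/-- Both `c' / c` and `c / c'` are at most `1 + D / c₀`. The exponential form makes the costs of
successive changes of the frozen impedance multiply to the exponential of a total variation. -/
theorem coneEnergy_switch (w : IsPipeWave a ℓ Z H Q H' Q') {c₀ c c' D : ℝ} (hc₀ : 0 < c₀)
    (hc : c₀ ≤ c) (hc' : c₀ ≤ c') (hD : |c' - c| ≤ D) (τ : ℝ) {r : ℝ} (hr : 0 ≤ r) (x : ℝ) :
    (∫ t in (τ - r)..(τ + r), coneEnergy a τ r c' H Q t x) ≤
      Real.exp (D / c₀) * ∫ t in (τ - r)..(τ + r), coneEnergy a τ r c H Q t x := by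
  have cE : ∀ c x, Continuous fun t => coneEnergy a τ r c H Q t x := fun c x =>
    continuous_slice_time (w.continuous_coneEnergy τ r c) x
  have hcp : 0 < c := hc₀.trans_le hc
  have hcp' : 0 < c' := hc₀.trans_le hc'
  have hD0 : 0 ≤ D := (abs_nonneg _).trans hD
  have hexp : 1 + D / c₀ ≤ Real.exp (D / c₀) := by
    rw [add_comm]; exact Real.add_one_le_exp _
  have h1 : c' ≤ Real.exp (D / c₀) * c := by
    have : c' ≤ (1 + D / c₀) * c := by
      have h2 : c' - c ≤ D := (le_abs_self _).trans hD
      have h3 : D ≤ D / c₀ * c := by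
        rw [div_mul_eq_mul_div, le_div_iff₀ hc₀]
        gcongr
      linarith
    exact this.trans (by gcongr)
  have h1' : c'⁻¹ ≤ Real.exp (D / c₀) * c⁻¹ := by
    rw [inv_le_iff_one_le_mul₀ hcp', mul_assoc, mul_comm c⁻¹, ← div_eq_mul_inv]
    have : c ≤ Real.exp (D / c₀) * c' := by
      have : c ≤ (1 + D / c₀) * c' := by
        have h2 : c - c' ≤ D := by
          have := neg_abs_le (c' - c)
          linarith
        have h3 : D ≤ D / c₀ * c' := by
          rw [div_mul_eq_mul_div, le_div_iff₀ hc₀]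
          gcongr
        linarith
      exact this.trans (by gcongr)
    rw [← mul_div_assoc, le_div_iff₀ hcp, one_mul]
    exact this
  rw [← intervalIntegral.integral_const_mul]
  refine intervalIntegral.integral_mono_on (by linarith) ((cE _ _).intervalIntegrable _ _)
    ((continuous_const.mul (cE _ _)).intervalIntegrable _ _) fun t _ => ?_
  have hχ := coneWeight_nonneg a τ r t x
  calc coneEnergy a τ r c' H Q t x
      = coneWeight a τ r t x * (2⁻¹ * (c' * H t x ^ 2 + c'⁻¹ * Q t x ^ 2)) := rfl
    _ ≤ coneWeight a τ r t x * (2⁻¹ * (Real.exp (D / c₀) * c * H t x ^ 2 +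
          Real.exp (D / c₀) * c⁻¹ * Q t x ^ 2)) := by gcongr
    _ = Real.exp (D / c₀) * coneEnergy a τ r c H Q t x := by unfold coneEnergy; ring

/-- If a wave and its flux vanish at `x = 0` for `|t - τ| < r`, they vanish in the cone
`|t - τ| < r - x / a`. -/
theorem sideways (hZ : IsProfile Z) (w : IsPipeWave a ℓ Z H Q H' Q') (ha : 0 < a)
    {τ r : ℝ} (h0 : ∀ t, |t - τ| < r → H t 0 = 0 ∧ Q t 0 = 0) {y t₀ : ℝ} (hy : y ∈ Icc 0 ℓ)
    (ht₀ : |t₀ - τ| < r - y / a) : H t₀ y = 0 ∧ Q t₀ y = 0 := by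
  obtain ⟨c₀, hc₀, hlow⟩ := hZ.lower
  have hya : 0 ≤ y / a := div_nonneg hy.1 ha.le
  have hyr : y / a < r := by linarith [abs_nonneg (t₀ - τ)]
  have hr : 0 < r := hya.trans_lt hyr
  obtain ⟨M, hM0, hM⟩ := coneEnergy_growth hZ w ha hc₀ hlow τ hr.le hy.2 hyr.le
  obtain ⟨p, q, hp, hq, hpq⟩ := hZ.exists_sub
  -- The sum of the two monotone parts of `Z` dominates the variation of `Z` on every interval.
  let m : ℝ → ℝ := fun x => p x + q x
  have hm : ∀ x₁ x₂, x₁ ≤ x₂ → |Z x₂ - Z x₁| ≤ m x₂ - m x₁ := by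
    intro x₁ x₂ h
    have h1 := hp h
    have h2 := hq h
    rw [hpq, abs_le]
    simp only [m, Pi.sub_apply]
    constructor <;> linarith
  have hmono : Monotone m := hp.add hq
  let G : ℝ → ℝ → ℝ := fun c x => ∫ t in (τ - r)..(τ + r), coneEnergy a τ r c H Q t x
  have hG0 : ∀ c > 0, ∀ x, 0 ≤ G c x := fun c hc x =>
    intervalIntegral.integral_nonneg (by linarith) fun t _ => coneEnergy_nonneg hc _ _ _ _ _ _ _
  have cE : ∀ c x, Continuous fun t => coneEnergy a τ r c H Q t x := fun c x =>
    continuous_slice_time (w.continuous_coneEnergy τ r c) x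
  have hswitch : ∀ c ≥ c₀, ∀ c' ≥ c₀, ∀ D, |c' - c| ≤ D → ∀ x,
      G c' x ≤ Real.exp (D / c₀) * G c x := fun c hc c' hc' D hD x =>
    w.coneEnergy_switch hc₀ hc hc' hD τ hr.le x
  -- The exponential factor decreases by exactly what a switch from the frozen impedance `Z x₁` to
  -- `Z x₂` can cost. What remains for each step is the product of its length and the variation on
  -- it, as `le_of_le_add_mul_sub` requires.
  let Φ : ℝ → ℝ := fun x => Real.exp (-(m x / c₀)) * G (Z x) x
  have hΦ : Φ y ≤ Φ 0 := by
    refine le_of_le_add_mul_sub (m := m) (M := Real.exp (-(m 0 / c₀)) * M) hy.1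
      fun x₁ x₂ h1 h12 h2 => ?_
    have hD : 0 ≤ m x₂ - m x₁ := sub_nonneg.2 (hmono h12)
    have e1 := hswitch (Z x₁) (hlow x₁) (Z x₂) (hlow x₂) _ (hm x₁ x₂ h12) x₂
    have e2 := hM (Z x₁) (hlow x₁) x₁ x₂ (m x₂ - m x₁) h1 h12 h2 fun x hx =>
      (hm x₁ x hx.1).trans (by linarith [hmono hx.2])
    calc Φ x₂ ≤ Real.exp (-(m x₂ / c₀)) * (Real.exp ((m x₂ - m x₁) / c₀) * G (Z x₁) x₂) := by
          change Real.exp (-(m x₂ / c₀)) * G (Z x₂) x₂ ≤ _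
          gcongr
      _ = Real.exp (-(m x₁ / c₀)) * G (Z x₁) x₂ := by
          rw [← mul_assoc, ← Real.exp_add]
          congr 2
          ring
      _ ≤ Real.exp (-(m x₁ / c₀)) * (G (Z x₁) x₁ + M * (x₂ - x₁) * (m x₂ - m x₁)) := by
          gcongr
      _ = Φ x₁ + Real.exp (-(m x₁ / c₀)) * (M * (x₂ - x₁) * (m x₂ - m x₁)) := by
          rw [mul_add]
      _ ≤ Φ x₁ + Real.exp (-(m 0 / c₀)) * (M * (x₂ - x₁) * (m x₂ - m x₁)) := by
          have hx : 0 ≤ x₂ - x₁ := by linarith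
          have := hmono h1
          gcongr
      _ = _ := by ring
  have hΦ0 : Φ 0 = 0 := by
    have : G (Z 0) 0 = 0 := by
      refine (intervalIntegral.integral_congr (g := fun _ => 0) fun t ht => ?_).trans (by simp)
      rw [uIcc_of_le (by linarith)] at ht
      by_cases h : |t - τ| < r
      · simp [coneEnergy, h0 t h]
      · have : r ^ 2 - (t - τ) ^ 2 ≤ 0 := by
          rw [sub_nonpos]
          exact sq_le_sq.2 (by rw [abs_of_pos hr]; exact not_lt.1 h)
        simp [coneEnergy, coneWeight, max_eq_right this]
    simp [Φ, this]
  have hGy : G (Z y) y ≤ 0 := by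
    rw [hΦ0] at hΦ
    exact nonpos_of_mul_nonpos_right hΦ (Real.exp_pos _)
  have hzp := hZ.pos y
  have hzero : coneEnergy a τ r (Z y) H Q t₀ y = 0 := by
    by_contra hne
    have hlt : |t₀ - τ| < r := by linarith
    rw [abs_lt] at hlt
    have := intervalIntegral.integral_pos (by linarith : τ - r < τ + r) (cE (Z y) y).continuousOn
      (fun t _ => coneEnergy_nonneg hzp _ _ _ _ _ _ _)
      ⟨t₀, ⟨by linarith, by linarith⟩, lt_of_le_of_ne (coneEnergy_nonneg hzp _ _ _ _ _ _ _) (Ne.symm hne)⟩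
    exact absurd this (not_lt.2 hGy)
  have hχ : 0 < coneWeight a τ r t₀ y := by
    have : 0 < (r - y / a) ^ 2 - (t₀ - τ) ^ 2 := by
      rw [sub_pos]
      exact sq_lt_sq.2 (by rwa [abs_of_pos (by linarith : 0 < r - y / a)])
    unfold coneWeight
    rw [max_eq_left this.le]
    positivity
  have h3 : 2⁻¹ * (Z y * H t₀ y ^ 2 + (Z y)⁻¹ * Q t₀ y ^ 2) = 0 :=
    (mul_eq_zero.1 hzero).resolve_left hχ.ne'
  have h4 : 0 ≤ Z y * H t₀ y ^ 2 := by positivity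
  have h5 : 0 ≤ (Z y)⁻¹ * Q t₀ y ^ 2 := by positivity
  have h6 : Z y * H t₀ y ^ 2 = 0 := by linarith
  have h7 : (Z y)⁻¹ * Q t₀ y ^ 2 = 0 := by linarith
  constructor
  · simpa [hzp.ne'] using h6
  · simpa [hzp.ne'] using h7

end IsPipeWave

/-! ### Waves on the network that are functions -/

namespace TimeDist

theorem zero_apply (φ : TimeTest) : (0 : TimeDist) φ = 0 := rfl

theorem add_apply (S T : TimeDist) (φ : TimeTest) : (S + T) φ = S φ + T φ := rfl

theorem sub_apply (S T : TimeDist) (φ : TimeTest) : (S - T) φ = S φ - T φ := rfl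

theorem smul_apply (c : ℝ) (T : TimeDist) (φ : TimeTest) : (c • T) φ = c * T φ := rfl

theorem sum_apply {ι : Type*} (s : Finset ι) (T : ι → TimeDist) (φ : TimeTest) :
    (∑ i ∈ s, T i) φ = ∑ i ∈ s, T i φ := by
  classical
  induction s using Finset.induction_on with
  | empty => simp
  | insert i s hi ih => rw [Finset.sum_insert hi, Finset.sum_insert hi, add_apply, ih]

end TimeDist

namespace PipeNetwork

variable {V : Type*} (N : PipeNetwork V)

/-- The projection of the line to the pipe `e`. -/
def clamp (e : N.Pipe) (x : ℝ) : ℝ := max 0 (min x (N.length e))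

theorem clamp_mem (e : N.Pipe) (x : ℝ) : N.clamp e x ∈ Icc 0 (N.length e) :=
  ⟨le_max_left _ _, max_le (N.length_pos e).le (min_le_right _ _)⟩

theorem clamp_of_mem {e : N.Pipe} {x : ℝ} (hx : x ∈ Icc 0 (N.length e)) : N.clamp e x = x := by
  rw [clamp, min_eq_left hx.2, max_eq_right hx.1]

theorem continuous_clamp (e : N.Pipe) : Continuous (N.clamp e) := by
  unfold clamp
  fun_prop

theorem monotone_clamp (e : N.Pipe) : Monotone (N.clamp e) := fun _ _ h =>
  max_le_max le_rfl (min_le_min h le_rfl)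

/-- The impedance `g A / a`. -/
def impedance (e : N.Pipe) (x : ℝ) : ℝ := N.gravity * N.area e (N.clamp e x) / N.speed

theorem isProfile_impedance (e : N.Pipe) : IsProfile (N.impedance e) := by
  have ha := N.speed_pos
  have hg := N.gravity_pos
  constructor
  · obtain ⟨c, hc, h⟩ := N.area_lower e
    refine ⟨N.gravity * c / N.speed, by positivity, fun x => ?_⟩
    have := h _ (N.clamp_mem e x)
    unfold impedance
    gcongr
  · have h1 : BoundedVariationOn (fun x => N.area e (N.clamp e x)) univ :=
      ne_top_of_le_ne_top (N.area_bv e) (eVariationOn.comp_le_of_monotoneOn (N.area e) _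
        ((N.monotone_clamp e).monotoneOn _) fun x _ => N.clamp_mem e x)
    have h2 : LipschitzWith (N.gravity / N.speed).toNNReal
        (fun y : ℝ => N.gravity * y / N.speed) := by
      refine LipschitzWith.of_dist_le_mul fun x y => ?_
      rw [Real.dist_eq, Real.dist_eq, Real.coe_toNNReal _ (by positivity)]
      have : N.gravity * x / N.speed - N.gravity * y / N.speed =
        N.gravity / N.speed * (x - y) := by ring
      rw [this, abs_mul, abs_of_pos (by positivity : 0 < N.gravity / N.speed)]
    exact h2.comp_boundedVariationOn h1

theorem coord_mem (z : N.End) : N.coord z ∈ Icc 0 (N.length z.1) := by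
  have := (N.length_pos z.1).le
  unfold coord
  split_ifs <;> simp [this]

theorem normal_mul_self (z : N.End) : N.normal z * N.normal z = 1 := by
  unfold normal
  split_ifs <;> norm_num

theorem normal_ne_zero (z : N.End) : N.normal z ≠ 0 := fun h => by
  have := N.normal_mul_self z
  simp [h] at this

open Classical in
/-- Functions on the network that are waves on each pipe and satisfy the conditions at the
junctions; `H'` and `Q'` are the time derivatives. -/
structure IsNetWave [Finite V] (H Q H' Q' : N.Pipe → ℝ → ℝ → ℝ) : Prop where
  pipe : ∀ e, IsPipeWave N.speed (N.length e) (N.impedance e) (H e) (Q e) (H' e) (Q' e)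
  scalar : ∀ z z' : N.End, N.vertex z = N.vertex z' → ∀ t,
    H z.1 t (N.coord z) = H z'.1 t (N.coord z')
  kirchhoff : ∀ v, ¬ N.IsBoundary v → ∀ t,
    ∑ z : N.End with N.vertex z = v, N.normal z * Q z.1 t (N.coord z) = 0

/-- The functions `t, x ↦ T_x (φ (· - t))`. -/
def smoothen (T : N.Pipe → ℝ → TimeDist) (φ : TimeTest) (e : N.Pipe) (t x : ℝ) : ℝ :=
  T e (N.clamp e x) (φ.shift t)

theorem smoothen_of_mem (T : N.Pipe → ℝ → TimeDist) (φ : TimeTest) {e : N.Pipe} (t : ℝ) {x : ℝ}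
    (hx : x ∈ Icc 0 (N.length e)) : N.smoothen T φ e t x = T e x (φ.shift t) := by
  rw [smoothen, N.clamp_of_mem hx]

/-- The functions `t, x ↦ ∂ₜ T_x (φ (· - t))`. -/
def smoothenDeriv (T : N.Pipe → ℝ → TimeDist) (φ : TimeTest) (e : N.Pipe) (t x : ℝ) : ℝ :=
  (T e (N.clamp e x)).timeDeriv (φ.shift t)

variable {N}

theorem continuous_smoothen {T : N.Pipe → ℝ → TimeDist} {e : N.Pipe}
    (hT : ∀ φ : TimeTest, ContinuousOn (fun x => T e x φ) (Icc 0 (N.length e))) (φ : TimeTest) :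
    Continuous (Function.uncurry (N.smoothen T φ e)) := by
  have h := TimeDist.continuousOn_shift hT φ
  have h2 : Continuous fun p : ℝ × ℝ => ((p.1, N.clamp e p.2) : ℝ × ℝ) :=
    continuous_fst.prodMk ((N.continuous_clamp e).comp continuous_snd)
  exact h.comp_continuous h2 fun p => ⟨mem_univ _, N.clamp_mem e _⟩

theorem continuous_smoothenDeriv {T : N.Pipe → ℝ → TimeDist} {e : N.Pipe}
    (hT : ∀ φ : TimeTest, ContinuousOn (fun x => T e x φ) (Icc 0 (N.length e))) (φ : TimeTest) :
    Continuous (Function.uncurry (N.smoothenDeriv T φ e)) := by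
  have h := (continuous_smoothen hT φ.der).neg
  refine h.congr fun p => ?_
  simp [Function.uncurry, smoothen, smoothenDeriv, TimeDist.timeDeriv_apply, TimeTest.der_shift]

variable {O : N.Outlet}

/-- The pipe and junction equations hold for every test function, in particular for all translates
of `φ`. Joint continuity is `TimeDist.continuousOn_shift`. The outlet condition is left out since
time-dependent coefficients do not commute with translations. -/
theorem Outlet.IsWave.isNetWave [Finite V] {H Q : N.Pipe → ℝ → TimeDist} {F : O.Port → TimeDist}
    (w : O.IsWave H Q F) (φ : TimeTest) :
    N.IsNetWave (N.smoothen H φ) (N.smoothen Q φ) (N.smoothenDeriv H φ) (N.smoothenDeriv Q φ) where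
  pipe e :=
    { continuous_H := continuous_smoothen (w.continuous_H e) φ
      continuous_Q := continuous_smoothen (w.continuous_Q e) φ
      continuous_H' := continuous_smoothenDeriv (w.continuous_H e) φ
      continuous_Q' := continuous_smoothenDeriv (w.continuous_Q e) φ
      deriv_H := fun t x => TimeDist.hasDerivAt_shift _ φ t
      deriv_Q := fun t x => TimeDist.hasDerivAt_shift _ φ t
      eq_H := fun t x hx => by
        have h0 : (0 : ℝ) ∈ Icc 0 (N.length e) := ⟨le_rfl, (N.length_pos e).le⟩
        rw [N.smoothen_of_mem H φ t hx, N.smoothen_of_mem H φ t h0, w.equation_H e _ x hx]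
        refine intervalIntegral.integral_congr fun y hy => ?_
        rw [uIcc_of_le hx.1] at hy
        have hy' : y ∈ Icc 0 (N.length e) := ⟨hy.1, hy.2.trans hx.2⟩
        have ha := N.speed_pos.ne'
        simp only [smoothenDeriv, impedance, N.clamp_of_mem hy']
        field_simp
      eq_Q := fun t x hx => by
        have h0 : (0 : ℝ) ∈ Icc 0 (N.length e) := ⟨le_rfl, (N.length_pos e).le⟩
        rw [N.smoothen_of_mem Q φ t hx, N.smoothen_of_mem Q φ t h0, w.equation_Q e _ x hx]
        refine intervalIntegral.integral_congr fun y hy => ?_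
        rw [uIcc_of_le hx.1] at hy
        have hy' : y ∈ Icc 0 (N.length e) := ⟨hy.1, hy.2.trans hx.2⟩
        have ha := N.speed_pos.ne'
        simp only [smoothenDeriv, impedance, N.clamp_of_mem hy']
        field_simp }
  scalar z z' h t := by
    rw [N.smoothen_of_mem H φ t (N.coord_mem z), N.smoothen_of_mem H φ t (N.coord_mem z'),
      w.scalar_H z z' h]
  kirchhoff v hv t := by
    have h := congrArg (fun T : TimeDist => T (φ.shift t)) (w.kirchhoff v hv)
    simp only [TimeDist.sum_apply, TimeDist.smul_apply, TimeDist.zero_apply] at h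
    refine (Finset.sum_congr rfl fun z _ => ?_).trans h
    rw [N.smoothen_of_mem Q φ t (N.coord_mem z)]

/-! #### Summation over the pipe ends -/

theorem sum_ends [Finite V] (B : N.End → ℝ) :
    ∑ z : N.End, B z = ∑ e : N.Pipe, (B (e, false) + B (e, true)) := by
  rw [Fintype.sum_prod_type]
  refine Finset.sum_congr rfl fun e _ => ?_
  rw [Fintype.sum_bool, add_comm]

open Classical in
theorem sum_ends_eq_sum_boundary [Finite V] (B : N.End → ℝ)
    (hJ : ∀ v, ¬ N.IsBoundary v → ∑ z : N.End with N.vertex z = v, B z = 0) :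
    ∑ z : N.End, B z = ∑ z : N.End with N.IsBoundary (N.vertex z), B z := by
  have := Fintype.ofFinite V
  rw [← Finset.sum_fiberwise (g := N.vertex) (f := B),
    ← Finset.sum_fiberwise (s := Finset.univ.filter fun z => N.IsBoundary (N.vertex z))
      (g := N.vertex) (f := B)]
  refine Finset.sum_congr rfl fun v _ => ?_
  by_cases hv : N.IsBoundary v
  · rw [Finset.filter_filter]
    refine Finset.sum_congr (Finset.filter_congr fun z _ => ?_) fun _ _ => rfl
    constructor
    · rintro rfl
      exact ⟨hv, rfl⟩
    · exact fun h => h.2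
  · rw [hJ v hv, Finset.filter_filter, Finset.sum_eq_zero]
    rintro z hz
    rw [Finset.mem_filter] at hz
    exact absurd (hz.2.2 ▸ hz.2.1) hv

/-! #### Finite speed of propagation -/

/-- The affine interpolation on the pipes of a function on the vertices. -/
def interp (N : PipeNetwork V) (θ : V → ℝ) (e : N.Pipe) (x : ℝ) : ℝ :=
  θ (N.node e false) + (θ (N.node e true) - θ (N.node e false)) / N.length e * x

theorem interp_eq (θ : V → ℝ) (e : N.Pipe) (x : ℝ) :
    N.interp θ e x = (1 - x / N.length e) * θ (N.node e false) +
      x / N.length e * θ (N.node e true) := by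
  unfold interp
  ring

theorem interp_coord (θ : V → ℝ) (z : N.End) :
    N.interp θ z.1 (N.coord z) = θ (N.vertex z) := by
  obtain ⟨e, b⟩ := z
  have := (N.length_pos e).ne'
  cases b
  · simp [interp, coord, vertex]
  · simp [interp, coord, vertex]
    field_simp
    ring

theorem interp_mono {θ θ' : V → ℝ} (h : ∀ v, θ v ≤ θ' v) {e : N.Pipe} {x : ℝ}
    (hx : x ∈ Icc 0 (N.length e)) : N.interp θ e x ≤ N.interp θ' e x := by
  have hℓ := N.length_pos e
  have h1 : 0 ≤ x / N.length e := div_nonneg hx.1 hℓ.le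
  have h2 : 0 ≤ 1 - x / N.length e := by
    rw [sub_nonneg, div_le_one hℓ]
    exact hx.2
  rw [interp_eq, interp_eq]
  gcongr <;> exact h _

theorem interp_const (c : ℝ) (e : N.Pipe) (x : ℝ) : N.interp (fun _ => c) e x = c := by
  simp [interp]

theorem interp_sub_const (θ : V → ℝ) (c : ℝ) (e : N.Pipe) (x : ℝ) :
    N.interp (fun v => θ v - c) e x = N.interp θ e x - c := by
  simp [interp]
  ring

theorem interp_smul (θ : V → ℝ) (c : ℝ) (e : N.Pipe) (x : ℝ) :
    N.interp (fun v => c * θ v) e x = c * N.interp θ e x := by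
  simp [interp]
  ring

/-- Energy method on the surfaces `t = s + θ(x)`, with `θ` affine on each pipe. The Lipschitz
constant `lam / a` makes the energy definite. Its change is the flux through the vertices, which
cancels at junctions and is zero at boundary points below the surface `s = 0`. -/
theorem IsNetWave.vanish_of_lt [Finite V] {H Q H' Q' : N.Pipe → ℝ → ℝ → ℝ}
    (w : N.IsNetWave H Q H' Q') {θ : V → ℝ} {lam : ℝ} (hl : lam < 1)
    (hθ : ∀ e, |θ (N.node e true) - θ (N.node e false)| ≤ lam * (N.length e / N.speed))
    {T₀ : ℝ} (h0 : ∀ e, ∀ t < T₀, ∀ x ∈ Icc 0 (N.length e), H e t x = 0 ∧ Q e t x = 0)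
    (hb : ∀ z, N.IsBoundary (N.vertex z) → ∀ t < θ (N.vertex z),
      H z.1 t (N.coord z) * Q z.1 t (N.coord z) = 0)
    {e : N.Pipe} {t x : ℝ} (hx : x ∈ Icc 0 (N.length e)) (ht : t < N.interp θ e x) :
    H e t x = 0 ∧ Q e t x = 0 := by
  classical
  have ha := N.speed_pos
  let σ : N.Pipe → ℝ := fun e => (θ (N.node e true) - θ (N.node e false)) / N.length e
  have hσ : ∀ e, |σ e| ≤ lam / N.speed := by
    intro e
    have hℓ := N.length_pos e
    rw [abs_div, abs_of_pos hℓ, div_le_iff₀ hℓ]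
    exact (hθ e).trans_eq (by ring)
  let E : N.Pipe → ℝ → ℝ := fun e s => ∫ x in (0)..N.length e,
    IsPipeWave.energyDensity N.speed (σ e) (N.impedance e) (H e) (Q e) (s + θ (N.node e false)) x
  obtain ⟨B, hB⟩ : ∃ B, ∀ v, θ v ≤ B := by
    obtain ⟨B, hB⟩ := (Set.finite_range θ).bddAbove
    exact ⟨B, fun v => hB (mem_range_self v)⟩
  set s := t - N.interp θ e x with hs
  have hs0 : s < 0 := by linarith
  -- So early that the whole surface `t = s₁ + θ(x)` lies before `T₀`, where the wave is at rest.
  set s₁ := min s (T₀ - B - 1) with hs₁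
  have hE₁ : ∀ e, E e s₁ = 0 := by
    intro e
    refine (intervalIntegral.integral_congr (g := fun _ => 0) fun y hy => ?_).trans (by simp)
    rw [uIcc_of_le (N.length_pos e).le] at hy
    have h1 : N.interp θ e y ≤ B := (interp_mono hB hy).trans_eq (interp_const B e y)
    have h2 : s₁ ≤ T₀ - B - 1 := min_le_right _ _
    have h3 := h0 e (s₁ + θ (N.node e false) + σ e * y) (by
      have : θ (N.node e false) + σ e * y = N.interp θ e y := rfl
      linarith) y hy
    simp [IsPipeWave.energyDensity, h3]
  -- All pipe ends at a vertex are evaluated at the same time `r + θ`, which is what allows the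
  -- junction conditions to act on the sum.
  let B' : ℝ → N.End → ℝ := fun r z => N.normal z *
    (H z.1 (r + θ (N.vertex z)) (N.coord z) * Q z.1 (r + θ (N.vertex z)) (N.coord z))
  have hB' : ∀ r < 0, ∑ z, B' r z = 0 := by
    intro r hr
    rw [sum_ends_eq_sum_boundary]
    · refine Finset.sum_eq_zero fun z hz => ?_
      rw [Finset.mem_filter] at hz
      simp only [B']
      rw [hb z hz.2 _ (by linarith), mul_zero]
    · intro v hv
      by_cases hne : ∃ z₀ : N.End, N.vertex z₀ = v
      · obtain ⟨z₀, hz₀⟩ := hne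
        rw [← mul_zero (H z₀.1 (r + θ v) (N.coord z₀)), ← w.kirchhoff v hv (r + θ v),
          Finset.mul_sum]
        refine Finset.sum_congr rfl fun z hz => ?_
        rw [Finset.mem_filter] at hz
        simp only [B']
        rw [hz.2, w.scalar z z₀ (hz.2.trans hz₀.symm)]
        ring
      · rw [Finset.sum_eq_zero]
        intro z hz
        rw [Finset.mem_filter] at hz
        exact absurd ⟨z, hz.2⟩ hne
  have hcont : ∀ z, Continuous fun r => B' r z := by
    intro z
    have hH := continuous_slice_time (w.pipe z.1).continuous_H (N.coord z)
    have hQ := continuous_slice_time (w.pipe z.1).continuous_Q (N.coord z)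
    have hadd : Continuous fun r : ℝ => r + θ (N.vertex z) := by fun_prop
    exact continuous_const.mul ((hH.comp hadd).mul (hQ.comp hadd))
  have hEe : ∀ e, E e s = ∫ r in s₁..s, (B' r (e, false) + B' r (e, true)) := by
    intro e
    have hℓ := N.length_pos e
    have key := (w.pipe e).energy_sub (N.isProfile_impedance e) hℓ.le (σ e)
      (by linarith [min_le_left s (T₀ - B - 1)] :
        s₁ + θ (N.node e false) ≤ s + θ (N.node e false))
    have e0 : ∫ x in (0)..N.length e, IsPipeWave.energyDensity N.speed (σ e) (N.impedance e) (H e)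
      (Q e) (s₁ + θ (N.node e false)) x = 0 := hE₁ e
    rw [e0, sub_zero] at key
    have c1 := intervalIntegral.integral_comp_add_right (a := s₁) (b := s)
      (fun r => H e (r + σ e * 0) 0 * Q e (r + σ e * 0) 0) (θ (N.node e false))
    have c2 := intervalIntegral.integral_comp_add_right (a := s₁) (b := s)
      (fun r => H e (r + σ e * N.length e) (N.length e) * Q e (r + σ e * N.length e) (N.length e))
      (θ (N.node e false))
    change E e s = _ at key
    rw [key, ← c1, ← c2, intervalIntegral.integral_add ((hcont _).intervalIntegrable _ _)
      ((hcont _).intervalIntegrable _ _), sub_eq_add_neg, ← intervalIntegral.integral_neg]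
    have hσℓ : θ (N.node e false) + σ e * N.length e = θ (N.node e true) := by
      simp only [σ]
      field_simp
      ring
    congr 1
    · refine intervalIntegral.integral_congr fun r _ => ?_
      simp [B', normal, coord, vertex]
    · refine intervalIntegral.integral_congr fun r _ => ?_
      have : r + θ (N.node e false) + σ e * N.length e = r + θ (N.node e true) := by
        rw [← hσℓ]; ring
      simp [B', normal, coord, vertex, this]
  have hsum : ∑ e, E e s = 0 := by
    simp only [hEe]
    have hI : ∀ e ∈ (Finset.univ : Finset N.Pipe),
        IntervalIntegrable (fun r => B' r (e, false) + B' r (e, true)) volume s₁ s := fun e _ =>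
      ((hcont (e, false)).add (hcont (e, true))).intervalIntegrable _ _
    rw [← intervalIntegral.integral_finsetSum hI]
    refine (intervalIntegral.integral_congr (g := fun _ => 0) fun r hr => ?_).trans (by simp)
    rw [uIcc_of_le (min_le_left _ _)] at hr
    simp only
    rw [← sum_ends (B' r), hB' r (hr.2.trans_lt hs0)]
  have hnn : ∀ e, 0 ≤ E e s := fun e => IsPipeWave.energy_nonneg (N.isProfile_impedance e) ha
    (N.length_pos e).le hl (hσ e) _ _ _
  have hzero : E e s = 0 :=
    (Finset.sum_eq_zero_iff_of_nonneg fun e _ => hnn e).1 hsum e (Finset.mem_univ e)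
  have := (w.pipe e).eq_zero_of_energy (N.isProfile_impedance e) ha (N.length_pos e) hl (hσ e)
    hzero hx
  have ht' : s + θ (N.node e false) + σ e * x = t := by
    rw [hs]
    simp only [interp, σ]
    ring
  rwa [ht'] at this

end PipeNetwork

namespace TimeTest

theorem exists_tsupport_subset_Iic {φ : TimeTest} {c : ℝ} (h : tsupport φ ⊆ Iio c) :
    ∃ b < c, tsupport φ ⊆ Iic b := by
  by_cases hne : (tsupport φ).Nonempty
  · obtain ⟨b, hb, hmax⟩ := IsCompact.exists_isGreatest φ.hasCompactSupport hne
    exact ⟨b, h hb, hmax⟩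
  · rw [not_nonempty_iff_eq_empty] at hne
    exact ⟨c - 1, by linarith, by simp [hne]⟩

theorem tsupport_shift_subset {φ : TimeTest} {b : ℝ} (h : tsupport φ ⊆ Iic b) (t : ℝ) :
    tsupport (shift t φ) ⊆ Iic (b + t) := by
  rw [tsupport_shift]
  intro s hs
  have : s - t ≤ b := h hs
  rw [mem_Iic]
  linarith

theorem tsupport_mulSmooth_subset (α : ℝ → ℝ) (hα : ContDiff ℝ ∞ α) (φ : TimeTest) :
    tsupport (mulSmooth α hα φ) ⊆ tsupport φ :=
  tsupport_mul_subset_right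

end TimeTest

namespace PipeNetwork

open TimeTest Distribution

variable {V : Type*} {N : PipeNetwork V} {O : N.Outlet}

/-! #### The view from a pipe end -/

/-- The point at distance `d` from the pipe end `z`. -/
def fromEnd (N : PipeNetwork V) (z : N.End) (d : ℝ) : ℝ := if z.2 then N.length z.1 - d else d

theorem fromEnd_zero (z : N.End) : N.fromEnd z 0 = N.coord z := by
  simp [fromEnd, coord]

theorem fromEnd_mem {z : N.End} {d : ℝ} (hd : d ∈ Icc 0 (N.length z.1)) :
    N.fromEnd z d ∈ Icc 0 (N.length z.1) := by
  unfold fromEnd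
  split_ifs
  · exact ⟨by linarith [hd.2], by linarith [hd.1]⟩
  · exact hd

theorem abs_fromEnd_sub (z : N.End) (d : ℝ) : |N.fromEnd z d - N.coord z| = |d| := by
  unfold fromEnd coord
  split_ifs <;> simp

theorem isProfile_fromEnd (z : N.End) : IsProfile fun d => N.impedance z.1 (N.fromEnd z d) := by
  obtain ⟨e, b⟩ := z
  cases b
  · exact N.isProfile_impedance e
  · exact (N.isProfile_impedance e).reflect _

theorem IsNetWave.fromEnd [Finite V] {H Q H' Q' : N.Pipe → ℝ → ℝ → ℝ}
    (w : N.IsNetWave H Q H' Q') (z : N.End) :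
    IsPipeWave N.speed (N.length z.1) (fun d => N.impedance z.1 (N.fromEnd z d))
      (fun t d => H z.1 t (N.fromEnd z d)) (fun t d => N.normal z * Q z.1 t (N.fromEnd z d))
      (fun t d => H' z.1 t (N.fromEnd z d)) (fun t d => N.normal z * Q' z.1 t (N.fromEnd z d)) := by
  obtain ⟨e, b⟩ := z
  cases b
  · simpa [PipeNetwork.fromEnd, normal] using w.pipe e
  · simpa [PipeNetwork.fromEnd, normal] using (w.pipe e).reverse (N.isProfile_impedance e)

theorem endArea_pos (z : N.End) : 0 < N.endArea z := by
  obtain ⟨c, hc, h⟩ := N.area_lower z.1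
  exact hc.trans_le (h _ (N.coord_mem z))

/-- The impedance at a pipe end. -/
def endImpedance (N : PipeNetwork V) (z : N.End) : ℝ := N.gravity * N.endArea z / N.speed

theorem endImpedance_pos (z : N.End) : 0 < N.endImpedance z := by
  have := N.speed_pos
  have := N.gravity_pos
  have := N.endArea_pos z
  unfold endImpedance
  positivity

theorem exists_const_impedance (hA : N.AreaConstNearBoundary) (z : N.End)
    (hz : N.IsBoundary (N.vertex z)) :
    ∃ y > 0, y ≤ N.length z.1 ∧
      ∀ d ∈ Icc 0 y, N.impedance z.1 (N.fromEnd z d) = N.endImpedance z := by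
  obtain ⟨ε, hε, h⟩ := hA z hz
  have hℓ := N.length_pos z.1
  refine ⟨min (ε / 2) (N.length z.1), by positivity, min_le_right _ _, fun d hd => ?_⟩
  have hmem := N.fromEnd_mem (z := z) ⟨hd.1, hd.2.trans (min_le_right _ _)⟩
  rw [impedance, N.clamp_of_mem hmem, h _ hmem, endImpedance]
  rw [abs_fromEnd_sub, abs_of_nonneg hd.1]
  have := hd.2.trans (min_le_left _ _)
  linarith

/-- The wave incident on a pipe end comes from the interior of the pipe. -/
theorem Outlet.IsWave.incident [Finite V] {H Q : N.Pipe → ℝ → TimeDist} {F : O.Port → TimeDist}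
    (w : O.IsWave H Q F) {z : N.End} {y : ℝ} (hy : 0 ≤ y) (hyℓ : y ≤ N.length z.1)
    (hc : ∀ d ∈ Icc 0 y, N.impedance z.1 (N.fromEnd z d) = N.endImpedance z) (φ : TimeTest) :
    H z.1 (N.coord z) φ - (N.endImpedance z)⁻¹ * (N.normal z * Q z.1 (N.coord z) φ) =
      H z.1 (N.fromEnd z y) (φ.shift (-(y / N.speed))) - (N.endImpedance z)⁻¹ *
        (N.normal z * Q z.1 (N.fromEnd z y) (φ.shift (-(y / N.speed)))) := by
  have key := ((w.isNetWave φ).fromEnd z).transport (isProfile_fromEnd z) hy hyℓ hc 0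
  have hm := fromEnd_mem (z := z) ⟨hy, hyℓ⟩
  simp only [fromEnd_zero] at key
  rw [N.smoothen_of_mem H φ _ (N.coord_mem z), N.smoothen_of_mem Q φ _ (N.coord_mem z),
    N.smoothen_of_mem H φ _ hm, N.smoothen_of_mem Q φ _ hm, shift_zero, zero_sub] at key
  exact key

/-! #### Finite speed of propagation for weak solutions -/

theorem Outlet.Port.vertex_pos (v : O.Port) : N.vertex v.pos = v.1 := v.2.1.choose_spec.1

theorem Outlet.Port.eq_pos (v : O.Port) {z : N.End} (hz : N.vertex z = v.1) : z = v.pos :=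
  v.2.1.choose_spec.2 z hz

theorem Outlet.eq_pos {z : N.End} (hz : N.vertex z = O.vertex) : z = O.pos :=
  O.isBoundary.unique hz rfl

theorem Outlet.boundary_cases {z : N.End} (hz : N.IsBoundary (N.vertex z)) :
    z = O.pos ∨ ∃ v : O.Port, z = v.pos := by
  by_cases h : N.vertex z = O.vertex
  · exact Or.inl (O.eq_pos h)
  · exact Or.inr ⟨⟨N.vertex z, hz, h⟩, Outlet.Port.eq_pos _ rfl⟩

theorem Outlet.IsWave.normal_mul_Q [Finite V] {H Q : N.Pipe → ℝ → TimeDist}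
    {F : O.Port → TimeDist} (w : O.IsWave H Q F) (v : O.Port) (φ : TimeTest) :
    N.normal v.pos * Q v.pos.1 (N.coord v.pos) φ = F v φ := by
  rw [← w.flow v]
  rfl

/-- Propagation from the boundary, when the values at the outlet are known to vanish. -/
theorem Outlet.IsWave.vanish_of_outlet [Finite V] {H Q : N.Pipe → ℝ → TimeDist}
    {F : O.Port → TimeDist} (w : O.IsWave H Q F) {θ : V → ℝ} {lam : ℝ} (hl : lam < 1)
    (hθ : ∀ e, |θ (N.node e true) - θ (N.node e false)| ≤ lam * (N.length e / N.speed))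
    (hF : ∀ v : O.Port, IsVanishingOn (F v) (Iio (θ v)))
    (hO : IsVanishingOn (Q O.pos.1 (N.coord O.pos)) (Iio (θ O.vertex)))
    {e : N.Pipe} {x : ℝ} (hx : x ∈ Icc 0 (N.length e)) :
    IsVanishingOn (H e x) (Iio (N.interp θ e x)) ∧
      IsVanishingOn (Q e x) (Iio (N.interp θ e x)) := by
  rw [IsVanishingOn, IsVanishingOn, ← forall_and]
  intro (φ : TimeTest)
  rw [← imp_and]
  intro hφ
  obtain ⟨b, hb, hφb⟩ := exists_tsupport_subset_Iic hφ
  have key := (w.isNetWave φ).vanish_of_lt (θ := fun v => θ v - b) hl (by simpa using hθ)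
    (T₀ := -b) (fun e t ht x hx => by
      rw [N.smoothen_of_mem H φ t hx, N.smoothen_of_mem Q φ t hx]
      have hs : tsupport (φ.shift t) ⊆ Iio 0 :=
        (tsupport_shift_subset hφb t).trans (Iic_subset_Iio.2 (by linarith))
      exact ⟨w.initial_H e x hx _ hs, w.initial_Q e x hx _ hs⟩)
    (fun z hz t ht => by
      rw [N.smoothen_of_mem Q φ t (N.coord_mem z)]
      have hs : tsupport (φ.shift t) ⊆ Iio (θ (N.vertex z)) :=
        (tsupport_shift_subset hφb t).trans (Iic_subset_Iio.2 (by linarith))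
      rcases O.boundary_cases hz with rfl | ⟨v, rfl⟩
      · rw [hO _ hs, mul_zero]
      · rw [v.vertex_pos] at hs
        have := w.normal_mul_Q v (φ.shift t)
        rw [hF v _ hs] at this
        rw [(mul_eq_zero.1 this).resolve_left (N.normal_ne_zero _), mul_zero])
    hx (t := 0) (by rw [interp_sub_const]; linarith)
  rwa [N.smoothen_of_mem H φ _ hx, N.smoothen_of_mem Q φ _ hx, shift_zero] at key

/-- If no wave is incident on the outlet, then the wave vanishes at the outlet. -/
theorem Outlet.IsWave.vanish_at_outlet [Finite V] {H Q : N.Pipe → ℝ → TimeDist}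
    {F : O.Port → TimeDist} (w : O.IsWave H Q F) {c : ℝ}
    (hc : ∀ φ : TimeTest, tsupport φ ⊆ Iio c → H O.pos.1 (N.coord O.pos) φ -
      (N.endImpedance O.pos)⁻¹ * (N.normal O.pos * Q O.pos.1 (N.coord O.pos) φ) = 0) :
    IsVanishingOn (Q O.pos.1 (N.coord O.pos)) (Iio c) := by
  intro (φ : TimeTest) hφ
  set ν := N.normal O.pos
  set Z := N.endImpedance O.pos
  have hZ : 0 < Z := endImpedance_pos _
  have hν : ν * ν = 1 := N.normal_mul_self _
  -- Without an incident wave `H = Z⁻¹ ν Q`, so the outlet condition becomes `Z⁻¹ ν γ Q = 0`.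
  -- Inactivity of the outlet makes `γ` invertible, and the condition is tested with `φ / γ`.
  let γ : ℝ → ℝ := fun t => O.α t * ν * Z + O.β t
  have hγ : ∀ t, γ t ≠ 0 := O.inactive
  have hγs : ContDiff ℝ ∞ fun t => (γ t)⁻¹ :=
    (((O.α_smooth.mul contDiff_const).mul contDiff_const).add O.β_smooth).inv hγ
  let ψ := mulSmooth (fun t => (γ t)⁻¹) hγs φ
  have hψ : tsupport ψ ⊆ Iio c := (tsupport_mulSmooth_subset _ _ _).trans hφ
  have h1 := w.outlet ψ
  have h2 := hc (mulSmooth O.β O.β_smooth ψ) ((tsupport_mulSmooth_subset _ _ _).trans hψ)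
  have h3 : Q O.pos.1 (N.coord O.pos) (mulSmooth O.α O.α_smooth ψ +
      (Z⁻¹ * ν) • mulSmooth O.β O.β_smooth ψ) = 0 := by
    rw [map_add, map_smul, smul_eq_mul]
    linarith
  have h4 : mulSmooth O.α O.α_smooth ψ + (Z⁻¹ * ν) • mulSmooth O.β O.β_smooth ψ =
      (Z⁻¹ * ν) • φ := by
    ext t
    change O.α t * ((γ t)⁻¹ * φ t) + Z⁻¹ * ν * (O.β t * ((γ t)⁻¹ * φ t)) = Z⁻¹ * ν * φ t
    have e1 : O.α t = Z⁻¹ * ν * (O.α t * ν * Z) := by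
      have : Z⁻¹ * ν * (O.α t * ν * Z) = O.α t * (ν * ν) * (Z⁻¹ * Z) := by ring
      rw [this, hν, inv_mul_cancel₀ hZ.ne']
      ring
    calc _ = Z⁻¹ * ν * ((O.α t * ν * Z) * ((γ t)⁻¹ * φ t)) +
          Z⁻¹ * ν * (O.β t * ((γ t)⁻¹ * φ t)) := by
            rw [← mul_assoc (Z⁻¹ * ν) (O.α t * ν * Z), ← e1]
      _ = Z⁻¹ * ν * φ t * (γ t * (γ t)⁻¹) := by simp only [γ]; ring
      _ = _ := by rw [mul_inv_cancel₀ (hγ t), mul_one]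
  rw [h4, map_smul, smul_eq_mul] at h3
  exact (mul_eq_zero.1 h3).resolve_left
    (mul_ne_zero (inv_ne_zero hZ.ne') (N.normal_ne_zero _))

theorem interp_fromEnd_ge {θ : V → ℝ} {L : ℝ} {z : N.End}
    (hθ : |θ (N.node z.1 true) - θ (N.node z.1 false)| ≤ L * N.length z.1) {d : ℝ} (hd : 0 ≤ d) :
    θ (N.vertex z) - L * d ≤ N.interp θ z.1 (N.fromEnd z d) := by
  obtain ⟨e, b⟩ := z
  have hℓ := N.length_pos e
  have h1 : |(θ (N.node e true) - θ (N.node e false)) / N.length e| ≤ L := by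
    rw [abs_div, abs_of_pos hℓ, div_le_iff₀ hℓ]
    exact hθ
  set σ := (θ (N.node e true) - θ (N.node e false)) / N.length e with hσ
  have h2 : σ * N.length e = θ (N.node e true) - θ (N.node e false) := by
    rw [hσ]; field_simp
  rw [abs_le] at h1
  have h3 := mul_le_mul_of_nonneg_right h1.1 hd
  have h4 := mul_le_mul_of_nonneg_right h1.2 hd
  cases b
  · simp only [vertex, fromEnd, interp, Bool.false_eq_true, if_false]
    rw [← hσ]
    linarith
  · simp only [vertex, fromEnd, interp, if_true]
    rw [← hσ]
    linarith

/-- Bootstrap in time at the outlet: silence in the network below `min θ (n κ)` shows that no wave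
is incident on the outlet for a further time `κ`. Then the outlet is silent for that time as well,
and `vanish_of_outlet` raises the cap to `(n + 1) κ`. -/
theorem Outlet.IsWave.vanish_of_strict [Finite V] {H Q : N.Pipe → ℝ → TimeDist}
    {F : O.Port → TimeDist} (w : O.IsWave H Q F) (hA : N.AreaConstNearBoundary)
    {θ : V → ℝ} {lam : ℝ} (hl : lam < 1)
    (hθ : ∀ e, |θ (N.node e true) - θ (N.node e false)| ≤ lam * (N.length e / N.speed))
    (hF : ∀ v : O.Port, IsVanishingOn (F v) (Iio (θ v)))
    {e : N.Pipe} {x : ℝ} (hx : x ∈ Icc 0 (N.length e)) :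
    IsVanishingOn (H e x) (Iio (N.interp θ e x)) ∧
      IsVanishingOn (Q e x) (Iio (N.interp θ e x)) := by
  have ha := N.speed_pos
  obtain ⟨y, hy, hyℓ, hc⟩ := exists_const_impedance hA O.pos O.isBoundary
  -- The wave needs `y / a` to cross the segment of constant impedance, while `θ` drops by at most
  -- `lam * y / a` along it; the gain is the difference.
  set κ := (1 - lam) * (y / N.speed) with hκ
  have hκ0 : 0 < κ := mul_pos (by linarith) (by positivity)
  have step : ∀ n : ℕ, ∀ e, ∀ x ∈ Icc 0 (N.length e),
      IsVanishingOn (H e x) (Iio (N.interp (fun v => min (θ v) (n * κ)) e x)) ∧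
        IsVanishingOn (Q e x) (Iio (N.interp (fun v => min (θ v) (n * κ)) e x)) := by
    have hlip : ∀ T e, |min (θ (N.node e true)) T - min (θ (N.node e false)) T| ≤
        lam * (N.length e / N.speed) := by
      intro T e
      refine le_trans ?_ (hθ e)
      exact (abs_min_sub_min_le_max _ _ _ _).trans (by simp)
    intro n
    induction n with
    | zero =>
      intro e x hx
      have : N.interp (fun v => min (θ v) ((0 : ℕ) * κ)) e x ≤ 0 :=
        (interp_mono (fun v => by simp) hx).trans_eq (interp_const 0 e x)
      exact ⟨(w.initial_H e x hx).mono (Iio_subset_Iio this),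
        (w.initial_Q e x hx).mono (Iio_subset_Iio this)⟩
    | succ n ih =>
      intro e x hx
      refine w.vanish_of_outlet hl (hlip _) (fun v => (hF v).mono (Iio_subset_Iio (min_le_left _ _)))
        ?_ hx
      refine IsVanishingOn.mono (Iio_subset_Iio ?_) (w.vanish_at_outlet
        (c := min (θ O.vertex) (n * κ) + κ) fun φ hφ => ?_)
      · push_cast
        rw [add_mul, one_mul, ← min_add_add_right]
        exact min_le_min (by linarith) le_rfl
      · rw [w.incident hy.le hyℓ hc]
        have hm := fromEnd_mem (z := O.pos) ⟨hy.le, hyℓ⟩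
        have hge := interp_fromEnd_ge (z := O.pos) (θ := fun v => min (θ v) (n * κ))
          (L := lam / N.speed) (by rw [div_mul_eq_mul_div, ← mul_div_assoc']; exact hlip _ _) hy.le
        obtain ⟨b, hb, hφb⟩ := exists_tsupport_subset_Iic hφ
        have hs : tsupport (φ.shift (-(y / N.speed))) ⊆
            Iio (N.interp (fun v => min (θ v) (n * κ)) O.pos.1 (N.fromEnd O.pos y)) := by
          refine (tsupport_shift_subset hφb _).trans (Iic_subset_Iio.2 (lt_of_lt_of_le ?_ hge))
          have e1 : lam / N.speed * y = lam * (y / N.speed) := by ring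
          change _ < min (θ O.vertex) _ - _
          rw [e1]
          linarith
        rw [(ih _ _ hm).1 _ hs, (ih _ _ hm).2 _ hs]
        simp
  obtain ⟨B, hB⟩ := (Set.finite_range θ).bddAbove
  obtain ⟨n, hn⟩ := exists_nat_ge (B / κ)
  have hθn : (fun v => min (θ v) (n * κ)) = θ := by
    funext v
    refine min_eq_left ((hB (mem_range_self v)).trans ?_)
    rwa [div_le_iff₀ hκ0] at hn
  have := step n e x hx
  rwa [hθn] at this

/-- Finite speed of propagation. -/
theorem Outlet.IsWave.vanish [Finite V] {H Q : N.Pipe → ℝ → TimeDist}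
    {F : O.Port → TimeDist} (w : O.IsWave H Q F) (hA : N.AreaConstNearBoundary)
    {θ : V → ℝ} (h0 : ∀ v, 0 ≤ θ v)
    (hθ : ∀ e, |θ (N.node e true) - θ (N.node e false)| ≤ N.length e / N.speed)
    (hF : ∀ v : O.Port, IsVanishingOn (F v) (Iio (θ v)))
    {e : N.Pipe} {x : ℝ} (hx : x ∈ Icc 0 (N.length e)) :
    IsVanishingOn (H e x) (Iio (N.interp θ e x)) ∧
      IsVanishingOn (Q e x) (Iio (N.interp θ e x)) := by
  rw [IsVanishingOn, IsVanishingOn, ← forall_and]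
  intro (φ : TimeTest)
  rw [← imp_and]
  intro hφ
  obtain ⟨b, hb, hφb⟩ := exists_tsupport_subset_Iic hφ
  -- The limiting slope `1 / a` is reached by scaling `θ` with `lam < 1`. Since `θ ≥ 0`, the scaled
  -- function is smaller and the hypothesis on the flows persists; the support of `φ` leaves room
  -- for `lam` close to `1`.
  obtain ⟨lam, hlam, hlam0, hlam1⟩ : ∃ lam, b < lam * N.interp θ e x ∧ 0 < lam ∧ lam < 1 := by
    have ht : Tendsto (fun lam : ℝ => lam * N.interp θ e x) (𝓝[<] 1) (𝓝 (1 * N.interp θ e x)) :=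
      (Continuous.tendsto (by fun_prop) 1).mono_left nhdsWithin_le_nhds
    rw [one_mul] at ht
    have h1 := ht.eventually (Ioi_mem_nhds hb)
    have h2 : ∀ᶠ lam : ℝ in 𝓝[<] 1, lam ∈ Ioo (0 : ℝ) 1 := Ioo_mem_nhdsLT zero_lt_one
    obtain ⟨lam, h⟩ := (h1.and h2).exists
    exact ⟨lam, h.1, h.2.1, h.2.2⟩
  have key := w.vanish_of_strict hA (θ := fun v => lam * θ v) hlam1 (fun e => by
      rw [← mul_sub, abs_mul, abs_of_pos hlam0]
      gcongr
      exact hθ e) (fun v => (hF v).mono (Iio_subset_Iio (by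
        have := h0 v
        nlinarith))) hx
  rw [interp_smul] at key
  have hs : tsupport φ ⊆ Iio (lam * N.interp θ e x) := hφb.trans (Iic_subset_Iio.2 hlam)
  exact ⟨key.1 _ hs, key.2 _ hs⟩

end PipeNetwork

/-! ### Commutativity of convolution and localisation with test functions. -/

namespace TimeTest

/-- Exchanging the two factors of a convolution of test functions. -/
theorem integral_mul_shift_comm (T : TimeDist) (φ ψ : TimeTest) :
    ∫ s, ψ s * T (shift s φ) = ∫ s, φ s * T (shift s ψ) := by
  have key : ∀ φ ψ : TimeTest, ∫ s, ψ s * T (shift s φ) = T (smear (reflect 0 ψ) φ) := by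
    intro φ ψ
    rw [TimeDist.apply_smear T (reflect 0 ψ).continuous.locallyIntegrable
      (reflect 0 ψ).hasCompactSupport, ← integral_neg_eq_self]
    refine integral_congr_ae (ae_of_all _ fun s => ?_)
    simp
  rw [key, key]
  congr 1
  ext r
  rw [smear_apply (reflect 0 ψ).continuous.locallyIntegrable (reflect 0 ψ).hasCompactSupport,
    smear_apply (reflect 0 φ).continuous.locallyIntegrable (reflect 0 φ).hasCompactSupport,
    ← integral_sub_left_eq_self _ volume (-r)]
  refine integral_congr_ae (ae_of_all _ fun s => ?_)
  simp only [reflect_apply]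
  rw [mul_comm]
  congr 2 <;> ring

/-- A continuous function with zero integral against all test functions with support near a point
vanishes at this point. -/
theorem eq_zero_of_integral_mul {f : ℝ → ℝ} (hf : Continuous f) {U : Set ℝ} (hU : IsOpen U)
    (h : ∀ ψ : TimeTest, tsupport ψ ⊆ U → ∫ s, ψ s * f s = 0) {s : ℝ} (hs : s ∈ U) : f s = 0 := by
  have h1 := hU.ae_eq_zero_of_integral_contDiff_smul_eq_zero (μ := volume) (f := f)
    (hf.locallyIntegrable.locallyIntegrableOn U)
    fun g g1 g2 g3 => h ⟨g, g1, g2, fun _ _ => trivial⟩ g3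
  have h2 : f =ᵐ[volume.restrict U] fun _ => 0 := by
    rw [Filter.EventuallyEq, ae_restrict_iff' hU.measurableSet]
    exact h1
  exact Measure.eqOn_open_of_ae_eq h2 hU hf.continuousOn continuousOn_const hs

end TimeTest

namespace PipeNetwork

open TimeTest Distribution

variable {V : Type*} {N : PipeNetwork V} {O : N.Outlet}

/-! #### The distance of vertices -/

theorem walkLength_nonneg {u v : V} (w : N.graph.Walk u v) : 0 ≤ N.walkLength w := by
  refine List.sum_nonneg fun x hx => ?_
  obtain ⟨d, -, rfl⟩ := List.mem_map.1 hx
  exact (N.length_pos _).le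

theorem bddBelow_walkLength (u v : V) :
    BddBelow (range fun w : N.graph.Walk u v => N.walkLength w) :=
  ⟨0, by rintro _ ⟨w, rfl⟩; exact walkLength_nonneg w⟩

instance (u v : V) : Nonempty (N.graph.Walk u v) := N.isTree.1.preconnected u v

theorem nodeDist_nonneg (u v : V) : 0 ≤ N.nodeDist u v :=
  le_ciInf fun w => walkLength_nonneg w

theorem nodeDist_le {u v : V} (w : N.graph.Walk u v) : N.nodeDist u v ≤ N.walkLength w :=
  ciInf_le (bddBelow_walkLength u v) w

theorem nodeDist_self (u : V) : N.nodeDist u u = 0 :=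
  le_antisymm ((nodeDist_le SimpleGraph.Walk.nil).trans_eq (by simp [walkLength]))
    (nodeDist_nonneg u u)

theorem walkLength_append {u v w : V} (p : N.graph.Walk u v) (q : N.graph.Walk v w) :
    N.walkLength (p.append q) = N.walkLength p + N.walkLength q := by
  simp [walkLength, SimpleGraph.Walk.darts_append]

theorem walkLength_reverse {u v : V} (p : N.graph.Walk u v) :
    N.walkLength p.reverse = N.walkLength p := by
  unfold walkLength
  rw [SimpleGraph.Walk.darts_reverse, List.map_reverse, List.sum_reverse, List.map_map]
  congr 2
  funext d
  simp

theorem nodeDist_comm (u v : V) : N.nodeDist u v = N.nodeDist v u := by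
  have : ∀ u v, N.nodeDist u v ≤ N.nodeDist v u := fun u v =>
    le_ciInf fun w => (nodeDist_le w.reverse).trans_eq (walkLength_reverse w)
  exact le_antisymm (this u v) (this v u)

theorem nodeDist_triangle (u v w : V) : N.nodeDist u w ≤ N.nodeDist u v + N.nodeDist v w := by
  have h1 : ∀ (p : N.graph.Walk u v), N.nodeDist u w - N.walkLength p ≤ N.nodeDist v w := fun p =>
    le_ciInf fun q => by
      have := nodeDist_le (p.append q)
      rw [walkLength_append] at this
      linarith
  have h2 : N.nodeDist u w - N.nodeDist v w ≤ N.nodeDist u v := le_ciInf fun p => by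
    linarith [h1 p]
  linarith

theorem adj_node (e : N.Pipe) : N.graph.Adj (N.node e false) (N.node e true) := by
  rw [← SimpleGraph.mem_edgeSet, N.node_spec e]
  exact e.2

theorem nodeDist_node_le (e : N.Pipe) :
    N.nodeDist (N.node e false) (N.node e true) ≤ N.length e := by
  refine (nodeDist_le (N.adj_node e).toWalk).trans_eq ?_
  simp [walkLength, SimpleGraph.Dart.edge, N.node_spec e]

theorem abs_nodeTT_sub_le (u : V) (e : N.Pipe) :
    |N.nodeTT u (N.node e true) - N.nodeTT u (N.node e false)| ≤ N.length e / N.speed := by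
  have ha := N.speed_pos
  unfold nodeTT
  rw [← sub_div, abs_div, abs_of_pos ha]
  gcongr
  have h1 := nodeDist_triangle (N := N) u (N.node e false) (N.node e true)
  have h2 := nodeDist_triangle (N := N) u (N.node e true) (N.node e false)
  rw [nodeDist_comm (N.node e true)] at h2
  have h3 := nodeDist_node_le e
  rw [abs_le]
  constructor <;> linarith

theorem nodeTT_nonneg (u v : V) : 0 ≤ N.nodeTT u v :=
  div_nonneg (nodeDist_nonneg u v) N.speed_pos.le

theorem nodeTT_self (u : V) : N.nodeTT u u = 0 := by
  rw [nodeTT, nodeDist_self, zero_div]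

theorem nodeTT_comm (u v : V) : N.nodeTT u v = N.nodeTT v u := by
  rw [nodeTT, nodeDist_comm, nodeTT]

/-! #### The response at a boundary point for small times -/

/-- The wave incident on the port stems from the point at distance `y`, at a time `y / a` earlier.
For times below `y / a` that wave is still zero, so pressure and flow at the port are related by the
end impedance alone. -/
theorem Outlet.exists_early (hA : N.AreaConstNearBoundary) (v : O.Port) [Finite V] :
    ∃ ε > 0, ∀ (H Q : N.Pipe → ℝ → TimeDist) (F : O.Port → TimeDist), O.IsWave H Q F →
      IsVanishingOn (H v.pos.1 (N.coord v.pos) -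
        (N.speed / (N.endArea v.pos * N.gravity)) • F v) (Iio ε) := by
  have ha := N.speed_pos
  obtain ⟨y, hy, hyℓ, hc⟩ := exists_const_impedance hA v.pos (by rw [v.vertex_pos]; exact v.2.1)
  refine ⟨y / N.speed, by positivity, fun H Q F w => ?_⟩
  intro (φ : TimeTest) hφ
  have hm := fromEnd_mem (z := v.pos) ⟨hy.le, hyℓ⟩
  have key := w.incident hy.le hyℓ hc φ
  have hs : tsupport (φ.shift (-(y / N.speed))) ⊆ Iio 0 := by
    obtain ⟨b, hb, hφb⟩ := exists_tsupport_subset_Iic hφ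
    exact (tsupport_shift_subset hφb _).trans (Iic_subset_Iio.2 (by linarith))
  have hi : (N.endImpedance v.pos)⁻¹ = N.speed / (N.endArea v.pos * N.gravity) := by
    rw [endImpedance, inv_div, mul_comm]
  rw [w.initial_H _ _ hm _ hs, w.initial_Q _ _ hm _ hs, w.normal_mul_Q, hi] at key
  rw [TimeDist.sub_apply, TimeDist.smul_apply, key]
  simp

/-! #### Reciprocity -/

open Classical in
theorem Outlet.sum_boundary [Finite V] (B : N.End → ℝ) :
    ∑ z : N.End with N.IsBoundary (N.vertex z), B z = B O.pos + ∑ v : O.Port, B v.pos := by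
  have hset : (Finset.univ.filter fun z : N.End => N.IsBoundary (N.vertex z)) =
      insert O.pos (Finset.univ.image fun v : O.Port => v.pos) := by
    ext z
    simp only [Finset.mem_filter, Finset.mem_univ, true_and, Finset.mem_insert, Finset.mem_image]
    constructor
    · intro hz
      rcases O.boundary_cases hz with h | ⟨v, h⟩
      · exact Or.inl h
      · exact Or.inr ⟨v, h.symm⟩
    · rintro (rfl | ⟨v, rfl⟩)
      · exact O.isBoundary
      · rw [v.vertex_pos]
        exact v.2.1
  rw [hset, Finset.sum_insert, Finset.sum_image]
  · intro v _ v' _ h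
    apply Subtype.ext
    rw [← v.vertex_pos, ← v'.vertex_pos]
    exact congrArg N.vertex h
  · simp only [Finset.mem_image, Finset.mem_univ, true_and, not_exists]
    intro v h
    exact v.2.2 (by rw [← v.vertex_pos, h]; rfl)

/-- On each pipe the convolved fluxes at the two ends cancel. In the sum over all ends, common
pressure and mass conservation remove the junctions, and only boundary points remain. -/
theorem IsNetWave.reciprocity [Finite V] {h q h' q' H Q H' Q' : N.Pipe → ℝ → ℝ → ℝ}
    (w₁ : N.IsNetWave h q h' q') (w₂ : N.IsNetWave H Q H' Q') (O : N.Outlet)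
    (t : ℝ) {s₁ s₂ : ℝ} (hs : s₁ ≤ s₂)
    (h₁ : ∀ e, ∀ x ∈ Icc 0 (N.length e), h e s₁ x = 0 ∧ q e s₁ x = 0)
    (h₂ : ∀ e, ∀ x ∈ Icc 0 (N.length e), H e (t - s₂) x = 0 ∧ Q e (t - s₂) x = 0) :
    (∫ s in s₁..s₂, (h O.pos.1 s (N.coord O.pos) * (N.normal O.pos *
          Q O.pos.1 (t - s) (N.coord O.pos)) -
        (N.normal O.pos * q O.pos.1 s (N.coord O.pos)) * H O.pos.1 (t - s) (N.coord O.pos))) +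
      ∑ v : O.Port, ∫ s in s₁..s₂, (h v.pos.1 s (N.coord v.pos) * (N.normal v.pos *
          Q v.pos.1 (t - s) (N.coord v.pos)) -
        (N.normal v.pos * q v.pos.1 s (N.coord v.pos)) *
          H v.pos.1 (t - s) (N.coord v.pos)) = 0 := by
  classical
  let b : N.End → ℝ → ℝ := fun z s => h z.1 s (N.coord z) * (N.normal z * Q z.1 (t - s) (N.coord z)) -
    (N.normal z * q z.1 s (N.coord z)) * H z.1 (t - s) (N.coord z)
  have hb : ∀ z, Continuous (b z) := by
    intro z
    have c1 := continuous_slice_time (w₁.pipe z.1).continuous_H (N.coord z)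
    have c2 := continuous_slice_time (w₁.pipe z.1).continuous_Q (N.coord z)
    have c3 := continuous_slice_time (w₂.pipe z.1).continuous_H (N.coord z)
    have c4 := continuous_slice_time (w₂.pipe z.1).continuous_Q (N.coord z)
    have c5 : Continuous fun s : ℝ => t - s := by fun_prop
    exact (c1.mul (continuous_const.mul (c4.comp c5))).sub
      ((continuous_const.mul c2).mul (c3.comp c5))
  let B : N.End → ℝ := fun z => ∫ s in s₁..s₂, b z s
  have e1 : ∑ z, B z = 0 := by
    rw [sum_ends]
    refine Finset.sum_eq_zero fun e _ => ?_
    have key := (w₁.pipe e).reciprocity (N.isProfile_impedance e) (w₂.pipe e)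
      (N.length_pos e).le t hs (h₁ e) (h₂ e)
    have f1 : B (e, true) = -∫ s in s₁..s₂, (h e s (N.length e) * Q e (t - s) (N.length e) -
        q e s (N.length e) * H e (t - s) (N.length e)) := by
      rw [← intervalIntegral.integral_neg]
      refine intervalIntegral.integral_congr fun s _ => ?_
      simp [b, normal, coord]
      ring
    have f2 : B (e, false) = ∫ s in s₁..s₂, (h e s 0 * Q e (t - s) 0 - q e s 0 * H e (t - s) 0) := by
      refine intervalIntegral.integral_congr fun s _ => ?_
      simp [b, normal, coord]
    rw [f1, f2, key, add_neg_cancel]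
  rw [sum_ends_eq_sum_boundary B, O.sum_boundary] at e1
  · exact e1
  · intro v hv
    change ∑ z : N.End with N.vertex z = v, ∫ s in s₁..s₂, b z s = 0
    rw [← intervalIntegral.integral_finsetSum fun z _ => (hb z).intervalIntegrable _ _]
    refine (intervalIntegral.integral_congr (g := fun _ => 0) fun s _ => ?_).trans (by simp)
    by_cases hne : ∃ z₀ : N.End, N.vertex z₀ = v
    · obtain ⟨z₀, hz₀⟩ := hne
      have : ∑ z : N.End with N.vertex z = v, b z s =
          h z₀.1 s (N.coord z₀) *
            (∑ z : N.End with N.vertex z = v, N.normal z * Q z.1 (t - s) (N.coord z)) -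
          (∑ z : N.End with N.vertex z = v, N.normal z * q z.1 s (N.coord z)) *
            H z₀.1 (t - s) (N.coord z₀) := by
        rw [Finset.mul_sum, Finset.sum_mul, ← Finset.sum_sub_distrib]
        refine Finset.sum_congr rfl fun z hz => ?_
        rw [Finset.mem_filter] at hz
        have hzz := hz.2.trans hz₀.symm
        simp only [b]
        rw [w₁.scalar z z₀ hzz, w₂.scalar z z₀ hzz]
      simp only
      rw [this, w₁.kirchhoff v hv, w₂.kirchhoff v hv]
      simp
    · refine Finset.sum_eq_zero fun z hz => ?_
      rw [Finset.mem_filter] at hz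
      exact absurd ⟨z, hz.2⟩ hne

open Classical in
/-- The boundary flow of an impulse at the accessible boundary point `i`. -/
def Outlet.impulse (V₀ : ℝ) (i v : O.Port) : TimeDist :=
  if v = i then V₀ • Distribution.delta 0 else 0

theorem Outlet.impulse_apply_self (V₀ : ℝ) (i : O.Port) (φ : TimeTest) :
    Outlet.impulse V₀ i i φ = V₀ * φ 0 := by
  rw [impulse, if_pos rfl, TimeDist.smul_apply]
  congr 1

theorem Outlet.impulse_apply_of_ne (V₀ : ℝ) {i v : O.Port} (h : v ≠ i) (φ : TimeTest) :
    Outlet.impulse V₀ i v φ = 0 := by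
  rw [impulse, if_neg h, TimeDist.zero_apply]

theorem Outlet.isVanishingOn_impulse (V₀ : ℝ) (i v : O.Port) :
    IsVanishingOn (Outlet.impulse V₀ i v) (Iio (N.nodeTT i v)) := by
  intro (φ : TimeTest) hφ
  by_cases h : v = i
  · subst h
    rw [nodeTT_self] at hφ
    rw [impulse_apply_self, image_eq_zero_of_notMem_tsupport (f := φ), mul_zero]
    exact fun h0 => lt_irrefl (0 : ℝ) (hφ h0)
  · rw [impulse_apply_of_ne V₀ h]

/-- The responses to two impulses, up to a term at the outlet. -/
theorem Outlet.IsWave.reciprocity_impulse [Finite V] {V₀ : ℝ} (hV₀ : V₀ ≠ 0) {i j : O.Port}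
    {h q H Q : N.Pipe → ℝ → TimeDist} (w₁ : O.IsWave h q (Outlet.impulse V₀ i))
    (w₂ : O.IsWave H Q (Outlet.impulse V₀ j)) {φ ψ : TimeTest}
    (hO : ∀ s, h O.pos.1 (N.coord O.pos) (shift s φ) * Q O.pos.1 (N.coord O.pos) (shift (-s) ψ) -
      q O.pos.1 (N.coord O.pos) (shift s φ) * H O.pos.1 (N.coord O.pos) (shift (-s) ψ) = 0) :
    ∫ s, ψ s * (h j.pos.1 (N.coord j.pos) (shift s φ) -
      H i.pos.1 (N.coord i.pos) (shift s φ)) = 0 := by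
  classical
  obtain ⟨R₁, hR₁, hφ⟩ := TimeDist.exists_interval φ
  obtain ⟨R₂, hR₂, hψ⟩ := TimeDist.exists_interval ψ
  -- So large that translation by `-R` moves both test functions into negative times, where the
  -- waves are at rest.
  set R := max R₁ R₂ + 1 with hR
  have hRφ : ∀ s, R - 1 < |s| → φ s = 0 := fun s hs => hφ s (by
    have := le_max_left R₁ R₂; linarith)
  have hRψ : ∀ s, R - 1 < |s| → ψ s = 0 := fun s hs => hψ s (by
    have := le_max_right R₁ R₂; linarith)
  have hR1 : 1 < R := by have := le_max_left R₁ R₂; linarith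
  have hsupp : ∀ χ : TimeTest, (∀ s, R - 1 < |s| → χ s = 0) → tsupport (shift (-R) χ) ⊆ Iio 0 := by
    intro χ hχ
    have : tsupport χ ⊆ Iic (R - 1) := by
      refine closure_minimal (fun s hs => ?_) isClosed_Iic
      by_contra hlt
      rw [mem_Iic, not_le] at hlt
      exact hs (hχ s (hlt.trans_le (le_abs_self s)))
    exact (tsupport_shift_subset this _).trans (Iic_subset_Iio.2 (by linarith))
  have key := (w₁.isNetWave φ).reciprocity (w₂.isNetWave ψ) O 0 (s₁ := -R) (s₂ := R) (by linarith)
    (fun e x hx => by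
      rw [N.smoothen_of_mem h φ _ hx, N.smoothen_of_mem q φ _ hx]
      exact ⟨w₁.initial_H e x hx _ (hsupp φ hRφ), w₁.initial_Q e x hx _ (hsupp φ hRφ)⟩)
    (fun e x hx => by
      rw [N.smoothen_of_mem H ψ _ hx, N.smoothen_of_mem Q ψ _ hx, zero_sub]
      exact ⟨w₂.initial_H e x hx _ (hsupp ψ hRψ), w₂.initial_Q e x hx _ (hsupp ψ hRψ)⟩)
  simp only [N.smoothen_of_mem _ _ _ (N.coord_mem _), zero_sub, w₁.normal_mul_Q,
    w₂.normal_mul_Q] at key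
  have e0 : ∫ s in -R..R, (h O.pos.1 (N.coord O.pos) (shift s φ) * (N.normal O.pos *
        Q O.pos.1 (N.coord O.pos) (shift (-s) ψ)) - (N.normal O.pos * q O.pos.1 (N.coord O.pos)
          (shift s φ)) * H O.pos.1 (N.coord O.pos) (shift (-s) ψ)) = 0 := by
    refine (intervalIntegral.integral_congr (g := fun _ => 0) fun s _ => ?_).trans (by simp)
    have := congrArg (N.normal O.pos * ·) (hO s)
    simp only [mul_zero] at this
    simp only
    linarith
  have toInterval : ∀ (χ : TimeTest), (∀ s, R - 1 < |s| → χ s = 0) → ∀ f : ℝ → ℝ,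
      ∫ s, χ s * f s = ∫ s in -R..R, χ s * f s := by
    intro χ hχ f
    rw [intervalIntegral.integral_of_le (by linarith), setIntegral_eq_integral_of_forall_compl_eq_zero]
    intro s hs
    rw [hχ s, zero_mul]
    by_contra hle
    rw [not_lt] at hle
    rw [abs_le] at hle
    exact hs ⟨by linarith, by linarith⟩
  have c1 : Continuous fun s => h j.pos.1 (N.coord j.pos) (shift s φ) :=
    TimeDist.continuous_shift _ _
  have c2 : Continuous fun s => H i.pos.1 (N.coord i.pos) (shift (-s) ψ) :=
    (TimeDist.continuous_shift _ _).comp continuous_neg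
  have c3 : Continuous fun s => φ (-s) := φ.continuous.comp continuous_neg
  have port : ∀ v : O.Port, ∫ s in -R..R, (h v.pos.1 (N.coord v.pos) (shift s φ) *
      Outlet.impulse V₀ j v (shift (-s) ψ) - Outlet.impulse V₀ i v (shift s φ) *
        H v.pos.1 (N.coord v.pos) (shift (-s) ψ)) =
      (if v = j then V₀ * ∫ s in -R..R, ψ s * h j.pos.1 (N.coord j.pos) (shift s φ) else 0) -
      (if v = i then V₀ * ∫ s in -R..R, φ (-s) * H i.pos.1 (N.coord i.pos) (shift (-s) ψ)
        else 0) := by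
    intro v
    have a1 : ∀ s, h v.pos.1 (N.coord v.pos) (shift s φ) * Outlet.impulse V₀ j v (shift (-s) ψ) =
        if v = j then V₀ * (ψ s * h j.pos.1 (N.coord j.pos) (shift s φ)) else 0 := by
      intro s
      split_ifs with hv
      · subst hv
        rw [Outlet.impulse_apply_self, shift_apply]
        simp
        ring
      · rw [Outlet.impulse_apply_of_ne V₀ hv, mul_zero]
    have a2 : ∀ s, Outlet.impulse V₀ i v (shift s φ) * H v.pos.1 (N.coord v.pos) (shift (-s) ψ) =
        if v = i then V₀ * (φ (-s) * H i.pos.1 (N.coord i.pos) (shift (-s) ψ)) else 0 := by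
      intro s
      split_ifs with hv
      · subst hv
        rw [Outlet.impulse_apply_self, shift_apply]
        simp
        ring
      · rw [Outlet.impulse_apply_of_ne V₀ hv, zero_mul]
    simp only [a1, a2]
    rw [intervalIntegral.integral_sub]
    · congr 1
      · split_ifs
        · rw [intervalIntegral.integral_const_mul]
        · simp
      · split_ifs
        · rw [intervalIntegral.integral_const_mul]
        · simp
    · split_ifs
      · exact (continuous_const.mul (ψ.continuous.mul c1)).intervalIntegrable _ _
      · simp
    · split_ifs
      · exact (continuous_const.mul (c3.mul c2)).intervalIntegrable _ _
      · simp
  rw [e0, zero_add] at key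
  simp only [port] at key
  rw [Finset.sum_sub_distrib, Finset.sum_ite_eq' Finset.univ j, Finset.sum_ite_eq' Finset.univ i,
    if_pos (Finset.mem_univ _), if_pos (Finset.mem_univ _), ← mul_sub] at key
  have key2 := (mul_eq_zero.1 key).resolve_left hV₀
  rw [intervalIntegral.integral_comp_neg (fun s => φ s * H i.pos.1 (N.coord i.pos) (shift s ψ)),
    neg_neg, ← toInterval ψ hRψ, ← toInterval φ hRφ,
    ← integral_mul_shift_comm (H i.pos.1 (N.coord i.pos)) φ ψ] at key2
  have i1 : ∀ T : TimeDist, Integrable fun s => ψ s * T (shift s φ) := by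
    intro T
    have := locallyIntegrable_mul (TimeDist.continuous_shift T φ).locallyIntegrable ψ
    simpa [mul_comm] using this
  simp only [mul_sub]
  rw [integral_sub (i1 _) (i1 _)]
  exact key2

/-- The outlet term of the convolution needs both waves at `x₀`. They arrive there no earlier than
the two travel times, so the convolution vanishes before the sum of these. -/
theorem Outlet.IsWave.reciprocity_early [Finite V] {V₀ : ℝ} (hV₀ : V₀ ≠ 0)
    (hA : N.AreaConstNearBoundary) {i j : O.Port}
    {h q H Q : N.Pipe → ℝ → TimeDist} (w₁ : O.IsWave h q (Outlet.impulse V₀ i))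
    (w₂ : O.IsWave H Q (Outlet.impulse V₀ j)) :
    IsVanishingOn (h j.pos.1 (N.coord j.pos) - H i.pos.1 (N.coord i.pos))
      (Iio (N.nodeTT i O.vertex + N.nodeTT O.vertex j)) := by
  intro (φ : TimeTest) hφ
  obtain ⟨b, hb, hφb⟩ := exists_tsupport_subset_Iic hφ
  set δ := N.nodeTT i O.vertex + N.nodeTT O.vertex j - b with hδ
  have hδ0 : 0 < δ := by linarith
  have v₁ := w₁.vanish hA (θ := N.nodeTT i) (nodeTT_nonneg _) (abs_nodeTT_sub_le _)
    (Outlet.isVanishingOn_impulse V₀ i) (N.coord_mem O.pos)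
  have v₂ := w₂.vanish hA (θ := N.nodeTT j) (nodeTT_nonneg _) (abs_nodeTT_sub_le _)
    (Outlet.isVanishingOn_impulse V₀ j) (N.coord_mem O.pos)
  rw [interp_coord] at v₁ v₂
  have := TimeTest.eq_zero_of_integral_mul (f := fun s => h j.pos.1 (N.coord j.pos) (shift s φ) -
      H i.pos.1 (N.coord i.pos) (shift s φ)) (U := Iio δ)
    ((TimeDist.continuous_shift _ _).sub (TimeDist.continuous_shift _ _)) isOpen_Iio
    (fun ψ hψ => w₁.reciprocity_impulse hV₀ w₂ fun s => by
      obtain ⟨b', hb', hψb⟩ := exists_tsupport_subset_Iic hψ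
      -- Either the first factor is tested before its wave arrives at the outlet, or the second one
      -- is, because `b + b'` is less than the sum of the travel times.
      by_cases hs : b + s < N.nodeTT i O.vertex
      · have : tsupport (shift s φ) ⊆ Iio (N.nodeTT i O.vertex) :=
          (tsupport_shift_subset hφb s).trans (Iic_subset_Iio.2 hs)
        rw [v₁.1 _ this, v₁.2 _ this]
        simp
      · have : tsupport (shift (-s) ψ) ⊆ Iio (N.nodeTT j O.vertex) := by
          refine (tsupport_shift_subset hψb (-s)).trans (Iic_subset_Iio.2 ?_)
          rw [nodeTT_comm]
          linarith
        rw [v₂.1 _ this, v₂.2 _ this]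
        simp) (s := 0) hδ0
  simpa [TimeDist.sub_apply] using this

/-- By proportionality `α / γ` and `β / γ` are constant in time, where `γ` is the nonvanishing
combination from the inactivity condition. Testing with `φ / γ` freezes the coefficients at time
`0`. -/
theorem Outlet.IsWave.outlet_const [Finite V] {H Q : N.Pipe → ℝ → TimeDist}
    {F : O.Port → TimeDist} (w : O.IsWave H Q F)
    (hc : ∀ s t, O.α s * O.β t = O.α t * O.β s) (φ : TimeTest) :
    O.α 0 * Q O.pos.1 (N.coord O.pos) φ + O.β 0 * H O.pos.1 (N.coord O.pos) φ = 0 := by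
  set c := N.normal O.pos * (N.gravity * N.endArea O.pos / N.speed) with hcdef
  let γ : ℝ → ℝ := fun t => O.α t * c + O.β t
  have hγ : ∀ t, γ t ≠ 0 := fun t => by
    have := O.inactive t
    rwa [mul_assoc] at this
  have hγs : ContDiff ℝ ∞ fun t => (γ t)⁻¹ :=
    ((O.α_smooth.mul contDiff_const).add O.β_smooth).inv hγ
  have h1 := w.outlet (mulSmooth (fun t => (γ t)⁻¹) hγs φ)
  have e1 : mulSmooth O.α O.α_smooth (mulSmooth (fun t => (γ t)⁻¹) hγs φ) =
      (O.α 0 * (γ 0)⁻¹) • φ := by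
    ext t
    change O.α t * ((γ t)⁻¹ * φ t) = O.α 0 * (γ 0)⁻¹ * φ t
    have := hγ t
    have := hγ 0
    field_simp
    simp only [γ]
    linear_combination (φ t) * hc t 0
  have e2 : mulSmooth O.β O.β_smooth (mulSmooth (fun t => (γ t)⁻¹) hγs φ) =
      (O.β 0 * (γ 0)⁻¹) • φ := by
    ext t
    change O.β t * ((γ t)⁻¹ * φ t) = O.β 0 * (γ 0)⁻¹ * φ t
    have := hγ t
    have := hγ 0
    field_simp
    simp only [γ]
    linear_combination (φ t) * c * hc 0 t
  rw [e1, e2, map_smul, map_smul, smul_eq_mul, smul_eq_mul] at h1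
  have h0 := hγ 0
  field_simp at h1
  linarith

/-- The outlet flux `h Q - q H` is the determinant of two vectors annihilated by the same nonzero
linear form. -/
theorem Outlet.IsWave.reciprocity_const [Finite V] {V₀ : ℝ} (hV₀ : V₀ ≠ 0) {i j : O.Port}
    {h q H Q : N.Pipe → ℝ → TimeDist} (w₁ : O.IsWave h q (Outlet.impulse V₀ i))
    (w₂ : O.IsWave H Q (Outlet.impulse V₀ j)) (hc : ∀ s t, O.α s * O.β t = O.α t * O.β s) :
    h j.pos.1 (N.coord j.pos) = H i.pos.1 (N.coord i.pos) := by
  ext φ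
  have := TimeTest.eq_zero_of_integral_mul (f := fun s => h j.pos.1 (N.coord j.pos) (shift s φ) -
      H i.pos.1 (N.coord i.pos) (shift s φ)) (U := univ)
    ((TimeDist.continuous_shift _ _).sub (TimeDist.continuous_shift _ _)) isOpen_univ
    (fun ψ _ => w₁.reciprocity_impulse hV₀ w₂ fun s => by
      have h1 := w₁.outlet_const hc (shift s φ)
      have h2 := w₂.outlet_const hc (shift (-s) ψ)
      have h0 := O.inactive 0
      by_cases hα : O.α 0 = 0
      · rw [hα] at h0 h1 h2
        have hβ : O.β 0 ≠ 0 := by simpa using h0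
        simp only [zero_mul, zero_add] at h1 h2
        rw [(mul_eq_zero.1 h1).resolve_left hβ, (mul_eq_zero.1 h2).resolve_left hβ]
        simp
      · refine (mul_eq_zero.1 ?_).resolve_left hα
        linear_combination h O.pos.1 (N.coord O.pos) (shift s φ) * h2 -
          H O.pos.1 (N.coord O.pos) (shift (-s) ψ) * h1) (s := 0) (mem_univ _)
  rw [shift_zero] at this
  exact sub_eq_zero.1 this

end PipeNetwork

namespace PipeNetwork

open TimeTest Distribution

variable {V : Type*} {N : PipeNetwork V} {O : N.Outlet}

/-! #### The two sides of a pipe -/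

/-- The opposite end of a pipe. -/
def opp (N : PipeNetwork V) (z : N.End) : N.End := (z.1, !z.2)

theorem opp_opp (z : N.End) : N.opp (N.opp z) = z := by simp [opp]

theorem eq_or_eq_opp {z z' : N.End} (h : z'.1 = z.1) : z' = z ∨ z' = N.opp z := by
  obtain ⟨e, b⟩ := z
  obtain ⟨e', b'⟩ := z'
  obtain rfl : e' = e := h
  cases b <;> cases b' <;> simp [opp]

theorem edge_eq (z : N.End) : s(N.vertex z, N.vertex (N.opp z)) = (z.1 : Sym2 V) := by
  obtain ⟨e, b⟩ := z
  rw [← N.node_spec e]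
  cases b
  · rfl
  · exact Sym2.eq_swap

theorem adj_opp (z : N.End) : N.graph.Adj (N.vertex z) (N.vertex (N.opp z)) := by
  rw [← SimpleGraph.mem_edgeSet, edge_eq]
  exact z.1.2

theorem vertex_opp_ne (z : N.End) : N.vertex (N.opp z) ≠ N.vertex z := (adj_opp z).ne'

theorem exists_end_of_adj {u v : V} (h : N.graph.Adj u v) :
    ∃ z : N.End, N.vertex z = u ∧ N.vertex (N.opp z) = v ∧ (z.1 : Sym2 V) = s(u, v) := by
  let e : N.Pipe := ⟨s(u, v), h⟩
  have he := N.node_spec e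
  rcases Sym2.eq_iff.1 he with ⟨h1, h2⟩ | ⟨h1, h2⟩
  · exact ⟨(e, false), h1, h2, rfl⟩
  · exact ⟨(e, true), h2, h1, rfl⟩

/-- The vertices on the side of the end `z` of a pipe, when the pipe is removed. -/
def Beyond (N : PipeNetwork V) (z : N.End) (v : V) : Prop :=
  ¬ (N.graph.deleteEdges {(z.1 : Sym2 V)}).Reachable (N.vertex (N.opp z)) v

theorem not_beyond_opp (z : N.End) : ¬ N.Beyond z (N.vertex (N.opp z)) :=
  fun h => h (SimpleGraph.Reachable.refl _)

/-- Every edge of a tree is a bridge. -/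
theorem beyond_self (z : N.End) : N.Beyond z (N.vertex z) := by
  have hb := (SimpleGraph.isAcyclic_iff_forall_isBridge.1 N.isTree.2) z.1.2
  rw [← edge_eq, SimpleGraph.isBridge_iff, edge_eq] at hb
  exact fun h => hb h.symm

theorem reachable_deleteEdges_of_ne {z z' : N.End} (h : z'.1 ≠ z.1) :
    (N.graph.deleteEdges {(z.1 : Sym2 V)}).Reachable (N.vertex z') (N.vertex (N.opp z')) := by
  refine SimpleGraph.Adj.reachable ?_
  rw [SimpleGraph.deleteEdges_adj]
  refine ⟨adj_opp z', ?_⟩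
  rw [edge_eq, mem_singleton_iff]
  exact fun h' => h (Subtype.ext h')

theorem beyond_iff_of_ne {z z' : N.End} (h : z'.1 ≠ z.1) :
    N.Beyond z (N.vertex z') ↔ N.Beyond z (N.vertex (N.opp z')) := by
  have hr := reachable_deleteEdges_of_ne h
  exact not_congr ⟨fun h1 => h1.trans hr, fun h1 => h1.trans hr.symm⟩

theorem nodeDist_opp_le (z : N.End) :
    N.nodeDist (N.vertex z) (N.vertex (N.opp z)) ≤ N.length z.1 := by
  obtain ⟨e, b⟩ := z
  cases b
  · exact nodeDist_node_le e
  · rw [nodeDist_comm]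
    exact nodeDist_node_le e

/-- Induction along the walk: a step through any other pipe stays on the same side, and the first
step through the pipe of `z` starts at `z` and ends at the opposite end. -/
theorem walkLength_ge_of_beyond {z : N.End} {u r : V} (w : N.graph.Walk u r) (hu : N.Beyond z u)
    (hr : ¬ N.Beyond z r) :
    N.nodeDist u (N.vertex z) + N.length z.1 + N.nodeDist (N.vertex (N.opp z)) r ≤
      N.walkLength w := by
  induction w with
  | nil => exact absurd hu hr
  | cons h w ih =>
    obtain ⟨z', rfl, rfl, hz'⟩ := exists_end_of_adj h
    have hl : N.walkLength (SimpleGraph.Walk.cons h w) = N.length z'.1 + N.walkLength w := by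
      simp only [walkLength, SimpleGraph.Walk.darts_cons, List.map_cons, List.sum_cons]
      congr 2
      exact Subtype.ext hz'.symm
    rw [hl]
    by_cases he : z'.1 = z.1
    · rcases eq_or_eq_opp he with rfl | rfl
      · rw [nodeDist_self]
        linarith [nodeDist_le w]
      · exact absurd hu (not_beyond_opp z)
    · have := ih ((beyond_iff_of_ne he).1 hu) hr
      have h1 := nodeDist_triangle (N := N) (N.vertex z') (N.vertex (N.opp z')) (N.vertex z)
      have h2 := nodeDist_opp_le z'
      linarith

/-- The way from one side of a pipe to the other one leads through the pipe. -/
theorem nodeDist_eq_of_beyond {z : N.End} {u r : V} (hu : N.Beyond z u) (hr : ¬ N.Beyond z r) :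
    N.nodeDist u r =
      N.nodeDist u (N.vertex z) + N.length z.1 + N.nodeDist (N.vertex (N.opp z)) r := by
  refine le_antisymm ?_ (le_ciInf fun w => walkLength_ge_of_beyond w hu hr)
  have h1 := nodeDist_triangle (N := N) u (N.vertex z) r
  have h2 := nodeDist_triangle (N := N) (N.vertex z) (N.vertex (N.opp z)) r
  have h3 := nodeDist_opp_le z
  linarith

theorem nodeDist_eq_of_not_beyond {z : N.End} {r : V} (hr : ¬ N.Beyond z r) :
    N.nodeDist (N.vertex z) r = N.length z.1 + N.nodeDist (N.vertex (N.opp z)) r := by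
  rw [nodeDist_eq_of_beyond (beyond_self z) hr, nodeDist_self, zero_add]

/-- Deleting one pipe leaves at most two components. The claim holds at an end of the pipe and is
transported along a walk, whose steps either use another pipe or start at an end of this one. -/
theorem not_beyond_or_not_beyond (z : N.End) (v : V) :
    ¬ N.Beyond z v ∨ ¬ N.Beyond (N.opp z) v := by
  have key : ∀ {u : V} (_ : N.graph.Walk v u), (¬ N.Beyond z u ∨ ¬ N.Beyond (N.opp z) u) →
      (¬ N.Beyond z v ∨ ¬ N.Beyond (N.opp z) v) := by
    intro u w
    induction w with
    | nil => exact id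
    | cons h w ih =>
      intro hu
      obtain ⟨z', rfl, rfl, hz'⟩ := exists_end_of_adj h
      by_cases he : z'.1 = z.1
      · rcases eq_or_eq_opp he with rfl | rfl
        · right
          have := not_beyond_opp (N.opp z')
          rwa [opp_opp] at this
        · exact Or.inl (not_beyond_opp z)
      · have := ih hu
        rwa [← beyond_iff_of_ne he, ← beyond_iff_of_ne (z := N.opp z) he] at this
  obtain ⟨w⟩ := N.isTree.1.preconnected v (N.vertex (N.opp z))
  exact key w (Or.inl (not_beyond_opp z))

theorem beyond_of_not_beyond_opp {z : N.End} {v : V} (h : ¬ N.Beyond (N.opp z) v) :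
    N.Beyond z v := by
  intro h'
  have h1 : (N.graph.deleteEdges {(z.1 : Sym2 V)}).Reachable (N.vertex z) v := by
    have := not_not.1 h
    rwa [opp_opp] at this
  exact beyond_self z (h'.trans h1.symm)

theorem beyond_opp_iff (z : N.End) (v : V) : N.Beyond (N.opp z) v ↔ ¬ N.Beyond z v := by
  constructor
  · intro h
    exact (not_beyond_or_not_beyond z v).resolve_right (not_not.2 h)
  · intro h
    by_contra h'
    exact h (beyond_of_not_beyond_opp h')

/-- A walk between distinct vertices contains a pipe, and among finitely many pipes there is a
shortest one. -/
theorem nodeDist_pos [Finite V] {u v : V} (h : u ≠ v) : 0 < N.nodeDist u v := by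
  have hne : Nonempty N.Pipe := by
    obtain ⟨w⟩ := N.isTree.1.preconnected u v
    cases w with
    | nil => exact absurd rfl h
    | cons hadj _ => exact ⟨⟨s(u, _), hadj⟩⟩
  obtain ⟨e, he⟩ := Finite.exists_min N.length
  refine (N.length_pos e).trans_le (le_ciInf fun w => ?_)
  cases w with
  | nil => exact absurd rfl h
  | cons hadj w =>
    have := walkLength_nonneg w
    simp only [walkLength, SimpleGraph.Walk.darts_cons, List.map_cons, List.sum_cons] at this ⊢
    exact (he _).trans (le_add_of_nonneg_right this)

/-- At most one pipe at the vertex leads to a given other vertex. -/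
theorem eq_of_beyond_opp {z z' : N.End} {r : V} (hv : N.vertex z = N.vertex z')
    (h : N.Beyond (N.opp z) r) (h' : N.Beyond (N.opp z') r) : z = z' := by
  by_contra hne
  have he : z.1 ≠ z'.1 := by
    intro he
    rcases eq_or_eq_opp he with rfl | rfl
    · exact hne rfl
    · exact vertex_opp_ne z' hv
  have h1 : N.nodeDist (N.vertex z) r = N.length z.1 + N.nodeDist (N.vertex (N.opp z)) r :=
    nodeDist_eq_of_not_beyond ((beyond_opp_iff z r).1 h)
  have h2 : ¬ N.Beyond (N.opp z') (N.vertex z) := by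
    have := not_beyond_opp (N.opp z')
    rwa [opp_opp, ← hv] at this
  have h3 : ¬ N.Beyond (N.opp z') (N.vertex (N.opp z)) := by
    rwa [← beyond_iff_of_ne (z := N.opp z') he]
  have h4 := nodeDist_eq_of_beyond h' h2
  have h5 := nodeDist_eq_of_beyond h' h3
  rw [opp_opp, ← hv] at h4 h5
  rw [nodeDist_self, nodeDist_comm] at h4
  rw [nodeDist_comm] at h5
  have := nodeDist_nonneg (N := N) (N.vertex z) (N.vertex (N.opp z))
  have := N.length_pos z.1
  linarith

/-! #### The part of the network that is cut off by a point -/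

namespace Outlet

open Classical in
/-- The end of the pipe of `p` on the side that is cut off from the outlet. -/
def innerEnd (O : N.Outlet) (p : N.InnerPoint) : N.End :=
  if O.IsCutOff p (N.node p.pipe false) then (p.pipe, false) else (p.pipe, true)

variable (p : N.InnerPoint)

theorem innerEnd_fst : (O.innerEnd p).1 = p.pipe := by
  unfold innerEnd
  split_ifs <;> rfl

theorem isCutOff_iff (v : V) : O.IsCutOff p v ↔ N.Beyond (O.innerEnd p) v := by
  have key : ∀ z : N.End, z.1 = p.pipe → ¬ N.Beyond z O.vertex →
      (O.IsCutOff p v ↔ N.Beyond z v) := by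
    rintro z hz h
    rw [Beyond, not_not, hz] at h
    rw [Beyond, hz]
    exact not_congr ⟨fun h1 => h.trans h1, fun h1 => h.symm.trans h1⟩
  unfold innerEnd
  split_ifs with hc
  · refine key _ rfl ?_
    rw [← beyond_opp_iff]
    exact fun h => hc h.symm
  · refine key _ rfl fun h => h ?_
    exact (not_not.1 hc).symm

theorem not_beyond_innerEnd : ¬ N.Beyond (O.innerEnd p) O.vertex := by
  rw [← isCutOff_iff]
  exact fun h => h (SimpleGraph.Reachable.refl _)

/-- The distance of `p` from the end of its pipe that is cut off. -/
def depth (O : N.Outlet) (p : N.InnerPoint) : ℝ := |p.x - N.coord (O.innerEnd p)|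

theorem fromEnd_depth : N.fromEnd (O.innerEnd p) (O.depth p) = p.x := by
  have h1 := p.mem.1
  have h2 := p.mem.2
  unfold depth innerEnd fromEnd coord
  split_ifs <;> simp_all
  · exact h1.le
  · rw [abs_of_neg (by linarith)]
    ring

theorem depth_pos : 0 < O.depth p := by
  have h1 := p.mem.1
  have h2 := p.mem.2
  unfold depth innerEnd coord
  split_ifs <;> simp_all
  · exact h1.ne'
  · linarith

theorem depth_lt : O.depth p < N.length p.pipe := by
  have h1 := p.mem.1
  have h2 := p.mem.2
  unfold depth innerEnd coord
  split_ifs <;> simp_all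
  · rwa [abs_of_pos h1]
  · rw [abs_of_neg (by linarith)]
    linarith

/-- Of the two routes to `p`, the one through the far end of the pipe first traverses the whole
pipe, so the minimum is attained through the inner end. -/
theorem TT_of_isCutOff {v : V} (hv : O.IsCutOff p v) :
    N.TT v p.pipe p.x = (N.nodeDist v (N.vertex (O.innerEnd p)) + O.depth p) / N.speed := by
  have hd := O.depth_lt p
  have hd0 := O.depth_pos p
  have h1 := nodeDist_eq_of_beyond ((isCutOff_iff p v).1 hv) (not_beyond_opp (O.innerEnd p))
  rw [nodeDist_self, add_zero, innerEnd_fst] at h1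
  have h2 := O.fromEnd_depth p
  unfold TT
  congr 1
  generalize hz : O.innerEnd p = z at h1 h2
  have hz1 : z.1 = p.pipe := by rw [← hz, innerEnd_fst]
  obtain ⟨e, b⟩ := z
  obtain rfl : e = p.pipe := hz1
  cases b
  · simp only [fromEnd, Bool.false_eq_true, if_false] at h2
    simp only [opp, PipeNetwork.vertex, Bool.not_false] at h1
    simp only [PipeNetwork.vertex]
    rw [h1, h2, min_eq_left]
    linarith
  · simp only [fromEnd, if_true] at h2
    simp only [opp, PipeNetwork.vertex, Bool.not_true] at h1
    simp only [PipeNetwork.vertex]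
    rw [h1, ← h2, min_eq_right]
    · ring
    · linarith

end Outlet

end PipeNetwork

theorem TimeTest.exists_tsupport_subset_ball {φ : TimeTest} {τ r : ℝ}
    (h : tsupport φ ⊆ Ioo (τ - r) (τ + r)) : ∃ b < r, ∀ s ∈ tsupport φ, |s - τ| ≤ b := by
  by_cases hne : (tsupport φ).Nonempty
  · obtain ⟨s₀, hs₀, hmax⟩ := IsCompact.exists_isMaxOn φ.hasCompactSupport hne
      (f := fun s => |s - τ|) (by fun_prop)
    refine ⟨|s₀ - τ|, ?_, fun s hs => hmax hs⟩
    have := h hs₀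
    rw [abs_lt]
    exact ⟨by linarith [this.1], by linarith [this.2]⟩
  · rw [not_nonempty_iff_eq_empty] at hne
    exact ⟨r - 1, by linarith, by simp [hne]⟩

theorem TimeTest.tsupport_shift_subset_ball {φ : TimeTest} {τ b r t : ℝ}
    (h : ∀ s ∈ tsupport φ, |s - τ| ≤ b) (ht : b + |t| < r) :
    tsupport (φ.shift t) ⊆ Ioo (τ - r) (τ + r) := by
  rw [tsupport_shift]
  intro s hs
  have h1 := abs_le.1 (h _ hs)
  have h2 := neg_abs_le t
  have h3 := le_abs_self t
  exact ⟨by linarith [h1.1], by linarith [h1.2]⟩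

namespace PipeNetwork

open TimeTest Distribution

variable {V : Type*} {N : PipeNetwork V} {O : N.Outlet}

theorem fromEnd_fromEnd (z : N.End) (x : ℝ) : N.fromEnd z (N.fromEnd z x) = x := by
  unfold fromEnd
  split_ifs
  · ring
  · rfl

/-! #### Continuation of waves in space -/

/-- Families of functionals of time on the network whose smoothings are waves. -/
def IsNetFamily (N : PipeNetwork V) [Finite V] (T S : N.Pipe → ℝ → TimeTest → ℝ) : Prop :=
  ∀ φ : TimeTest, ∃ H' Q', N.IsNetWave (fun e t x => T e (N.clamp e x) (φ.shift t))
    (fun e t x => S e (N.clamp e x) (φ.shift t)) H' Q'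

namespace IsNetFamily

variable [Finite V] {T S : N.Pipe → ℝ → TimeTest → ℝ} {τ : ℝ}

theorem scalar (w : N.IsNetFamily T S) {z z' : N.End} (h : N.vertex z = N.vertex z') :
    T z.1 (N.coord z) = T z'.1 (N.coord z') := by
  funext φ
  obtain ⟨H', Q', hw⟩ := w φ
  have := hw.scalar z z' h 0
  simpa only [N.clamp_of_mem (N.coord_mem _), shift_zero] using this

/-- If the support of `φ` has distance at most `b` from `τ`, the smoothings of the data vanish for
`|t| < r - b`. Sideways uniqueness in that cone is then read off at `t = 0`. -/
theorem vanish_fromEnd (w : N.IsNetFamily T S) {z : N.End} {r : ℝ}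
    (hT : IsVanishingOn (T z.1 (N.coord z)) (Ioo (τ - r) (τ + r)))
    (hS : IsVanishingOn (S z.1 (N.coord z)) (Ioo (τ - r) (τ + r))) {y : ℝ}
    (hy : y ∈ Icc 0 (N.length z.1)) :
    IsVanishingOn (T z.1 (N.fromEnd z y)) (Ioo (τ - (r - y / N.speed)) (τ + (r - y / N.speed))) ∧
    IsVanishingOn (S z.1 (N.fromEnd z y)) (Ioo (τ - (r - y / N.speed)) (τ + (r - y / N.speed))) := by
  rw [IsVanishingOn, IsVanishingOn, ← forall_and]
  intro (φ : TimeTest)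
  rw [← imp_and]
  intro hφ
  obtain ⟨b, hb, hφb⟩ := exists_tsupport_subset_ball hφ
  obtain ⟨H', Q', hw⟩ := w φ
  have key := (hw.fromEnd z).sideways (isProfile_fromEnd z) N.speed_pos (τ := 0) (r := r - b)
    (fun t ht => by
      rw [sub_zero] at ht
      have hs : tsupport (φ.shift t) ⊆ Ioo (τ - r) (τ + r) :=
        tsupport_shift_subset_ball hφb (by linarith)
      simp only [fromEnd_zero, N.clamp_of_mem (N.coord_mem z)]
      rw [hT _ hs, hS _ hs, mul_zero]
      exact ⟨rfl, rfl⟩) hy (t₀ := 0) (by rw [sub_zero, abs_zero]; linarith)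
  simp only [N.clamp_of_mem (fromEnd_mem hy), shift_zero] at key
  exact ⟨key.1, (mul_eq_zero.1 key.2).resolve_left (N.normal_ne_zero z)⟩

/-- Zero pressure and flow spread from the ports towards `p`, by induction on vertices in order of
decreasing distance from the inner end. At a junction every pipe but one leads away and brings both
data from a farther vertex; the remaining pipe gets the pressure by continuity and the flow by mass
conservation. Along a pipe the time window shrinks by its travel time, exactly as the travel time to
`p` does. -/
theorem vanish_cutOff (w : N.IsNetFamily T S) (p : N.InnerPoint)
    (hport : ∀ j : O.Port, O.IsCutOff p j →
      IsVanishingOn (T j.pos.1 (N.coord j.pos)) (Ioo (τ - O.actionTime p j) (τ + O.actionTime p j)) ∧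
      IsVanishingOn (S j.pos.1 (N.coord j.pos)) (Ioo (τ - O.actionTime p j) (τ + O.actionTime p j)))
    {z : N.End} (hz : O.IsCutOff p (N.vertex z)) :
    IsVanishingOn (T z.1 (N.coord z)) (Ioo (τ - N.TT (N.vertex z) p.pipe p.x)
      (τ + N.TT (N.vertex z) p.pipe p.x)) ∧
    IsVanishingOn (S z.1 (N.coord z)) (Ioo (τ - N.TT (N.vertex z) p.pipe p.x)
      (τ + N.TT (N.vertex z) p.pipe p.x)) := by
  classical
  set root := N.vertex (O.innerEnd p) with hroot
  have ha := N.speed_pos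
  generalize hv : N.vertex z = v at hz ⊢
  revert z
  -- Farther vertices come first; the relation is well founded because there are finitely many
  -- vertices.
  have wf : WellFounded (InvImage (· > ·) fun v => N.nodeDist v root) :=
    have : IsTrans V (InvImage (· > ·) fun v => N.nodeDist v root) :=
      ⟨fun a b c h1 h2 => gt_trans (α := ℝ) h1 h2⟩
    have : Std.Irrefl (InvImage (· > ·) fun v => N.nodeDist v root) :=
      ⟨fun a h => lt_irrefl (N.nodeDist a root) h⟩
    Finite.wellFounded_of_trans_of_irrefl _
  induction v using wf.induction with
  | _ v ih =>
  intro z hzv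
  set R := N.TT v p.pipe p.x with hR
  by_cases hb : N.IsBoundary v
  · have hne : v ≠ O.vertex := by
      rintro rfl
      exact O.not_beyond_innerEnd p ((O.isCutOff_iff p _).1 hz)
    let j : O.Port := ⟨v, hb, hne⟩
    have hj := hport j hz
    have hf : O.actionTime p j = R := by
      unfold Outlet.actionTime
      rw [if_pos hz]
    rw [hf] at hj
    rwa [j.eq_pos hzv]
  · let X : N.End → Prop := fun z' => z' = O.innerEnd p ∨ N.Beyond (N.opp z') root
    have away : ∀ z' : N.End, N.vertex z' = v → ¬ X z' →
        IsVanishingOn (T z'.1 (N.coord z')) (Ioo (τ - R) (τ + R)) ∧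
        IsVanishingOn (S z'.1 (N.coord z')) (Ioo (τ - R) (τ + R)) := by
      intro z' hz' hX
      rw [not_or] at hX
      have hcut : N.Beyond (O.innerEnd p) (N.vertex z') := by
        rw [hz', ← O.isCutOff_iff]
        exact hz
      have hne : z'.1 ≠ (O.innerEnd p).1 := by
        intro he
        rcases eq_or_eq_opp he with h | h
        · exact hX.1 h
        · rw [h] at hcut
          exact not_beyond_opp _ hcut
      have hcut' : O.IsCutOff p (N.vertex (N.opp z')) :=
        (O.isCutOff_iff p _).2 ((beyond_iff_of_ne hne).1 hcut)
      have hd := nodeDist_eq_of_not_beyond hX.2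
      rw [opp_opp, hz'] at hd
      have hℓ := N.length_pos z'.1
      have hlen : N.length (N.opp z').1 = N.length z'.1 := rfl
      have hi := ih (N.vertex (N.opp z')) (by
        change N.nodeDist v root < N.nodeDist (N.vertex (N.opp z')) root
        linarith) hcut' rfl
      have key := w.vanish_fromEnd hi.1 hi.2 (y := N.length z'.1) ⟨hℓ.le, le_rfl⟩
      have e1 : N.fromEnd (N.opp z') (N.length z'.1) = N.coord z' := by
        obtain ⟨e, b⟩ := z'
        cases b <;> simp [PipeNetwork.fromEnd, coord, opp]
      have e2 : N.TT (N.vertex (N.opp z')) p.pipe p.x - N.length z'.1 / N.speed = R := by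
        rw [hR, O.TT_of_isCutOff p hcut', O.TT_of_isCutOff p hz, hd, hlen, ← hroot]
        ring
      rw [e1, e2] at key
      exact key
    have uniq : ∀ z₁ z₂ : N.End, N.vertex z₁ = v → N.vertex z₂ = v → X z₁ → X z₂ → z₁ = z₂ := by
      have aux : ∀ z' : N.End, N.vertex z' = root → ¬ N.Beyond (N.opp z') root := by
        intro z' h
        have := not_beyond_opp (N.opp z')
        rwa [opp_opp, h] at this
      intro z₁ z₂ h₁ h₂ hX₁ hX₂
      by_cases hvr : v = root
      · have f₁ := hX₁.resolve_right (aux z₁ (h₁.trans hvr))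
        have f₂ := hX₂.resolve_right (aux z₂ (h₂.trans hvr))
        rw [f₁, f₂]
      · have g₁ : z₁ ≠ O.innerEnd p := fun h => hvr (by rw [← h₁, h])
        have g₂ : z₂ ≠ O.innerEnd p := fun h => hvr (by rw [← h₂, h])
        exact eq_of_beyond_opp (h₁.trans h₂.symm) (hX₁.resolve_left g₁) (hX₂.resolve_left g₂)
    -- A vertex with only one pipe end would be a boundary point.
    have hother : ∃ z' : N.End, N.vertex z' = v ∧ ¬ X z' := by
      by_contra hcon
      push Not at hcon
      exact hb ⟨z, hzv, fun z' hz' => uniq z' z hz' hzv (hcon z' hz') (hcon z hzv)⟩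
    obtain ⟨z', hz', hX'⟩ := hother
    have hT : IsVanishingOn (T z.1 (N.coord z)) (Ioo (τ - R) (τ + R)) := by
      rw [w.scalar (hzv.trans hz'.symm)]
      exact (away z' hz' hX').1
    refine ⟨hT, ?_⟩
    by_cases hX : X z
    · intro (φ : TimeTest) hφ
      obtain ⟨H', Q', hw⟩ := w φ
      have hk := hw.kirchhoff v hb 0
      simp only [N.clamp_of_mem (N.coord_mem _), shift_zero] at hk
      rw [Finset.sum_eq_single z] at hk
      · exact (mul_eq_zero.1 hk).resolve_left (N.normal_ne_zero z)
      · intro z'' hz'' hne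
        rw [Finset.mem_filter] at hz''
        rw [(away z'' hz''.2 fun h => hne (uniq _ _ hz''.2 hzv h hX)).2 φ hφ, mul_zero]
      · intro h
        exact (h (by simp [hzv])).elim
    · exact (away z hzv hX).2

/-- One last continuation from a vertex into the pipe leaves a cone of positive width, because the
points of `D_p` lie strictly before `p`. -/
theorem vanish_admissible (w : N.IsNetFamily T S) (p : N.InnerPoint)
    (hport : ∀ j : O.Port, O.IsCutOff p j →
      IsVanishingOn (T j.pos.1 (N.coord j.pos)) (Ioo (τ - O.actionTime p j) (τ + O.actionTime p j)) ∧
      IsVanishingOn (S j.pos.1 (N.coord j.pos)) (Ioo (τ - O.actionTime p j) (τ + O.actionTime p j)))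
    {e : N.Pipe} {x : ℝ} (hx : (e, x) ∈ O.admissibleSet p) :
    ∃ r > 0, IsVanishingOn (T e x) (Ioo (τ - r) (τ + r)) := by
  have ha := N.speed_pos
  set root := N.vertex (O.innerEnd p) with hroot
  have main : ∀ z : N.End, z.1 = e → O.IsCutOff p (N.vertex z) →
      N.fromEnd z x < N.nodeDist (N.vertex z) root + O.depth p →
      ∃ r > 0, IsVanishingOn (T e x) (Ioo (τ - r) (τ + r)) := by
    rintro z rfl hz hlt
    have h1 := w.vanish_cutOff p hport hz
    have h2 := (w.vanish_fromEnd h1.1 h1.2 (y := N.fromEnd z x) (fromEnd_mem hx.1)).1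
    rw [fromEnd_fromEnd, O.TT_of_isCutOff p hz, ← sub_div] at h2
    exact ⟨_, div_pos (by linarith) ha, h2⟩
  obtain ⟨hmem, hx⟩ := hx
  simp only at hmem hx
  by_cases he : e = p.pipe
  · rw [if_pos he] at hx
    refine main (O.innerEnd p) (by rw [O.innerEnd_fst, he])
      ((O.isCutOff_iff p _).2 (beyond_self _)) ?_
    rw [nodeDist_self, zero_add]
    have h1 := O.fromEnd_depth p
    unfold Outlet.innerEnd at h1 ⊢
    subst he
    split_ifs at hx h1 ⊢
    · simp only [PipeNetwork.fromEnd] at h1 ⊢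
      simp at h1 ⊢
      linarith
    · simp only [PipeNetwork.fromEnd] at h1 ⊢
      simp at h1 ⊢
      linarith
  · rw [if_neg he] at hx
    have hcut : ∀ b, O.IsCutOff p (N.vertex (e, b)) := by
      have h1 : O.IsCutOff p (N.vertex (e, false)) := hx
      have h2 : O.IsCutOff p (N.vertex (e, true)) := by
        rw [O.isCutOff_iff] at h1 ⊢
        exact (beyond_iff_of_ne (z' := (e, false)) (by rwa [O.innerEnd_fst])).1 h1
      intro b
      cases b
      · exact h1
      · exact h2
    -- The end of the pipe that is farther from the root; the whole pipe is then on the way from it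
    -- to `p`.
    have hfar : ∃ b, ¬ N.Beyond (e, b) root := by
      rcases not_beyond_or_not_beyond (N := N) (e, false) root with h | h
      · exact ⟨_, h⟩
      · exact ⟨true, h⟩
    obtain ⟨b, hb⟩ := hfar
    refine main (e, b) rfl (hcut b) ?_
    rw [nodeDist_eq_of_not_beyond hb]
    have h1 := (fromEnd_mem (z := (e, b)) hmem).2
    have h2 := nodeDist_nonneg (N := N) (N.vertex (N.opp (e, b))) root
    have h3 := O.depth_pos p
    simp only at h1 ⊢
    linarith

end IsNetFamily

end PipeNetwork

/-! ### Superposition of waves -/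

theorem TimeDist.ofFun_apply {u : ℝ → ℝ} (hu : LocallyIntegrable u) (φ : TimeTest) :
    TimeDist.ofFun u φ = ∫ t, u t * φ t := by
  have h := TestFunction.integralAgainstBilinCLM_eq_integral (n := ⊤) (Ω := (⊤ : Opens ℝ))
    (B := ContinuousLinearMap.mul ℝ ℝ) (μ := volume)
    (hu.locallyIntegrableOn ((⊤ : Opens ℝ) : Set ℝ)) (f := φ)
  refine h.trans (integral_congr_ae (ae_of_all _ fun t => ?_))
  simp [mul_comm]

/-- A locally integrable function whose distribution vanishes on an open set is zero there. -/
theorem TimeDist.ae_eq_zero_of_integral_mul {u : ℝ → ℝ} {U : Set ℝ} (hU : IsOpen U)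
    (hu : LocallyIntegrableOn u U)
    (h : ∀ φ : TimeTest, tsupport φ ⊆ U → ∫ t, u t * φ t = 0) : ∀ᵐ t, t ∈ U → u t = 0 :=
  hU.ae_eq_zero_of_integral_contDiff_smul_eq_zero hu fun g g1 g2 g3 => by
    refine Eq.trans (integral_congr_ae (ae_of_all _ fun t => ?_))
      (h ⟨g, g1, g2, fun _ _ => trivial⟩ g3)
    exact mul_comm _ _

/-! ### Calculus of `smear`, `shift` and `reflect`. -/

namespace TimeTest

variable {u v : ℝ → ℝ}

theorem integrable_mul_comp_add (hu : Integrable u) (φ : TimeTest) (r : ℝ) :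
    Integrable fun s => u s * φ (s + r) := by
  have := integrable_mul hu (shift (-r) φ)
  simpa using this

theorem smear_shift (hu : LocallyIntegrable u) (hc : HasCompactSupport u) (t : ℝ) (φ : TimeTest) :
    smear u (shift t φ) = shift t (smear u φ) := by
  ext r
  rw [smear_apply hu hc, shift_apply, smear_apply hu hc]
  simp only [shift_apply, add_sub_assoc]

theorem smear_add (hu : LocallyIntegrable u) (hc : HasCompactSupport u) (hv : LocallyIntegrable v)
    (hd : HasCompactSupport v) (φ : TimeTest) :
    smear (fun s => u s + v s) φ = smear u φ + smear v φ := by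
  ext r
  change _ = smear u φ r + smear v φ r
  rw [smear_apply (u := fun s => u s + v s) (hu.add hv) (hc.add hd), smear_apply hu hc, smear_apply hv hd,
    ← integral_add (integrable_mul_comp_add (integrable_of_hasCompactSupport hu hc) φ r)
      (integrable_mul_comp_add (integrable_of_hasCompactSupport hv hd) φ r)]
  simp only [add_mul]

theorem smear_const_mul (hu : LocallyIntegrable u) (hc : HasCompactSupport u) (c : ℝ)
    (φ : TimeTest) : smear (fun s => c * u s) φ = c • smear u φ := by
  ext r
  change _ = c * smear u φ r
  rw [smear_apply (u := fun s => c * u s) (hu.smul c) hc.mul_left, smear_apply hu hc, ← integral_const_mul]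
  simp only [mul_assoc]

theorem smear_zero_time (hu : LocallyIntegrable u) (hc : HasCompactSupport u) (φ : TimeTest) :
    smear u φ 0 = ∫ s, u s * φ s := by
  rw [smear_apply hu hc]
  simp

theorem smear_reflect (hu : LocallyIntegrable u) (hc : HasCompactSupport u) (c : ℝ)
    (φ : TimeTest) : smear (fun s => u (c - s)) φ = reflect 0 (smear u (reflect c φ)) := by
  have hu' : Integrable u := integrable_of_hasCompactSupport hu hc
  ext r
  rw [smear_apply (hu'.comp_sub_left c).locallyIntegrable
    (hc.comp_homeomorph (Homeomorph.subLeft c)), reflect_apply, smear_apply hu hc,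
    ← integral_sub_left_eq_self _ volume c]
  refine integral_congr_ae (ae_of_all _ fun s => ?_)
  simp only [reflect_apply]
  congr 2 <;> ring

/-- A nonzero product `u s * φ (s + r)` needs, for almost every `s`, both `s ≥ c` and `s + r ≤ b`.
-/
theorem tsupport_smear_subset (hu : LocallyIntegrable u) (hc : HasCompactSupport u) {c b : ℝ}
    (h0 : ∀ᵐ s, s < c → u s = 0) {φ : TimeTest} (hφ : tsupport φ ⊆ Iic b) :
    tsupport (smear u φ) ⊆ Iic (b - c) := by
  refine closure_minimal (fun r hr => ?_) isClosed_Iic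
  by_contra hlt
  rw [mem_Iic, not_le] at hlt
  refine hr ?_
  rw [smear_apply hu hc]
  refine integral_eq_zero_of_ae ?_
  filter_upwards [h0] with s hs
  by_cases hsc : s < c
  · rw [hs hsc, zero_mul, Pi.zero_apply]
  · rw [image_eq_zero_of_notMem_tsupport (f := φ), mul_zero, Pi.zero_apply]
    intro hmem
    have : s + r ≤ b := hφ hmem
    linarith

theorem reflect_shift (c t : ℝ) (φ : TimeTest) :
    reflect c (shift t φ) = shift (c - t) (reflect 0 φ) := by
  ext s
  simp only [reflect_apply, shift_apply]
  congr 1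
  ring

theorem reflect_reflect (c : ℝ) (φ : TimeTest) : reflect c (reflect c φ) = φ := by
  ext s
  simp

theorem integral_reflect (c : ℝ) (φ : TimeTest) : ∫ s, reflect c φ s = ∫ s, φ s := by
  simp only [reflect_apply]
  exact integral_sub_left_eq_self (fun s => φ s) volume c

theorem integral_shift (t : ℝ) (φ : TimeTest) : ∫ s, shift t φ s = ∫ s, φ s := by
  simp only [shift_apply]
  exact integral_sub_right_eq_self (fun s => φ s) t

end TimeTest

/-! ### Linear combinations, time reversal and constant waves. -/

namespace IsPipeWave

variable {a ℓ : ℝ} {Z : ℝ → ℝ} {H Q H' Q' : ℝ → ℝ → ℝ}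

theorem intervalIntegrable_eq_H (hZ : IsProfile Z) (w : IsPipeWave a ℓ Z H Q H' Q') (t x : ℝ) :
    IntervalIntegrable (fun y => -(a⁻¹ * ((Z y)⁻¹ * Q' t y))) volume 0 x := by
  have := hZ.intervalIntegrable_combination (A := fun _ => 0) (B := fun y => -(a⁻¹ * Q' t y))
    (C := fun _ => 0) continuous_const
    ((continuous_const.mul (w.continuous_Q'.comp (Continuous.prodMk_right t))).neg)
    continuous_const 0 x
  refine this.congr fun y _ => ?_
  ring

theorem intervalIntegrable_eq_Q (hZ : IsProfile Z) (w : IsPipeWave a ℓ Z H Q H' Q') (t x : ℝ) :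
    IntervalIntegrable (fun y => -(a⁻¹ * (Z y * H' t y))) volume 0 x := by
  have := hZ.intervalIntegrable_combination (A := fun y => -(a⁻¹ * H' t y)) (B := fun _ => 0)
    (C := fun _ => 0)
    ((continuous_const.mul (w.continuous_H'.comp (Continuous.prodMk_right t))).neg)
    continuous_const continuous_const 0 x
  refine this.congr fun y _ => ?_
  ring

theorem combine {h q h' q' : ℝ → ℝ → ℝ} (hZ : IsProfile Z) (w₁ : IsPipeWave a ℓ Z H Q H' Q')
    (w₂ : IsPipeWave a ℓ Z h q h' q') (c d : ℝ) :
    IsPipeWave a ℓ Z (fun t x => c * H t x + d * h t x) (fun t x => c * Q t x + d * q t x)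
      (fun t x => c * H' t x + d * h' t x) (fun t x => c * Q' t x + d * q' t x) where
  continuous_H := (continuous_const.mul w₁.continuous_H).add (continuous_const.mul w₂.continuous_H)
  continuous_Q := (continuous_const.mul w₁.continuous_Q).add (continuous_const.mul w₂.continuous_Q)
  continuous_H' :=
    (continuous_const.mul w₁.continuous_H').add (continuous_const.mul w₂.continuous_H')
  continuous_Q' :=
    (continuous_const.mul w₁.continuous_Q').add (continuous_const.mul w₂.continuous_Q')
  deriv_H t x := ((w₁.deriv_H t x).const_mul c).add ((w₂.deriv_H t x).const_mul d)
  deriv_Q t x := ((w₁.deriv_Q t x).const_mul c).add ((w₂.deriv_Q t x).const_mul d)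
  eq_H t x hx := by
    have e : ∀ y, -(a⁻¹ * ((Z y)⁻¹ * (c * Q' t y + d * q' t y))) =
        c * -(a⁻¹ * ((Z y)⁻¹ * Q' t y)) + d * -(a⁻¹ * ((Z y)⁻¹ * q' t y)) := fun y => by ring
    simp only [e]
    rw [intervalIntegral.integral_add ((w₁.intervalIntegrable_eq_H hZ t x).const_mul c)
      ((w₂.intervalIntegrable_eq_H hZ t x).const_mul d), intervalIntegral.integral_const_mul,
      intervalIntegral.integral_const_mul, ← w₁.eq_H t x hx, ← w₂.eq_H t x hx]
    ring
  eq_Q t x hx := by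
    have e : ∀ y, -(a⁻¹ * (Z y * (c * H' t y + d * h' t y))) =
        c * -(a⁻¹ * (Z y * H' t y)) + d * -(a⁻¹ * (Z y * h' t y)) := fun y => by ring
    simp only [e]
    rw [intervalIntegral.integral_add ((w₁.intervalIntegrable_eq_Q hZ t x).const_mul c)
      ((w₂.intervalIntegrable_eq_Q hZ t x).const_mul d), intervalIntegral.integral_const_mul,
      intervalIntegral.integral_const_mul, ← w₁.eq_Q t x hx, ← w₂.eq_Q t x hx]
    ring

theorem timeReverse (w : IsPipeWave a ℓ Z H Q H' Q') (c : ℝ) :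
    IsPipeWave a ℓ Z (fun t x => H (c - t) x) (fun t x => -Q (c - t) x)
      (fun t x => -H' (c - t) x) (fun t x => Q' (c - t) x) := by
  have hm : Continuous fun p : ℝ × ℝ => ((c - p.1, p.2) : ℝ × ℝ) := by fun_prop
  exact
    { continuous_H := w.continuous_H.comp hm
      continuous_Q := (w.continuous_Q.comp hm).neg
      continuous_H' := (w.continuous_H'.comp hm).neg
      continuous_Q' := w.continuous_Q'.comp hm
      deriv_H := fun t x => (w.deriv_H (c - t) x).comp_const_sub c t
      deriv_Q := fun t x => by
        exact ((w.deriv_Q (c - t) x).comp_const_sub c t).fun_neg.congr_deriv (neg_neg _)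
      eq_H := fun t x hx => w.eq_H (c - t) x hx
      eq_Q := fun t x hx => by
        have := w.eq_Q (c - t) x hx
        simp only [mul_neg, neg_neg]
        rw [intervalIntegral.integral_neg] at this
        linarith }

theorem const (a ℓ : ℝ) (Z : ℝ → ℝ) (k : ℝ) :
    IsPipeWave a ℓ Z (fun _ _ => k) (fun _ _ => 0) (fun _ _ => 0) (fun _ _ => 0) where
  continuous_H := continuous_const
  continuous_Q := continuous_const
  continuous_H' := continuous_const
  continuous_Q' := continuous_const
  deriv_H t x := hasDerivAt_const t k
  deriv_Q t x := hasDerivAt_const t 0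
  eq_H t x hx := by simp
  eq_Q t x hx := by simp

end IsPipeWave

/-! ### Operations on families of waves. -/

namespace PipeNetwork

open TimeTest Distribution

variable {V : Type*} {N : PipeNetwork V} {O : N.Outlet} [Finite V]

namespace IsNetFamily

variable {T S T' S' : N.Pipe → ℝ → TimeTest → ℝ}

theorem of_isWave {H Q : N.Pipe → ℝ → TimeDist} {F : O.Port → TimeDist} (w : O.IsWave H Q F) :
    N.IsNetFamily (fun e x φ => H e x φ) (fun e x φ => Q e x φ) := fun φ =>
  ⟨_, _, w.isNetWave φ⟩

theorem combine (w : N.IsNetFamily T S) (w' : N.IsNetFamily T' S') (c d : ℝ) :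
    N.IsNetFamily (fun e x φ => c * T e x φ + d * T' e x φ)
      (fun e x φ => c * S e x φ + d * S' e x φ) := by
  classical
  intro φ
  obtain ⟨H', Q', h⟩ := w φ
  obtain ⟨H'', Q'', h'⟩ := w' φ
  refine ⟨_, _, fun e => (h.pipe e).combine (N.isProfile_impedance e) (h'.pipe e) c d, ?_, ?_⟩
  · intro z z' hz t
    have h1 := h.scalar z z' hz t
    have h2 := h'.scalar z z' hz t
    simp only at h1 h2 ⊢
    rw [h1, h2]
  · intro v hv t
    have h1 := h.kirchhoff v hv t
    have h2 := h'.kirchhoff v hv t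
    simp only [mul_add, mul_left_comm _ c, mul_left_comm _ d, Finset.sum_add_distrib,
      ← Finset.mul_sum]
    rw [h1, h2]
    simp

theorem smear (w : N.IsNetFamily T S) {u : ℝ → ℝ} (hu : LocallyIntegrable u)
    (hc : HasCompactSupport u) :
    N.IsNetFamily (fun e x φ => T e x (smear u φ)) (fun e x φ => S e x (smear u φ)) := by
  intro φ
  obtain ⟨H', Q', h⟩ := w (TimeTest.smear u φ)
  refine ⟨H', Q', ?_⟩
  simpa only [smear_shift hu hc] using h

/-- Reflecting the translate by `t` gives the translate of the reflected test function by `c - t`.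
The wave equations are invariant under time reversal if the flow changes sign. -/
theorem reflect (w : N.IsNetFamily T S) (c : ℝ) :
    N.IsNetFamily (fun e x φ => T e x (reflect c φ)) (fun e x φ => -S e x (reflect c φ)) := by
  classical
  intro φ
  obtain ⟨H', Q', h⟩ := w (TimeTest.reflect 0 φ)
  simp only [reflect_shift]
  refine ⟨_, _, fun e => (h.pipe e).timeReverse c, ?_, ?_⟩
  · intro z z' hz t
    exact h.scalar z z' hz (c - t)
  · intro v hv t
    have := h.kirchhoff v hv (c - t)
    simp only [mul_neg, Finset.sum_neg_distrib]
    rw [this, neg_zero]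

theorem const (k : ℝ) : N.IsNetFamily (fun _ _ φ => k * ∫ s, φ s) (fun _ _ _ => 0) := by
  intro φ
  simp only [integral_shift]
  exact ⟨_, _, fun e => IsPipeWave.const _ _ _ _, fun _ _ _ _ => rfl, fun _ _ _ => by simp⟩

theorem zero : N.IsNetFamily (fun _ _ _ => 0) (fun _ _ _ => 0) := by
  simpa using const (N := N) 0

theorem sum {ι : Type*} (s : Finset ι) {T S : ι → N.Pipe → ℝ → TimeTest → ℝ}
    (w : ∀ i, N.IsNetFamily (T i) (S i)) (c : ℝ) :
    N.IsNetFamily (fun e x φ => ∑ i ∈ s, c * T i e x φ) (fun e x φ => ∑ i ∈ s, c * S i e x φ) := by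
  classical
  induction s using Finset.induction_on with
  | empty => simpa using zero (N := N)
  | insert i s hi ih =>
    simp only [Finset.sum_insert hi]
    have := (w i).combine ih c 1
    simpa only [one_mul] using this

/-- A wave without energy flux through the boundary before the time `c` vanishes before `c`. -/
theorem vanish_before (w : N.IsNetFamily T S) {c : ℝ}
    (h0 : ∀ e, ∀ x ∈ Icc 0 (N.length e), IsVanishingOn (T e x) (Iio 0) ∧ IsVanishingOn (S e x) (Iio 0))
    (hb : ∀ z : N.End, N.IsBoundary (N.vertex z) → IsVanishingOn (S z.1 (N.coord z)) (Iio c))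
    {e : N.Pipe} {x : ℝ} (hx : x ∈ Icc 0 (N.length e)) :
    IsVanishingOn (T e x) (Iio c) ∧ IsVanishingOn (S e x) (Iio c) := by
  rw [IsVanishingOn, IsVanishingOn, ← forall_and]
  intro (φ : TimeTest)
  rw [← imp_and]
  intro hφ
  obtain ⟨b, hb', hφb⟩ := exists_tsupport_subset_Iic hφ
  obtain ⟨H', Q', hw⟩ := w φ
  have key := hw.vanish_of_lt (θ := fun _ => c - b) (lam := 0) one_pos (by simp) (T₀ := -b)
    (fun e t ht x hx => by
      have hs : tsupport (φ.shift t) ⊆ Iio 0 :=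
        (tsupport_shift_subset hφb t).trans (Iic_subset_Iio.2 (by linarith))
      simp only [N.clamp_of_mem hx]
      exact ⟨(h0 e x hx).1 _ hs, (h0 e x hx).2 _ hs⟩)
    (fun z hz t ht => by
      have hs : tsupport (φ.shift t) ⊆ Iio c :=
        (tsupport_shift_subset hφb t).trans (Iic_subset_Iio.2 (by linarith))
      simp only [N.clamp_of_mem (N.coord_mem z)]
      rw [hb z hz _ hs, mul_zero]) hx (t := 0) (by rw [interp_const]; linarith)
  simpa only [N.clamp_of_mem hx, shift_zero] using key

end IsNetFamily

end PipeNetwork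

theorem exists_pos_forall_le {ι : Type*} [Finite ι] {m : ι → ℝ} (h : ∀ i, 0 < m i) :
    ∃ η > 0, ∀ i, η ≤ m i := by
  cases isEmpty_or_nonempty ι
  · exact ⟨1, one_pos, fun i => isEmptyElim i⟩
  · obtain ⟨i, hi⟩ := Finite.exists_min m
    exact ⟨m i, h i, hi⟩

theorem MeasureTheory.LocallyIntegrable.indicator_Icc {u : ℝ → ℝ} (hu : LocallyIntegrable u)
    (a b : ℝ) : LocallyIntegrable ((Icc a b).indicator u) ∧
      HasCompactSupport ((Icc a b).indicator u) :=
  ⟨hu.indicator measurableSet_Icc, HasCompactSupport.intro isCompact_Icc fun _ hx =>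
    indicator_of_notMem hx _⟩

/-! ### Gluing of vanishing statements in time. -/

namespace TimeTest

/-- Vanishing on an interval, from vanishing on both sides of a point and near this point. -/
theorem vanish_of_vanish_near {G : TimeTest → ℝ} (hG : ∀ φ ψ, G (φ + ψ) = G φ + G ψ)
    {a b τ r : ℝ} (hr : 0 < r) (h1 : Distribution.IsVanishingOn G (Ioo a τ))
    (h2 : Distribution.IsVanishingOn G (Ioo τ b))
    (h3 : Distribution.IsVanishingOn G (Ioo (τ - r) (τ + r))) :
    Distribution.IsVanishingOn G (Ioo a b) := by
  intro (φ : TimeTest) hφ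
  -- A smooth partition of unity: `ρ` lives on `t ≥ τ + δ`, `σ` on `t ≤ τ - δ`, and `1 - ρ - σ`
  -- within `2 δ < r` of `τ`.
  set δ := r / 3 with hδ
  have hδ0 : 0 < δ := by positivity
  let ρ : ℝ → ℝ := fun t => Real.smoothTransition ((t - τ - δ) / δ)
  let σ : ℝ → ℝ := fun t => Real.smoothTransition ((τ - t - δ) / δ)
  have hρ : ContDiff ℝ ∞ ρ := Real.smoothTransition.contDiff.comp
    (((contDiff_id.sub contDiff_const).sub contDiff_const).div_const δ)
  have hσ : ContDiff ℝ ∞ σ := Real.smoothTransition.contDiff.comp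
    (((contDiff_const.sub contDiff_id).sub contDiff_const).div_const δ)
  have hκ : ContDiff ℝ ∞ fun t => 1 - ρ t - σ t := (contDiff_const.sub hρ).sub hσ
  have hdec : φ = mulSmooth ρ hρ φ + (mulSmooth σ hσ φ + mulSmooth _ hκ φ) := by
    ext t
    change φ t = ρ t * φ t + (σ t * φ t + (1 - ρ t - σ t) * φ t)
    ring
  have hsub : ∀ (α : ℝ → ℝ) (hα : ContDiff ℝ ∞ α) (C : Set ℝ), IsClosed C →
      (∀ t ∉ C, α t = 0) → tsupport (mulSmooth α hα φ) ⊆ C := by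
    intro α hα C hC h0
    refine closure_minimal (fun t ht => ?_) hC
    by_contra hmem
    refine ht ?_
    rw [mulSmooth_apply, h0 t hmem, zero_mul]
  rw [hdec, hG, hG, h2 (mulSmooth ρ hρ φ), h1 (mulSmooth σ hσ φ), h3 (mulSmooth _ hκ φ)]
  · simp
  · refine (hsub _ hκ (Icc (τ - 2 * δ) (τ + 2 * δ)) isClosed_Icc fun t ht => ?_).trans fun t ht =>
      ⟨by linarith [ht.1], by linarith [ht.2]⟩
    simp only [ρ, σ]
    rw [mem_Icc, not_and_or, not_le, not_le] at ht
    rcases ht with ht | ht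
    · rw [Real.smoothTransition.zero_of_nonpos, Real.smoothTransition.one_of_one_le]
      · ring
      · rw [one_le_div hδ0]
        linarith
      · exact div_nonpos_of_nonpos_of_nonneg (by linarith) hδ0.le
    · rw [Real.smoothTransition.one_of_one_le, Real.smoothTransition.zero_of_nonpos]
      · ring
      · exact div_nonpos_of_nonpos_of_nonneg (by linarith) hδ0.le
      · rw [one_le_div hδ0]
        linarith
  · intro t ht
    have t1 := hφ (tsupport_mulSmooth_subset _ _ _ ht)
    have t2 := hsub σ hσ (Iic (τ - δ)) isClosed_Iic (fun t ht => by
      rw [mem_Iic, not_le] at ht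
      exact Real.smoothTransition.zero_of_nonpos
        (div_nonpos_of_nonpos_of_nonneg (by linarith) hδ0.le)) ht
    rw [mem_Iic] at t2
    exact ⟨t1.1, by linarith⟩
  · intro t ht
    have t1 := hφ (tsupport_mulSmooth_subset _ _ _ ht)
    have t2 := hsub ρ hρ (Ici (τ + δ)) isClosed_Ici (fun t ht => by
      rw [mem_Ici, not_le] at ht
      exact Real.smoothTransition.zero_of_nonpos
        (div_nonpos_of_nonpos_of_nonneg (by linarith) hδ0.le)) ht
    rw [mem_Ici] at t2
    exact ⟨by linarith, t1.2⟩

theorem reflect_add (c : ℝ) (φ ψ : TimeTest) :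
    reflect c (φ + ψ) = reflect c φ + reflect c ψ := by
  ext s
  rfl

theorem tsupport_reflect_subset {φ : TimeTest} {c a b : ℝ} (h : tsupport φ ⊆ Ioo a b) :
    tsupport (reflect c φ) ⊆ Ioo (c - b) (c - a) := by
  rw [tsupport_reflect]
  intro s hs
  have := h hs
  exact ⟨by linarith [this.2], by linarith [this.1]⟩

theorem smear_test_add {u : ℝ → ℝ} (hu : LocallyIntegrable u) (hc : HasCompactSupport u)
    (φ ψ : TimeTest) : smear u (φ + ψ) = smear u φ + smear u ψ := by
  have hi := integrable_of_hasCompactSupport hu hc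
  ext r
  change _ = smear u φ r + smear u ψ r
  rw [smear_apply hu hc, smear_apply hu hc, smear_apply hu hc,
    ← integral_add (integrable_mul_comp_add hi φ r) (integrable_mul_comp_add hi ψ r)]
  refine integral_congr_ae (ae_of_all _ fun s => ?_)
  exact mul_add _ _ _

theorem integral_mul_reflect (u : ℝ → ℝ) (c : ℝ) (φ : TimeTest) :
    ∫ t, u t * reflect c φ t = ∫ t, u (c - t) * φ t := by
  rw [← integral_sub_left_eq_self _ volume c]
  simp

end TimeTest

namespace PipeNetwork

open TimeTest Distribution

variable {V : Type*} {N : PipeNetwork V} {O : N.Outlet}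

/-! #### Travel times to points of the pipes -/

theorem interp_ge {θ : V → ℝ} {e : N.Pipe} {c x : ℝ} (hx : x ∈ Icc 0 (N.length e))
    (h0 : c ≤ θ (N.node e false)) (h1 : c ≤ θ (N.node e true)) : c ≤ N.interp θ e x := by
  have hℓ := N.length_pos e
  have a1 : 0 ≤ x / N.length e := div_nonneg hx.1 hℓ.le
  have a2 : 0 ≤ 1 - x / N.length e := by
    rw [sub_nonneg, div_le_one hℓ]
    exact hx.2
  rw [interp_eq]
  nlinarith [mul_le_mul_of_nonneg_left h0 a2, mul_le_mul_of_nonneg_left h1 a1]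

theorem interp_fromEnd (θ : V → ℝ) (z : N.End) (y : ℝ) :
    N.interp θ z.1 (N.fromEnd z y) = θ (N.vertex z) +
      (θ (N.vertex (N.opp z)) - θ (N.vertex z)) / N.length z.1 * y := by
  obtain ⟨e, b⟩ := z
  have hℓ := (N.length_pos e).ne'
  cases b
  · simp [interp, fromEnd, vertex, opp]
  · simp only [interp, fromEnd, vertex, opp, if_true, Bool.not_true]
    field_simp
    ring

theorem nodeTT_pos [Finite V] {u v : V} (h : u ≠ v) : 0 < N.nodeTT u v :=
  div_pos (nodeDist_pos h) N.speed_pos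

theorem interp_nodeTT_nonneg (u : V) {e : N.Pipe} {x : ℝ} (hx : x ∈ Icc 0 (N.length e)) :
    0 ≤ N.interp (N.nodeTT u) e x :=
  interp_ge hx (nodeTT_nonneg _ _) (nodeTT_nonneg _ _)

theorem interp_nodeTT_pos [Finite V] (u : V) {e : N.Pipe} {x : ℝ} (hx : x ∈ Ioo 0 (N.length e)) :
    0 < N.interp (N.nodeTT u) e x := by
  have hℓ := N.length_pos e
  have a1 : 0 < x / N.length e := div_pos hx.1 hℓ
  have a2 : 0 < 1 - x / N.length e := by
    rw [sub_pos, div_lt_one hℓ]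
    exact hx.2
  rw [interp_eq]
  by_cases h : u = N.node e false
  · have h1 : 0 < N.nodeTT u (N.node e true) := nodeTT_pos (by rw [h]; exact (adj_node e).ne)
    have := nodeTT_nonneg (N := N) u (N.node e false)
    positivity
  · have h1 : 0 < N.nodeTT u (N.node e false) := nodeTT_pos h
    have := nodeTT_nonneg (N := N) u (N.node e true)
    positivity

namespace Outlet

variable (p : N.InnerPoint)

/-- The intermediate quantity is the travel time to the far end of the pipe of `p`. It separates the
two sides strictly because `p` is not a vertex. -/
theorem actionTime_lt_of_not_isCutOff {j : O.Port} (hj : O.IsCutOff p j) {v : V}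
    (hv : ¬ O.IsCutOff p v) : O.actionTime p j <
      (N.nodeDist j (N.vertex (O.innerEnd p)) + N.length p.pipe) / N.speed ∧
      (N.nodeDist j (N.vertex (O.innerEnd p)) + N.length p.pipe) / N.speed ≤ N.nodeTT j v := by
  have ha := N.speed_pos
  have h1 := O.depth_lt p
  rw [actionTime, if_pos hj, O.TT_of_isCutOff p hj, nodeTT]
  rw [isCutOff_iff] at hj hv
  rw [nodeDist_eq_of_beyond hj hv, innerEnd_fst]
  have h2 := nodeDist_nonneg (N := N) (N.vertex (N.opp (O.innerEnd p))) v
  constructor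
  · gcongr
  · exact div_le_div_of_nonneg_right (by linarith) ha.le

theorem not_isCutOff_vertex : ¬ O.IsCutOff p O.vertex := fun h => h (SimpleGraph.Reachable.refl _)

theorem actionTime_lt [Finite V] (j : O.Port) : O.actionTime p j < N.nodeTT j O.vertex := by
  by_cases hj : O.IsCutOff p j
  · have := O.actionTime_lt_of_not_isCutOff p hj (O.not_isCutOff_vertex p)
    exact this.1.trans_le this.2
  · rw [actionTime, if_neg hj]
    exact nodeTT_pos j.2.2

/-- The strict inequality keeps the wave away from `x` until some time after `τ`, not merely until
`τ`. This is why `p` itself and the vertices are excluded. -/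
theorem actionTime_lt_interp [Finite V] (j : O.Port) {e : N.Pipe} {x : ℝ}
    (hx : x ∈ Ioo 0 (N.length e)) (hp : e = p.pipe → x ≠ p.x) (hD : (e, x) ∉ O.admissibleSet p) :
    O.actionTime p j < N.interp (N.nodeTT j) e x := by
  classical
  have ha := N.speed_pos
  have hx' := Ioo_subset_Icc_self hx
  by_cases hj : O.IsCutOff p j
  · by_cases he : e = p.pipe
    · have hxp := hp he
      set z := O.innerEnd p with hz
      have hz1 : z.1 = e := by rw [hz, innerEnd_fst, he]
      have hlt : O.depth p < N.fromEnd z x := by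
        have h1 := O.fromEnd_depth p
        have h2 : ¬ (if O.IsCutOff p (N.node p.pipe false) then x < p.x else p.x < x) := by
          intro h
          refine hD ⟨hx', ?_⟩
          simp only
          rw [if_pos he]
          exact h
        rw [hz]
        subst he
        unfold innerEnd at h1 ⊢
        split_ifs at h1 h2 ⊢
        · simp only [PipeNetwork.fromEnd] at h1 ⊢
          simp at h1 ⊢
          exact lt_of_le_of_ne (by linarith) fun h => hxp (by linarith)
        · simp only [PipeNetwork.fromEnd] at h1 ⊢
          simp at h1 ⊢
          have : x < p.x := lt_of_le_of_ne (by linarith) hxp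
          linarith
      have h3 := N.interp_fromEnd (N.nodeTT j) z (N.fromEnd z x)
      have h4 : N.nodeTT j (N.vertex (N.opp z)) - N.nodeTT j (N.vertex z) =
          N.length z.1 / N.speed := by
        rw [isCutOff_iff] at hj
        rw [nodeTT, nodeTT, nodeDist_eq_of_beyond hj (not_beyond_opp _), nodeDist_self, ← hz]
        ring
      have hℓ := (N.length_pos z.1).ne'
      rw [fromEnd_fromEnd, h4, hz1] at h3
      rw [h3, actionTime, if_pos hj, O.TT_of_isCutOff p hj, nodeTT, add_div]
      have h5 : N.length e / N.speed / N.length e * N.fromEnd z x = N.fromEnd z x / N.speed := by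
        have := (N.length_pos e).ne'
        field_simp
      rw [h5]
      gcongr
    · have hc : ¬ O.IsCutOff p (N.node e false) := fun h => hD ⟨hx', by
        simp only
        rw [if_neg he]
        exact h⟩
      have hc' : ¬ O.IsCutOff p (N.node e true) := by
        rw [isCutOff_iff] at hc ⊢
        have := beyond_iff_of_ne (z := O.innerEnd p) (z' := (e, false)) (by rwa [O.innerEnd_fst])
        exact fun h => hc (this.2 h)
      have h1 := O.actionTime_lt_of_not_isCutOff p hj hc
      have h2 := O.actionTime_lt_of_not_isCutOff p hj hc'
      exact h1.1.trans_le (interp_ge hx' h1.2 h2.2)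
  · rw [actionTime, if_neg hj]
    exact interp_nodeTT_pos _ hx

/-! #### Superposition of the responses to impulses -/

variable [Finite V]

/-- The response to a boundary flow `u`, when there is no reflection at the outlet. -/
def superpose (V₀ : ℝ) (R : O.Port → N.Pipe → ℝ → TimeDist) (u : O.Port → ℝ → ℝ) (e : N.Pipe)
    (x : ℝ) (φ : TimeTest) : ℝ :=
  ∑ i, V₀⁻¹ * R i e x (TimeTest.smear (u i) φ)

variable {V₀ : ℝ} {R P : O.Port → N.Pipe → ℝ → TimeDist} {u v : O.Port → ℝ → ℝ}

/-- Pipe and junction equations survive convolution in time, for all times. The condition at the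
outlet may be lost if it depends on time, but it is not part of a family of waves. -/
theorem isNetFamily_superpose (w : ∀ i, O.IsWave (R i) (P i) (impulse V₀ i))
    (hu : ∀ i, LocallyIntegrable (u i) ∧ HasCompactSupport (u i)) :
    N.IsNetFamily (superpose V₀ R u) (superpose V₀ P u) :=
  IsNetFamily.sum Finset.univ
    (fun i => (IsNetFamily.of_isWave (w i)).smear (hu i).1 (hu i).2) V₀⁻¹

theorem superpose_add (R : O.Port → N.Pipe → ℝ → TimeDist)
    (hu : ∀ i, LocallyIntegrable (u i) ∧ HasCompactSupport (u i))
    (hv : ∀ i, LocallyIntegrable (v i) ∧ HasCompactSupport (v i)) (e : N.Pipe) (x : ℝ)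
    (φ : TimeTest) : superpose V₀ R (fun i s => u i s + v i s) e x φ =
      superpose V₀ R u e x φ + superpose V₀ R v e x φ := by
  simp only [superpose]
  rw [← Finset.sum_add_distrib]
  refine Finset.sum_congr rfl fun i _ => ?_
  rw [smear_add (hu i).1 (hu i).2 (hv i).1 (hv i).2, map_add, mul_add]

theorem superpose_test_add (R : O.Port → N.Pipe → ℝ → TimeDist)
    (hu : ∀ i, LocallyIntegrable (u i) ∧ HasCompactSupport (u i)) (e : N.Pipe) (x : ℝ)
    (φ ψ : TimeTest) : superpose V₀ R u e x (φ + ψ) =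
      superpose V₀ R u e x φ + superpose V₀ R u e x ψ := by
  simp only [superpose]
  rw [← Finset.sum_add_distrib]
  refine Finset.sum_congr rfl fun i _ => ?_
  rw [smear_test_add (hu i).1 (hu i).2, map_add, mul_add]

/-- A flow at port `i` that starts at `c i` is felt at `x` only after the travel time has been
added, by finite speed for the impulse responses. -/
theorem superpose_vanish (w : ∀ i, O.IsWave (R i) (P i) (impulse V₀ i))
    (hA : N.AreaConstNearBoundary)
    (hu : ∀ i, LocallyIntegrable (u i) ∧ HasCompactSupport (u i)) {c : O.Port → ℝ}
    (hc : ∀ i, ∀ᵐ s, s < c i → u i s = 0) {e : N.Pipe} {x d : ℝ} (hx : x ∈ Icc 0 (N.length e))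
    (hd : ∀ i : O.Port, d ≤ c i + N.interp (N.nodeTT i) e x) :
    IsVanishingOn (superpose V₀ R u e x) (Iio d) ∧
      IsVanishingOn (superpose V₀ P u e x) (Iio d) := by
  rw [IsVanishingOn, IsVanishingOn, ← forall_and]
  intro (φ : TimeTest)
  rw [← imp_and]
  intro hφ
  obtain ⟨b, hb, hφb⟩ := exists_tsupport_subset_Iic hφ
  have key : ∀ i, R i e x (TimeTest.smear (u i) φ) = 0 ∧ P i e x (TimeTest.smear (u i) φ) = 0 := by
    intro i
    have hv := (w i).vanish hA (θ := N.nodeTT i) (nodeTT_nonneg _) (abs_nodeTT_sub_le _)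
      (isVanishingOn_impulse V₀ i) hx
    have hs : tsupport (TimeTest.smear (u i) φ) ⊆ Iio (N.interp (N.nodeTT i) e x) :=
      (tsupport_smear_subset (hu i).1 (hu i).2 (hc i) hφb).trans
        (Iic_subset_Iio.2 (by linarith [hd i]))
    exact ⟨hv.1 _ hs, hv.2 _ hs⟩
  constructor
  · exact Finset.sum_eq_zero fun i _ => by rw [(key i).1, mul_zero]
  · exact Finset.sum_eq_zero fun i _ => by rw [(key i).2, mul_zero]

theorem normal_mul_superpose (hV₀ : V₀ ≠ 0) (w : ∀ i, O.IsWave (R i) (P i) (impulse V₀ i))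
    (hu : ∀ i, LocallyIntegrable (u i) ∧ HasCompactSupport (u i)) (j : O.Port) (φ : TimeTest) :
    N.normal j.pos * superpose V₀ P u j.pos.1 (N.coord j.pos) φ = ∫ t, u j t * φ t := by
  classical
  simp only [superpose]
  rw [Finset.mul_sum, Finset.sum_eq_single j]
  · rw [mul_left_comm, (w j).normal_mul_Q, impulse_apply_self, ← mul_assoc,
      inv_mul_cancel₀ hV₀, one_mul, smear_zero_time (hu j).1 (hu j).2]
  · intro i _ hij
    rw [mul_left_comm, (w i).normal_mul_Q, impulse_apply_of_ne V₀ hij.symm, mul_zero]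
  · intro h
    exact absurd (Finset.mem_univ j) h

-- The delta part of the response gives the instantaneous term, since `smear` evaluated at time `0`
-- is the pairing of `u` with `φ`.
open Classical in
theorem superpose_port {k : O.Port → O.Port → TimeDist}
    (hk : ∀ i j : O.Port, V₀⁻¹ • R i j.pos.1 (N.coord j.pos) =
      (if i = j then (N.speed / (N.endArea i.pos * N.gravity)) • Distribution.delta 0 else 0) +
        k i j)
    (hu : ∀ i, LocallyIntegrable (u i) ∧ HasCompactSupport (u i)) (j : O.Port) (φ : TimeTest) :
    superpose V₀ R u j.pos.1 (N.coord j.pos) φ =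
      N.speed / (N.endArea j.pos * N.gravity) * (∫ t, u j t * φ t) +
        ∑ i, k i j (TimeTest.smear (u i) φ) := by
  have h1 : ∀ i, V₀⁻¹ * R i j.pos.1 (N.coord j.pos) (TimeTest.smear (u i) φ) =
      (if i = j then N.speed / (N.endArea j.pos * N.gravity) * (∫ t, u j t * φ t) else 0) +
        k i j (TimeTest.smear (u i) φ) := by
    intro i
    have := congrArg (fun T : TimeDist => T (TimeTest.smear (u i) φ)) (hk i j)
    simp only [TimeDist.add_apply, TimeDist.smul_apply] at this
    rw [this]
    congr 1
    split_ifs with h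
    · subst h
      rw [TimeDist.smul_apply, ← smear_zero_time (hu i).1 (hu i).2]
      congr 1
    · rfl
  simp only [superpose, h1]
  rw [Finset.sum_add_distrib, Finset.sum_ite_eq' Finset.univ j, if_pos (Finset.mem_univ _)]

end Outlet

end PipeNetwork

/-! ### Focusing of waves -/

/-- The function `u` on `[0, τ]`, extended evenly about `τ` and by zero. -/
def evenExtension (τ : ℝ) (u : ℝ → ℝ) (s : ℝ) : ℝ :=
  (Icc 0 τ).indicator u s + (Icc 0 τ).indicator u (2 * τ - s)

theorem evenExtension_symm (τ : ℝ) (u : ℝ → ℝ) (s : ℝ) :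
    evenExtension τ u (2 * τ - s) = evenExtension τ u s := by
  rw [evenExtension, evenExtension, sub_sub_cancel, add_comm]

/-- At `s = τ ≥ 0` both summands contribute, so the inequality has to be strict; a single time does
not matter for the integrals. -/
theorem evenExtension_of_lt {τ : ℝ} {s : ℝ} (u : ℝ → ℝ) (hs : s < τ) :
    evenExtension τ u s = (Icc 0 τ).indicator u s := by
  rw [evenExtension, indicator_of_notMem (a := 2 * τ - s), add_zero]
  exact fun h => by linarith [h.2]

theorem MeasureTheory.LocallyIntegrable.evenExtension {u : ℝ → ℝ} (hu : LocallyIntegrable u)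
    (τ : ℝ) : LocallyIntegrable (evenExtension τ u) ∧ HasCompactSupport (evenExtension τ u) := by
  obtain ⟨h1, h2⟩ := hu.indicator_Icc 0 τ
  have h3 := TimeTest.integrable_of_hasCompactSupport h1 h2
  exact ⟨(h3.add (h3.comp_sub_left (2 * τ))).locallyIntegrable,
    h2.add (h2.comp_homeomorph (Homeomorph.subLeft (2 * τ)))⟩

namespace PipeNetwork

open TimeTest Distribution

variable {V : Type*} {N : PipeNetwork V} {O : N.Outlet}

namespace Outlet

/-- Boundary flows that start so late that no wave arrives beyond `p` before the time `τ`. -/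
structure IsControl (O : N.Outlet) (p : N.InnerPoint) (τ : ℝ) (F : O.Port → ℝ → ℝ) : Prop where
  le : ∀ j, O.actionTime p j ≤ τ
  locallyIntegrable : ∀ j, LocallyIntegrable (F j)
  zero : ∀ j, ∀ᵐ t, t < τ - O.actionTime p j → F j t = 0

variable {p : N.InnerPoint} {τ : ℝ} {F : O.Port → ℝ → ℝ}
  {H Q : N.Pipe → ℝ → TimeDist} {V₀ : ℝ} {R P : O.Port → N.Pipe → ℝ → TimeDist}

theorem integral_eq_of_ae_eq_on {f g : ℝ → ℝ} {U : Set ℝ} (h : ∀ᵐ t, t ∈ U → f t = g t)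
    {φ : TimeTest} (hφ : tsupport φ ⊆ U) : ∫ t, f t * φ t = ∫ t, g t * φ t := by
  refine integral_congr_ae ?_
  filter_upwards [h] with t ht
  by_cases hm : t ∈ U
  · rw [ht hm]
  · rw [image_eq_zero_of_notMem_tsupport (f := φ) fun h => hm (hφ h), mul_zero, mul_zero]

theorem IsControl.isVanishingOn (hF : O.IsControl p τ F) (j : O.Port) :
    IsVanishingOn (TimeDist.ofFun (F j)) (Iio (τ - O.actionTime p j)) := by
  intro (φ : TimeTest) hφ
  rw [TimeDist.ofFun_apply (hF.locallyIntegrable j),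
    integral_eq_of_ae_eq_on (g := fun _ => 0) (hF.zero j) hφ]
  simp

/-- No wave arrives at the outlet until some time after `τ`. -/
theorem IsControl.exists_silence [Finite V] (hF : O.IsControl p τ F)
    (w : O.IsWave H Q fun j => TimeDist.ofFun (F j)) (hA : N.AreaConstNearBoundary) :
    ∃ η > 0, η ≤ 1 ∧ (∀ j, O.actionTime p j + η ≤ N.nodeTT j O.vertex) ∧
      IsVanishingOn (Q O.pos.1 (N.coord O.pos)) (Iio (τ + η)) := by
  obtain ⟨η', hη', hle⟩ := exists_pos_forall_le
    (m := fun j : O.Port => N.nodeTT j O.vertex - O.actionTime p j)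
    fun j => sub_pos.2 (O.actionTime_lt p j)
  have hη1 : min η' 1 ≤ η' := min_le_left _ _
  -- The cap at `1` matches the truncation of the flows to `[0, τ + 1]` below.
  refine ⟨min η' 1, by positivity, min_le_right _ _, fun j => by linarith [hle j], ?_⟩
  set η := min η' 1
  -- The surface is the backward characteristic cone of the outlet at time `τ + η`, cut off at time
  -- `0`. Flows at the ports start only above it.
  have hv := (w.vanish hA (θ := fun v => max 0 (τ + η - N.nodeTT O.vertex v))
    (fun v => le_max_left _ _) (fun e => by
      refine (abs_max_sub_max_le_max _ _ _ _).trans ?_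
      rw [sub_self, abs_zero, sub_sub_sub_cancel_left, abs_sub_comm]
      exact max_le (div_nonneg (N.length_pos e).le N.speed_pos.le) (abs_nodeTT_sub_le _ e))
    (fun j => (hF.isVanishingOn j).mono (Iio_subset_Iio (max_le (by linarith [hF.le j]) (by
      rw [nodeTT_comm]
      linarith [hle j])))) (N.coord_mem O.pos)).2
  rw [interp_coord] at hv
  refine hv.mono (Iio_subset_Iio ?_)
  change _ ≤ max 0 (τ + η - N.nodeTT O.vertex O.vertex)
  rw [nodeTT_self, sub_zero]
  exact le_max_right _ _

/-- Until some time after `τ` the wave is a superposition of impulse responses. -/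
theorem IsControl.exists_eq_superpose [Finite V] (hF : O.IsControl p τ F)
    (w : O.IsWave H Q fun j => TimeDist.ofFun (F j)) (hA : N.AreaConstNearBoundary) (hV₀ : V₀ ≠ 0)
    (wR : ∀ i, O.IsWave (R i) (P i) (impulse V₀ i)) :
    ∃ η > 0, ∀ e, ∀ x ∈ Icc 0 (N.length e), ∀ φ : TimeTest, tsupport φ ⊆ Iio (τ + η) →
      H e x φ = superpose V₀ R (fun i => (Icc 0 (τ + 1)).indicator (F i)) e x φ := by
  obtain ⟨η, hη, hη1, hTT, hQ⟩ := hF.exists_silence w hA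
  have hv := fun i => (hF.locallyIntegrable i).indicator_Icc 0 (τ + 1)
  set v : O.Port → ℝ → ℝ := fun i => (Icc 0 (τ + 1)).indicator (F i) with hvdef
  have hv0 : ∀ i, ∀ᵐ s, s < (0 : ℝ) → v i s = 0 := fun i => ae_of_all _ fun s hs =>
    indicator_of_notMem (fun h => by linarith [h.1]) _
  have hvz : ∀ i, ∀ᵐ s, s < τ - O.actionTime p i → v i s = 0 := by
    intro i
    filter_upwards [hF.zero i] with s hs h
    rw [hvdef]
    simp only [indicator_apply]
    rw [hs h, ite_self]
  have hfam := (IsNetFamily.of_isWave w).combine (isNetFamily_superpose wR hv) 1 (-1)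
  refine ⟨η, hη, fun e x hx φ hφ => ?_⟩
  -- The difference of the wave and the superposition carries no energy through the boundary before
  -- `τ + η`: the flows agree at the ports, and both waves have zero flow at the outlet. The outlet
  -- condition itself is not needed for the superposition.
  have key := (hfam.vanish_before (c := τ + η) ?_ ?_ hx).1 φ hφ
  · simp only at key
    linarith
  · intro e x hx
    have hs := superpose_vanish wR hA hv hv0 (d := 0) hx fun i => by
      linarith [interp_nodeTT_nonneg (N := N) i hx]
    constructor
    · intro (ψ : TimeTest) hψ
      simp only
      rw [w.initial_H e x hx ψ hψ, hs.1 ψ hψ]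
      simp
    · intro (ψ : TimeTest) hψ
      simp only
      rw [w.initial_Q e x hx ψ hψ, hs.2 ψ hψ]
      simp
  · intro z hz (ψ : TimeTest) hψ
    simp only
    rcases O.boundary_cases hz with rfl | ⟨j, rfl⟩
    · have hs := superpose_vanish wR hA hv hvz (d := τ + η) (N.coord_mem O.pos) fun i => by
        rw [interp_coord]
        change _ ≤ _ + N.nodeTT i O.vertex
        linarith [hTT i]
      rw [hQ ψ hψ, hs.2 ψ hψ]
      simp
    · have h1 := w.normal_mul_Q j ψ
      have h2 := normal_mul_superpose hV₀ wR hv j ψ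
      rw [TimeDist.ofFun_apply (hF.locallyIntegrable j),
        integral_eq_of_ae_eq_on (g := v j) (U := Iio (τ + η)) ?_ hψ, ← h2] at h1
      · rw [mul_right_injective₀ (N.normal_ne_zero _) h1]
        ring
      · filter_upwards [hF.zero j] with t ht htU
        by_cases h0 : t < 0
        · rw [ht (by linarith [hF.le j]), hvdef]
          simp only
          rw [indicator_of_notMem fun h => by linarith [h.1]]
        · rw [hvdef]
          simp only
          rw [mem_Iio] at htU
          rw [indicator_of_mem (mem_Icc.2 ⟨not_lt.1 h0, by linarith⟩)]

/-- The difference of the even flow and the actual one. -/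
def lateFlow (τ : ℝ) (F : O.Port → ℝ → ℝ) (i : O.Port) (s : ℝ) : ℝ :=
  evenExtension τ (F i) s + -1 * (Icc 0 (τ + 1)).indicator (F i) s

theorem lateFlow_of_lt {i : O.Port} {s : ℝ} (hs : s < τ) : lateFlow τ F i s = 0 := by
  rw [lateFlow, evenExtension_of_lt _ hs]
  by_cases h0 : 0 ≤ s
  · rw [indicator_of_mem (mem_Icc.2 ⟨h0, hs.le⟩), indicator_of_mem (mem_Icc.2 ⟨h0, by linarith⟩)]
    ring
  · rw [indicator_of_notMem fun h => h0 h.1, indicator_of_notMem fun h => h0 h.1]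
    ring

theorem integrable_lateFlow (hF : ∀ i, LocallyIntegrable (F i)) (i : O.Port) :
    LocallyIntegrable (lateFlow τ F i) ∧ HasCompactSupport (lateFlow τ F i) := by
  have h1 := (hF i).evenExtension τ
  have h2 := (hF i).indicator_Icc 0 (τ + 1)
  exact ⟨h1.1.add (h2.1.smul (-1 : ℝ)), h1.2.add h2.2.mul_left⟩

theorem superpose_even [Finite V] (hF : ∀ i, LocallyIntegrable (F i)) (R : O.Port → N.Pipe → ℝ → TimeDist)
    (e : N.Pipe) (x : ℝ) (φ : TimeTest) :
    superpose V₀ R (fun i => evenExtension τ (F i)) e x φ =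
      superpose V₀ R (fun i => (Icc 0 (τ + 1)).indicator (F i)) e x φ +
        superpose V₀ R (lateFlow τ F) e x φ := by
  rw [← superpose_add R (fun i => (hF i).indicator_Icc 0 (τ + 1)) (integrable_lateFlow hF)]
  congr 1
  funext i s
  simp only [lateFlow]
  ring

/-- The part of the kernels that is not instantaneous does not see the late flow. -/
theorem kernel_smear_eq_zero {k : TimeDist} {ε : ℝ} (hk : IsVanishingOn k (Iio ε)) {u : ℝ → ℝ}
    (hu : LocallyIntegrable u ∧ HasCompactSupport u) (h0 : ∀ s < τ, u s = 0) {φ : TimeTest}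
    (hφ : tsupport φ ⊆ Iio (τ + ε)) : k (TimeTest.smear u φ) = 0 := by
  obtain ⟨b, hb, hφb⟩ := exists_tsupport_subset_Iic hφ
  exact hk _ ((tsupport_smear_subset hu.1 hu.2 (ae_of_all _ h0) hφb).trans
    (Iic_subset_Iio.2 (by linarith)))

/-- At the accessible boundary points the pressure of the even wave is even about `τ`, up to a
constant. -/
theorem even_pressure_before [Finite V] {k : O.Port → O.Port → TimeDist} {ε h₀ : ℝ} {Qp : O.Port → ℝ → ℝ}
    (hε : 0 < ε) (hkε : ∀ i j, IsVanishingOn (k i j) (Iio ε))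
    (hQp : ∀ j, LocallyIntegrable (Qp j)) (hle : ∀ j, O.actionTime p j ≤ τ)
    (hIE : O.IntegralEquation k (O.actionTime p) τ h₀ Qp) (j : O.Port) {φ : TimeTest}
    (hφ : tsupport φ ⊆ Ioo (τ - O.actionTime p j) τ) :
    N.speed / (N.endArea j.pos * N.gravity) *
        ((∫ t, evenExtension τ (fun t => N.normal j.pos * Qp j t) t * φ t) +
          ∫ t, evenExtension τ (fun t => N.normal j.pos * Qp j t) t * reflect (2 * τ) φ t) +
      ∑ i : O.Port, (k i j (TimeTest.smear (evenExtension τ fun t => N.normal i.pos * Qp i t) φ) +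
        k i j (TimeTest.smear (evenExtension τ fun t => N.normal i.pos * Qp i t)
          (reflect (2 * τ) φ))) = 2 * (h₀ * ∫ t, φ t) := by
  have hq := fun i => (hQp i).indicator_Icc 0 τ
  have hqi := fun i => TimeTest.integrable_of_hasCompactSupport (hq i).1 (hq i).2
  have hφτ : tsupport φ ⊆ Iio τ := fun t ht => (hφ ht).2
  have hform : ∀ i, evenExtension τ (fun t => N.normal i.pos * Qp i t) = fun s =>
      N.normal i.pos * ((Icc 0 τ).indicator (Qp i) s + (Icc 0 τ).indicator (Qp i) (2 * τ - s)) := by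
    intro i
    funext s
    simp only [evenExtension, indicator_apply]
    split_ifs <;> ring
  have hq' : ∀ i, LocallyIntegrable (fun s => (Icc 0 τ).indicator (Qp i) (2 * τ - s)) ∧
      HasCompactSupport (fun s => (Icc 0 τ).indicator (Qp i) (2 * τ - s)) := fun i =>
    ⟨((hqi i).comp_sub_left (2 * τ)).locallyIntegrable,
      (hq i).2.comp_homeomorph (Homeomorph.subLeft (2 * τ))⟩
  have hsm : ∀ i, ∀ ψ : TimeTest,
      TimeTest.smear (evenExtension τ fun t => N.normal i.pos * Qp i t) ψ =
      N.normal i.pos • (TimeTest.smear ((Icc 0 τ).indicator (Qp i)) ψ +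
        reflect 0 (TimeTest.smear ((Icc 0 τ).indicator (Qp i)) (reflect (2 * τ) ψ))) := by
    intro i ψ
    rw [hform, smear_const_mul (u := fun s => (Icc 0 τ).indicator (Qp i) s +
        (Icc 0 τ).indicator (Qp i) (2 * τ - s)) ((hq i).1.add (hq' i).1) ((hq i).2.add (hq' i).2),
      smear_add (hq i).1 (hq i).2 (hq' i).1 (hq' i).2, smear_reflect (hq i).1 (hq i).2]
  -- The mirrored half of the flow starts at `τ`, and the delay `ε` of the kernel hides it from test
  -- functions supported before `τ`.
  have hlate : ∀ i, k i j (reflect 0 (TimeTest.smear ((Icc 0 τ).indicator (Qp i))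
      (reflect (2 * τ) φ))) = 0 := by
    intro i
    rw [← smear_reflect (hq i).1 (hq i).2]
    exact kernel_smear_eq_zero (τ := τ) (hkε i j) (hq' i)
      (fun s hs => indicator_of_notMem (fun h => by linarith [h.2]) _)
      (hφτ.trans (Iio_subset_Iio (by linarith)))
  -- Of the four terms from the two halves of the flow, tested with `φ` and its reflection, one
  -- vanishes by the delay. The other three are those of the integral equation, up to the factor
  -- that `ν / 2` takes away.
  have hk : ∀ i, k i j (TimeTest.smear (evenExtension τ fun t => N.normal i.pos * Qp i t) φ) +
      k i j (TimeTest.smear (evenExtension τ fun t => N.normal i.pos * Qp i t)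
        (reflect (2 * τ) φ)) = 2 * (N.normal i.pos / 2 *
        ((k i j).convAbs ((Icc 0 τ).indicator (Qp i)) φ +
          (k i j).convReflect (2 * τ) ((Icc 0 τ).indicator (Qp i)) φ)) := by
    intro i
    rw [hsm, hsm, map_smul, map_smul, map_add, map_add, reflect_reflect, hlate,
      TimeDist.convAbs, TimeDist.convReflect, smul_eq_mul, smul_eq_mul]
    ring
  have hint : ∫ t, evenExtension τ (fun t => N.normal j.pos * Qp j t) t * φ t =
      ∫ t, (N.normal j.pos * Qp j t) * φ t := by
    refine integral_eq_of_ae_eq_on (U := Ioo (τ - O.actionTime p j) τ) (ae_of_all _ fun t ht => ?_) hφ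
    rw [evenExtension_of_lt _ ht.2, 
      indicator_of_mem (mem_Icc.2 ⟨by linarith [ht.1, hle j], ht.2.le⟩)]
  have hint' : ∫ t, evenExtension τ (fun t => N.normal j.pos * Qp j t) t * reflect (2 * τ) φ t =
      ∫ t, (N.normal j.pos * Qp j t) * φ t := by
    rw [integral_mul_reflect, ← hint]
    simp only [evenExtension_symm]
  have hI := hIE j φ hφ
  rw [integral_const_mul] at hI
  have hI' : ∫ t, N.speed / (N.endArea j.pos * N.gravity) * N.normal j.pos * Qp j t * φ t =
      N.speed / (N.endArea j.pos * N.gravity) * ∫ t, (N.normal j.pos * Qp j t) * φ t := by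
    rw [← integral_const_mul]
    simp only [mul_assoc]
  rw [hI'] at hI
  simp only [hk]
  rw [hint, hint', ← Finset.mul_sum, hI]
  ring

end Outlet

end PipeNetwork

/-- The function `t ↦ g(t) + g(2τ - t) - 2c` near `τ`. -/
def evenDefect (τ r c : ℝ) (g : ℝ → ℝ) (t : ℝ) : ℝ :=
  (Icc (τ - r) (τ + r)).indicator g t + (Icc (τ - r) (τ + r)).indicator g (2 * τ - t) - 2 * c

/-! ### From distributional evenness about `τ` to evenness almost everywhere. -/

namespace TimeTest

variable {τ r c : ℝ} {g : ℝ → ℝ}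

/-- Truncation to an interval symmetric about `τ` makes `g` integrable, and then its reflection is
integrable too. -/
theorem locallyIntegrable_evenDefect (hg : LocallyIntegrable g) (τ r c : ℝ) :
    LocallyIntegrable (evenDefect τ r c g) := by
  obtain ⟨h1, h2⟩ := hg.indicator_Icc (τ - r) (τ + r)
  have h3 := integrable_of_hasCompactSupport h1 h2
  exact (h1.add (h3.comp_sub_left (2 * τ)).locallyIntegrable).sub (locallyIntegrable_const _)

theorem tsupport_reflect_subset_ball {φ : TimeTest} (hφ : tsupport φ ⊆ Ioo (τ - r) (τ + r)) :
    tsupport (reflect (2 * τ) φ) ⊆ Ioo (τ - r) (τ + r) := by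
  have := tsupport_reflect_subset (c := 2 * τ) hφ
  rwa [show 2 * τ - (τ + r) = τ - r by ring, show 2 * τ - (τ - r) = τ + r by ring] at this

theorem integral_evenDefect (hg : LocallyIntegrable g) (c : ℝ) {φ : TimeTest}
    (hφ : tsupport φ ⊆ Ioo (τ - r) (τ + r)) :
    ∫ t, evenDefect τ r c g t * φ t =
      (∫ t, g t * φ t) + (∫ t, g t * reflect (2 * τ) φ t) - 2 * (c * ∫ t, φ t) := by
  obtain ⟨h1, h2⟩ := hg.indicator_Icc (τ - r) (τ + r)
  have h3 := integrable_of_hasCompactSupport h1 h2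
  have hloc : ∀ ψ : TimeTest, tsupport ψ ⊆ Ioo (τ - r) (τ + r) →
      ∫ t, g t * ψ t = ∫ t, (Icc (τ - r) (τ + r)).indicator g t * ψ t := fun ψ hψ =>
    PipeNetwork.Outlet.integral_eq_of_ae_eq_on (ae_of_all _ fun t ht =>
      (indicator_of_mem (Ioo_subset_Icc_self ht) g).symm) hψ
  rw [hloc φ hφ, hloc _ (tsupport_reflect_subset_ball hφ), integral_mul_reflect,
    ← integral_add (integrable_mul h3 φ) (integrable_mul (h3.comp_sub_left (2 * τ)) φ),
    ← integral_const_mul, ← integral_const_mul, ← integral_sub]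
  · refine integral_congr_ae (ae_of_all _ fun t => ?_)
    simp only [evenDefect]
    ring
  · exact (integrable_mul h3 φ).add (integrable_mul (h3.comp_sub_left (2 * τ)) φ)
  · have := locallyIntegrable_mul (locallyIntegrable_const (μ := volume) (2 * c)) φ
    simpa only [mul_assoc] using this

theorem ae_even_of_integral (hg : LocallyIntegrable g)
    (h : ∀ φ : TimeTest, tsupport φ ⊆ Ioo (τ - r) (τ + r) →
      (∫ t, g t * φ t) + (∫ t, g t * reflect (2 * τ) φ t) = 2 * (c * ∫ t, φ t)) :
    ∀ᵐ t, t ∈ Ioo (τ - r) (τ + r) → g t + g (2 * τ - t) = 2 * c := by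
  have key := TimeDist.ae_eq_zero_of_integral_mul isOpen_Ioo
    ((locallyIntegrable_evenDefect hg τ r c).locallyIntegrableOn (Ioo (τ - r) (τ + r)))
    fun φ hφ => by rw [integral_evenDefect hg c hφ, h φ hφ, sub_self]
  filter_upwards [key] with t ht hmem
  have h1 := ht hmem
  rw [evenDefect, indicator_of_mem (Ioo_subset_Icc_self hmem),
    indicator_of_mem (mem_Icc.2 ⟨by linarith [hmem.2], by linarith [hmem.1]⟩)] at h1
  linarith

end TimeTest

/-! ### Evenness of the pressure, from the ports to the interior. -/

namespace PipeNetwork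

open TimeTest Distribution

variable {V : Type*} {N : PipeNetwork V} {O : N.Outlet}

namespace Outlet

variable [Finite V] {p : N.InnerPoint} {τ : ℝ} {V₀ : ℝ} {R P : O.Port → N.Pipe → ℝ → TimeDist}

open Classical in
/-- At the boundary points that are cut off, the pressure of the even wave is even about `τ`, up
to a constant. -/
theorem even_pressure_port {k : O.Port → O.Port → TimeDist} {ε η h₀ : ℝ} {Qp : O.Port → ℝ → ℝ}
    (hk : ∀ i j : O.Port, V₀⁻¹ • R i j.pos.1 (N.coord j.pos) =
      (if i = j then (N.speed / (N.endArea i.pos * N.gravity)) • Distribution.delta 0 else 0) +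
        k i j)
    (hε : 0 < ε) (hkε : ∀ i j, IsVanishingOn (k i j) (Iio ε))
    (hF : O.IsControl p τ fun j t => N.normal j.pos * Qp j t)
    (hQp : ∀ j, LocallyIntegrable (Qp j))
    (hIE : O.IntegralEquation k (O.actionTime p) τ h₀ Qp) {j : O.Port} (hj : O.IsCutOff p j)
    {g : ℝ → ℝ} (hg : LocallyIntegrable g) (hη : 0 < η)
    (hgs : ∀ φ : TimeTest, tsupport φ ⊆ Iio (τ + η) → ∫ t, g t * φ t =
      superpose V₀ R (fun i => (Icc 0 (τ + 1)).indicator fun t => N.normal i.pos * Qp i t)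
        j.pos.1 (N.coord j.pos) φ) :
    IsVanishingOn (fun φ : TimeTest =>
      superpose V₀ R (fun i => evenExtension τ fun t => N.normal i.pos * Qp i t)
          j.pos.1 (N.coord j.pos) φ +
        superpose V₀ R (fun i => evenExtension τ fun t => N.normal i.pos * Qp i t)
          j.pos.1 (N.coord j.pos) (reflect (2 * τ) φ) + -2 * h₀ * ∫ t, φ t)
      (Ioo (τ - O.actionTime p j) (τ + O.actionTime p j)) := by
  set F : O.Port → ℝ → ℝ := fun i t => N.normal i.pos * Qp i t with hFdef
  set f := O.actionTime p j with hf
  have hf0 : 0 < f := by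
    rw [hf, actionTime, if_pos hj, O.TT_of_isCutOff p hj]
    exact div_pos (add_pos_of_nonneg_of_pos (nodeDist_nonneg _ _) (O.depth_pos p)) N.speed_pos
  have hev := fun i => (hF.locallyIntegrable i).evenExtension τ
  set W := superpose V₀ R (fun i => evenExtension τ (F i)) j.pos.1 (N.coord j.pos) with hW
  set c := N.speed / (N.endArea j.pos * N.gravity) with hc
  let G : TimeTest → ℝ := fun φ => W φ + W (reflect (2 * τ) φ) + -2 * h₀ * ∫ t, φ t
  have hGrefl : ∀ φ, G (reflect (2 * τ) φ) = G φ := by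
    intro φ
    simp only [G]
    rw [reflect_reflect, integral_reflect, add_comm (W _)]
  -- Before `τ` this is the integral equation; after `τ` it follows because `G` is invariant under
  -- reflection about `τ`.
  have hbefore : IsVanishingOn G (Ioo (τ - f) τ) := by
    intro (φ : TimeTest) hφ
    have h1 := even_pressure_before hε hkε hQp hF.le hIE j hφ
    rw [Finset.sum_add_distrib] at h1
    have h2 := superpose_port hk hev j φ
    have h3 := superpose_port hk hev j (reflect (2 * τ) φ)
    simp only [G]
    rw [hW, h2, h3]
    linarith
  have hafter : IsVanishingOn G (Ioo τ (τ + f)) := by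
    intro (φ : TimeTest) hφ
    rw [← hGrefl]
    refine hbefore _ ((tsupport_reflect_subset (c := 2 * τ) hφ).trans ?_)
    rw [show 2 * τ - (τ + f) = τ - f by ring, show 2 * τ - τ = τ by ring]
  have hadd : ∀ φ ψ, G (φ + ψ) = G φ + G ψ := by
    intro φ ψ
    have hi : ∫ t, (φ + ψ) t = (∫ t, φ t) + ∫ t, ψ t :=
      integral_add (φ.continuous.integrable_of_hasCompactSupport φ.hasCompactSupport)
        (ψ.continuous.integrable_of_hasCompactSupport ψ.hasCompactSupport)
    simp only [G]
    rw [reflect_add, hW, superpose_test_add R hev, superpose_test_add R hev, hi]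
    ring
  -- Three windows about `τ`: evenness is known on both sides for `f`, the actual pressure is the
  -- function `g` until `τ + η`, and the kernels ignore the late flow until `τ + ε`.
  set r := min f (min η ε) with hr
  have hr0 : 0 < r := by positivity
  have hlate := integrable_lateFlow (τ := τ) hF.locallyIntegrable
  have hm : LocallyIntegrable fun t => g t + c * lateFlow τ F j t :=
    hg.add ((hlate j).1.smul c)
  have hrη : r ≤ η := (min_le_right _ _).trans (min_le_left _ _)
  have hrε : r ≤ ε := (min_le_right _ _).trans (min_le_right _ _)
  have hWm : ∀ φ : TimeTest, tsupport φ ⊆ Ioo (τ - r) (τ + r) →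
      W φ = ∫ t, (g t + c * lateFlow τ F j t) * φ t := by
    intro φ hφ
    have h0 : tsupport φ ⊆ Iio (τ + η) := fun t ht => by
      have := (hφ ht).2
      rw [mem_Iio]
      linarith
    have h0' : tsupport φ ⊆ Iio (τ + ε) := fun t ht => by
      have := (hφ ht).2
      rw [mem_Iio]
      linarith
    have h1 := superpose_port hk hlate j φ
    rw [Finset.sum_eq_zero fun i _ => kernel_smear_eq_zero (hkε i j) (hlate i)
      (fun s hs => lateFlow_of_lt hs) h0', add_zero] at h1
    rw [hW, superpose_even hF.locallyIntegrable, ← hgs φ h0, h1, ← integral_const_mul,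
      ← integral_add (locallyIntegrable_mul hg φ)
        ((locallyIntegrable_mul (hlate j).1 φ).const_mul _)]
    refine integral_congr_ae (ae_of_all _ fun t => ?_)
    simp only [c]
    ring
  have hGm : ∀ φ : TimeTest, tsupport φ ⊆ Ioo (τ - r) (τ + r) →
      G φ = ∫ t, evenDefect τ r h₀ (fun t => g t + c * lateFlow τ F j t) t * φ t := by
    intro φ hφ
    rw [integral_evenDefect hm h₀ hφ, ← hWm φ hφ, ← hWm _ (tsupport_reflect_subset_ball hφ)]
    simp only [G]
    ring
  have hd := locallyIntegrable_evenDefect hm τ r h₀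
  have hrf : r ≤ f := min_le_left _ _
  have hleft := TimeDist.ae_eq_zero_of_integral_mul isOpen_Ioo
    (hd.locallyIntegrableOn (Ioo (τ - r) τ)) fun φ hφ => by
      rw [← hGm φ (hφ.trans fun t ht => ⟨ht.1, by linarith [ht.2]⟩)]
      exact hbefore φ (hφ.trans fun t ht => ⟨by linarith [ht.1], ht.2⟩)
  have hright := TimeDist.ae_eq_zero_of_integral_mul isOpen_Ioo
    (hd.locallyIntegrableOn (Ioo τ (τ + r))) fun φ hφ => by
      rw [← hGm φ (hφ.trans fun t ht => ⟨by linarith [ht.1], ht.2⟩)]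
      exact hafter φ (hφ.trans fun t ht => ⟨ht.1, by linarith [ht.2]⟩)
  -- Vanishing on both sides of `τ` does not exclude a distribution concentrated at `τ`. Near `τ`
  -- however `G` is given by a locally integrable function, and a single point is a null set.
  have hnear : IsVanishingOn G (Ioo (τ - r) (τ + r)) := by
    intro (φ : TimeTest) hφ
    rw [hGm φ hφ, integral_eq_of_ae_eq_on (g := fun _ => 0) (U := Ioo (τ - r) (τ + r)) ?_ hφ]
    · simp
    · have hne : ∀ᵐ t : ℝ, t ≠ τ := by
        simp [ae_iff]
      filter_upwards [hleft, hright, hne] with t h1 h2 h3 ht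
      rcases lt_or_gt_of_ne h3 with h | h
      · exact h1 ⟨ht.1, h⟩
      · exact h2 ⟨h, ht.2⟩
  exact vanish_of_vanish_near hadd hr0 hbefore hafter hnear

open Classical in
/-- The pressure near the time `τ`, at the points of the network. -/
theorem IsFunctionWave.even_pressure {k : O.Port → O.Port → TimeDist} {ε h₀ : ℝ}
    {Qp : O.Port → ℝ → ℝ} {H Q : N.Pipe → ℝ → ℝ → ℝ} (hA : N.AreaConstNearBoundary) (hV₀ : V₀ ≠ 0)
    (wR : ∀ i, O.IsWave (R i) (P i) (impulse V₀ i))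
    (hk : ∀ i j : O.Port, V₀⁻¹ • R i j.pos.1 (N.coord j.pos) =
      (if i = j then (N.speed / (N.endArea i.pos * N.gravity)) • Distribution.delta 0 else 0) +
        k i j)
    (hε : 0 < ε) (hkε : ∀ i j, IsVanishingOn (k i j) (Iio ε))
    (hF : O.IsControl p τ fun j t => N.normal j.pos * Qp j t)
    (hQp : ∀ j, LocallyIntegrable (Qp j))
    (hIE : O.IntegralEquation k (O.actionTime p) τ h₀ Qp)
    (w : O.IsFunctionWave H Q fun j t => N.normal j.pos * Qp j t) {e : N.Pipe} {x : ℝ}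
    (hx : x ∈ Ioo 0 (N.length e)) (hp : e = p.pipe → x ≠ p.x) :
    ∃ r > 0, ∀ᵐ t, t ∈ Ioo (τ - r) (τ + r) →
      H e t x + H e (2 * τ - t) x = 2 * if (e, x) ∈ O.admissibleSet p then h₀ else 0 := by
  have hx' := Ioo_subset_Icc_self hx
  set F : O.Port → ℝ → ℝ := fun i t => N.normal i.pos * Qp i t with hFdef
  obtain ⟨η, hη, hHs⟩ := hF.exists_eq_superpose w.wave hA hV₀ wR
  have hHs' : ∀ e, ∀ x ∈ Icc 0 (N.length e), ∀ φ : TimeTest, tsupport φ ⊆ Iio (τ + η) →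
      ∫ t, H e t x * φ t =
        superpose V₀ R (fun i => (Icc 0 (τ + 1)).indicator (F i)) e x φ := by
    intro e x hx φ hφ
    rw [← hHs e x hx φ hφ, TimeDist.ofFun_apply (w.trace_H e x hx)]
  have hfin : ∀ r : ℝ, 0 < r → (∀ φ : TimeTest, tsupport φ ⊆ Ioo (τ - r) (τ + r) →
      (∫ t, H e t x * φ t) + (∫ t, H e t x * reflect (2 * τ) φ t) =
        2 * ((if (e, x) ∈ O.admissibleSet p then h₀ else 0) * ∫ t, φ t)) →
      ∃ r > 0, ∀ᵐ t, t ∈ Ioo (τ - r) (τ + r) →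
        H e t x + H e (2 * τ - t) x = 2 * if (e, x) ∈ O.admissibleSet p then h₀ else 0 :=
    fun r hr h => ⟨r, hr, ae_even_of_integral (w.trace_H e x hx') h⟩
  have hball : ∀ {r d : ℝ}, r ≤ d → Ioo (τ - r) (τ + r) ⊆ Iio (τ + d) := by
    intro r d hrd t ht
    have := ht.2
    rw [mem_Iio]
    linarith
  by_cases hD : (e, x) ∈ O.admissibleSet p
  · simp only [if_pos hD] at hfin ⊢
    have hev := fun i => (hF.locallyIntegrable i).evenExtension τ
    have hlate := integrable_lateFlow (τ := τ) hF.locallyIntegrable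
    set W := superpose V₀ R (fun i => evenExtension τ (F i)) with hW
    set WQ := superpose V₀ P (fun i => evenExtension τ (F i)) with hWQ
    have fam : N.IsNetFamily W WQ := isNetFamily_superpose wR hev
    -- The even wave plus its time reversal minus `2 h₀`. At the ports its flow vanishes since the
    -- flow is even and time reversal changes its sign; its pressure vanishes by
    -- `even_pressure_port`.
    have fam2 := (fam.combine (fam.reflect (2 * τ)) 1 1).combine (IsNetFamily.const (-2 * h₀)) 1 1
    simp only [one_mul, add_zero] at fam2
    obtain ⟨r₁, hr₁, hvan⟩ := fam2.vanish_admissible (τ := τ) p (fun j hj => by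
      refine ⟨even_pressure_port hk hε hkε hF hQp hIE hj (w.trace_H _ _ (N.coord_mem _)) hη
        (hHs' _ _ (N.coord_mem _)), ?_⟩
      intro (φ : TimeTest) _
      have h1 := normal_mul_superpose hV₀ wR hev j φ
      have h2 := normal_mul_superpose hV₀ wR hev j (reflect (2 * τ) φ)
      rw [integral_mul_reflect] at h2
      simp only [evenExtension_symm] at h2
      have h3 := mul_right_injective₀ (N.normal_ne_zero _) (h1.trans h2.symm)
      simp only
      rw [hWQ, h3, add_neg_cancel]) hD
    obtain ⟨η', hη', hle⟩ := exists_pos_forall_le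
      (m := fun i : O.Port => N.interp (N.nodeTT i) e x) fun i => interp_nodeTT_pos _ hx
    -- The even wave differs from the actual one by the response to flows that start at `τ`, which
    -- need a positive time to reach the interior point `x`.
    have hWH : ∀ φ : TimeTest, tsupport φ ⊆ Iio (τ + min η η') → ∫ t, H e t x * φ t = W e x φ := by
      intro φ hφ
      have h1 := (superpose_vanish wR hA hlate (c := fun _ => τ) (d := τ + η')
        (fun i => ae_of_all _ fun s hs => lateFlow_of_lt hs) hx' fun i => by
          linarith [hle i]).1 φ (hφ.trans (Iio_subset_Iio (by linarith [min_le_right η η'])))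
      rw [hW, superpose_even hF.locallyIntegrable, h1, add_zero]
      exact hHs' e x hx' φ (hφ.trans (Iio_subset_Iio (by linarith [min_le_left η η'])))
    refine hfin (min r₁ (min η η')) (by positivity) fun φ hφ => ?_
    rw [hWH φ (hφ.trans (hball (min_le_right _ _))),
      hWH _ ((tsupport_reflect_subset_ball hφ).trans (hball (min_le_right _ _)))]
    have h1 := hvan φ (hφ.trans (Ioo_subset_Ioo (by linarith [min_le_left r₁ (min η η')])
      (by linarith [min_le_left r₁ (min η η')])))
    simp only at h1
    linarith
  -- Outside `D_p` the wave has not yet arrived shortly after `τ`, so both pressures in the sum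
  -- vanish.
  · simp only [if_neg hD] at hfin ⊢
    have hv := fun i => (hF.locallyIntegrable i).indicator_Icc 0 (τ + 1)
    obtain ⟨η', hη', hle⟩ := exists_pos_forall_le
      (m := fun i : O.Port => N.interp (N.nodeTT i) e x - O.actionTime p i)
      fun i => sub_pos.2 (O.actionTime_lt_interp p i hx hp hD)
    have hvz : ∀ i, ∀ᵐ s, s < τ - O.actionTime p i →
        (Icc 0 (τ + 1)).indicator (F i) s = 0 := by
      intro i
      filter_upwards [hF.zero i] with s hs h
      simp only [indicator_apply]
      rw [hs h, ite_self]
    have hzero : ∀ φ : TimeTest, tsupport φ ⊆ Iio (τ + min η η') → ∫ t, H e t x * φ t = 0 := by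
      intro φ hφ
      rw [hHs' e x hx' φ (hφ.trans (Iio_subset_Iio (by linarith [min_le_left η η'])))]
      exact (superpose_vanish wR hA hv hvz (d := τ + η') hx' fun i => by
        linarith [hle i]).1 φ (hφ.trans (Iio_subset_Iio (by linarith [min_le_right η η'])))
    refine hfin (min η η') (by positivity) fun φ hφ => ?_
    rw [hzero φ (hφ.trans (hball le_rfl)),
      hzero _ ((tsupport_reflect_subset_ball hφ).trans (hball le_rfl))]
    ring

end Outlet

end PipeNetwork

/-! ### The profile at the time `τ` -/

/-- A function that is continuous in time with values in `L¹`, from its even part in time. -/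
theorem ae_eq_of_even {f : ℝ → ℝ → ℝ} {ℓ τ : ℝ} {c : ℝ → ℝ}
    (hm : AEStronglyMeasurable (fun w : ℝ × ℝ => f w.1 w.2)
      (volume.restrict (univ ×ˢ Icc 0 ℓ)))
    (hs : ∀ t, IntegrableOn (f t) (Icc 0 ℓ))
    (ht : Tendsto (fun t => ∫ x in Icc 0 ℓ, |f t x - f τ x|) (𝓝 τ) (𝓝 0))
    (hc : Measurable c) (hci : IntegrableOn c (Icc 0 ℓ))
    (h : ∀ᵐ x ∂(volume.restrict (Icc 0 ℓ)), ∃ r > 0, ∀ᵐ t, t ∈ Ioo (τ - r) (τ + r) →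
      f t x + f (2 * τ - t) x = 2 * c x) :
    ∀ᵐ x ∂(volume.restrict (Icc 0 ℓ)), f τ x = c x := by
  set μ := (volume : Measure ℝ).restrict (Icc 0 ℓ) with hμ
  have hprod : (volume : Measure (ℝ × ℝ)).restrict (univ ×ˢ Icc 0 ℓ) = volume.prod μ := by
    rw [Measure.volume_eq_prod, ← Measure.prod_restrict, Measure.restrict_univ]
  rw [hprod] at hm
  set g := hm.mk _ with hg
  have hgm : Measurable g := hm.stronglyMeasurable_mk.measurable
  have hfg : ∀ᵐ w ∂(volume.prod μ), f w.1 w.2 = g w := hm.ae_eq_mk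
  have hrefl : Measure.QuasiMeasurePreserving (fun t : ℝ => 2 * τ - t) volume volume :=
    (Measure.measurePreserving_sub_left volume (2 * τ)).quasiMeasurePreserving
  have A1 : ∀ᵐ t, ∀ᵐ x ∂μ, f t x = g (t, x) := Measure.ae_ae_of_ae_prod hfg
  have A1' : ∀ᵐ t, ∀ᵐ x ∂μ, f (2 * τ - t) x = g (2 * τ - t, x) := hrefl.ae A1
  have A2 : ∀ᵐ x ∂μ, ∀ᵐ t, f t x = g (t, x) := Measure.ae_ae_of_ae_prod
    ((Measure.measurePreserving_swap (μ := μ) (ν := volume)).quasiMeasurePreserving.ae hfg)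
  -- The radius `r` depends on `x`. The sets `E n` below, where radius `1 / (n + 1)` works, are
  -- measurable sections of null measure and exhaust the segment up to a null set; a measurable
  -- version `g` of `f` is used to define them.
  let B : ℕ → Set (ℝ × ℝ) := fun n =>
    {w | w.1 ∈ Ioo (τ - 1 / (n + 1)) (τ + 1 / (n + 1)) ∧ g w + g (2 * τ - w.1, w.2) ≠ 2 * c w.2}
  have hB : ∀ n, MeasurableSet (B n) := by
    intro n
    refine (measurableSet_Ioo.preimage measurable_fst).inter (MeasurableSet.compl ?_)
    refine measurableSet_eq_fun (hgm.add (hgm.comp ?_)) ((hc.comp measurable_snd).const_mul 2)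
    exact (measurable_const.sub measurable_fst).prodMk measurable_snd
  let E : ℕ → Set ℝ := fun n => {x | volume ((fun t => (t, x)) ⁻¹' B n) = 0}
  have hE : ∀ n, MeasurableSet (E n) := fun n =>
    measurable_measure_prodMk_right (hB n) (measurableSet_singleton 0)
  have hcover : ∀ᵐ x ∂μ, ∃ n, x ∈ E n := by
    filter_upwards [h, A2] with x ⟨r, hr, hx⟩ hx2
    have hx3 := hrefl.ae hx2
    obtain ⟨n, hn⟩ := exists_nat_one_div_lt hr
    refine ⟨n, ?_⟩
    have : ∀ᵐ t, (t, x) ∉ B n := by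
      filter_upwards [hx, hx2, hx3] with t h1 h2 h3 h4
      refine h4.2 ?_
      rw [← h2, ← h3]
      exact h1 ⟨by linarith [h4.1.1], by linarith [h4.1.2]⟩
    have h5 := ae_iff.1 this
    simp only [not_not] at h5
    exact h5
  have main : ∀ n, ∀ᵐ x ∂(μ.restrict (E n)), f τ x = c x := by
    intro n
    have hnull : (volume.prod (μ.restrict (E n))) (B n) = 0 := by
      rw [Measure.prod_apply_symm (hB n)]
      refine (lintegral_congr_ae ?_).trans lintegral_zero
      filter_upwards [ae_restrict_mem (hE n)] with x hx using hx
    have hae : ∀ᵐ t, ∀ᵐ x ∂(μ.restrict (E n)), (t, x) ∉ B n :=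
      Measure.ae_ae_of_ae_prod (compl_mem_ae_iff.2 hnull)
    have hgood : ∀ᵐ t, t ∈ Ioo (τ - 1 / ((n : ℝ) + 1)) (τ + 1 / (n + 1)) →
        ∀ᵐ x ∂(μ.restrict (E n)), f t x + f (2 * τ - t) x = 2 * c x := by
      filter_upwards [hae, A1, A1'] with t h1 h2 h3 ht
      filter_upwards [h1, ae_restrict_of_ae h2, ae_restrict_of_ae h3] with x h4 h5 h6
      rw [h5, h6]
      by_contra hne
      exact h4 ⟨ht, hne⟩
    set D : ℝ → ℝ := fun t => ∫ x in Icc 0 ℓ, |f t x - f τ x| with hD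
    have hDi : ∀ t, Integrable (fun x => |f t x - f τ x|) μ := fun t => ((hs t).sub (hs τ)).abs
    have hIi : Integrable (fun x => |f τ x - c x|) μ := ((hs τ).sub hci).abs
    set I := ∫ x, |f τ x - c x| ∂(μ.restrict (E n)) with hI
    -- The triangle inequality applied to `2 (f τ - c) = -((f t - f τ) + (f (2τ - t) - f τ))`.
    have hle : ∀ t, (∀ᵐ x ∂(μ.restrict (E n)), f t x + f (2 * τ - t) x = 2 * c x) →
        2 * I ≤ D t + D (2 * τ - t) := by
      intro t htx
      have e1 : ∀ s, ∫ x, |f s x - f τ x| ∂(μ.restrict (E n)) ≤ D s := fun s =>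
        setIntegral_le_integral (hDi s) (ae_of_all _ fun x => abs_nonneg _)
      refine le_trans ?_ (add_le_add (e1 t) (e1 (2 * τ - t)))
      rw [hI, ← integral_const_mul, ← integral_add (hDi t).restrict (hDi _).restrict]
      refine integral_mono_ae (hIi.restrict.const_mul 2)
        ((hDi t).restrict.add (hDi _).restrict) ?_
      filter_upwards [htx] with x hx
      have e2 : 2 * (f τ x - c x) = -((f t x - f τ x) + (f (2 * τ - t) x - f τ x)) := by
        linarith
      calc 2 * |f τ x - c x| = |2 * (f τ x - c x)| := by rw [abs_mul, abs_two]
        _ ≤ _ := by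
          rw [e2, abs_neg]
          exact abs_add_le _ _
    have hI0 : I ≤ 0 := by
      by_contra hpos
      rw [not_le] at hpos
      have hr : Tendsto (fun t : ℝ => 2 * τ - t) (𝓝 τ) (𝓝 τ) := by
        have : Continuous fun t : ℝ => 2 * τ - t := by fun_prop
        convert this.tendsto τ using 2
        ring
      have h1 : ∀ᶠ t in 𝓝 τ, D t < I := ht.eventually (Iio_mem_nhds hpos)
      have h2 : ∀ᶠ t in 𝓝 τ, D (2 * τ - t) < I := (ht.comp hr).eventually (Iio_mem_nhds hpos)
      have hn : (0 : ℝ) < 1 / (n + 1) := by positivity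
      have h3 : ∀ᶠ t in 𝓝 τ, t ∈ Ioo (τ - 1 / ((n : ℝ) + 1)) (τ + 1 / (n + 1)) :=
        Ioo_mem_nhds (by linarith) (by linarith)
      obtain ⟨U, hU, hUo, hUτ⟩ := eventually_nhds_iff.1 (h1.and (h2.and h3))
      -- Evenness holds only for almost every `t`; such times are dense, hence one lies where both
      -- `D t` and `D (2τ - t)` are small.
      obtain ⟨t, htU, htg⟩ := (Measure.dense_of_ae hgood).inter_open_nonempty U hUo ⟨τ, hUτ⟩
      have h4 := hU t htU
      linarith [hle t (htg h4.2.2)]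
    have hI1 : I = 0 := le_antisymm hI0 (integral_nonneg fun x => abs_nonneg _)
    have h5 := (integral_eq_zero_iff_of_nonneg_ae (ae_of_all _ fun x => abs_nonneg _)
      hIi.restrict).1 hI1
    filter_upwards [h5] with x hx
    exact sub_eq_zero.1 (abs_eq_zero.1 hx)
  have main' : ∀ᵐ x ∂μ, ∀ n, x ∈ E n → f τ x = c x :=
    ae_all_iff.2 fun n => (ae_restrict_iff' (hE n)).1 (main n)
  filter_upwards [hcover, main'] with x ⟨n, hn⟩ hx
  exact hx n hn

namespace PipeNetwork

open TimeTest Distribution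

variable {V : Type*} {N : PipeNetwork V} {O : N.Outlet}

theorem Outlet.measurableSet_admissible (p : N.InnerPoint) (e : N.Pipe) :
    MeasurableSet {x | (e, x) ∈ O.admissibleSet p} := by
  classical
  by_cases he : e = p.pipe
  · by_cases hc : O.IsCutOff p (N.node p.pipe false)
    · convert (measurableSet_Icc (a := (0 : ℝ)) (b := N.length e)).inter
        (measurableSet_Iio (a := p.x)) using 1
      ext x
      simp [admissibleSet, he, hc]
    · convert (measurableSet_Icc (a := (0 : ℝ)) (b := N.length e)).inter
        (measurableSet_Ioi (a := p.x)) using 1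
      ext x
      simp [admissibleSet, he, hc]
  · convert (measurableSet_Icc (a := (0 : ℝ)) (b := N.length e)).inter
      (MeasurableSet.const (O.IsCutOff p (N.node e false))) using 1
    ext x
    simp [admissibleSet, he]

open Classical in
theorem Outlet.IsFunctionWave.focus [Finite V] {p : N.InnerPoint} {τ V₀ : ℝ}
    {R P : O.Port → N.Pipe → ℝ → TimeDist} {k : O.Port → O.Port → TimeDist} {ε h₀ : ℝ}
    {Qp : O.Port → ℝ → ℝ} {H Q : N.Pipe → ℝ → ℝ → ℝ} (hA : N.AreaConstNearBoundary) (hV₀ : V₀ ≠ 0)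
    (wR : ∀ i, O.IsWave (R i) (P i) (Outlet.impulse V₀ i))
    (hk : ∀ i j : O.Port, V₀⁻¹ • R i j.pos.1 (N.coord j.pos) =
      (if i = j then (N.speed / (N.endArea i.pos * N.gravity)) • Distribution.delta 0 else 0) +
        k i j)
    (hε : 0 < ε) (hkε : ∀ i j, IsVanishingOn (k i j) (Iio ε))
    (hle : ∀ j, O.actionTime p j ≤ τ)
    (hQp : ∀ j, LocallyIntegrable (Qp j))
    (hIE : O.IntegralEquation k (O.actionTime p) τ h₀ Qp)
    (hQ0 : ∀ j, ∀ t ∈ Icc 0 (τ - O.actionTime p j), Qp j t = 0)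
    (w : O.IsFunctionWave H Q fun j t => N.normal j.pos * Qp j t) (e : N.Pipe) :
    ∀ᵐ x ∂(volume.restrict (Icc 0 (N.length e))),
      H e τ x = if (e, x) ∈ O.admissibleSet p then h₀ else 0 := by
  have hF : O.IsControl p τ fun j t => N.normal j.pos * Qp j t := by
    -- For negative times the flow vanishes almost everywhere by the initial condition of the wave;
    -- from `0` to the start of the action it vanishes by hypothesis.
    refine ⟨hle, w.locallyIntegrable_F, fun j => ?_⟩
    have h1 := TimeDist.ae_eq_zero_of_integral_mul isOpen_Iio
      ((w.locallyIntegrable_F j).locallyIntegrableOn (Iio 0)) fun φ hφ => by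
        rw [← TimeDist.ofFun_apply (w.locallyIntegrable_F j)]
        exact w.wave.initial_F j φ hφ
    filter_upwards [h1] with t ht hlt
    by_cases h0 : t < 0
    · exact ht h0
    · rw [hQ0 j t ⟨not_lt.1 h0, hlt.le⟩, mul_zero]
  have hc : Measurable fun x => if (e, x) ∈ O.admissibleSet p then h₀ else (0 : ℝ) :=
    Measurable.ite (O.measurableSet_admissible p e) measurable_const measurable_const
  refine ae_eq_of_even (w.measurable_H e) (w.slice_H e) (w.time_continuous_H e τ) hc ?_ ?_
  · refine Measure.integrableOn_of_bounded (M := |h₀|) (by simp) hc.aestronglyMeasurable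
      (ae_of_all _ fun x => ?_)
    split_ifs <;> simp
  -- The vertices and `p` are excluded as null sets.
  · have hne : ∀ y : ℝ, ∀ᵐ x ∂(volume.restrict (Icc 0 (N.length e))), x ≠ y := fun y =>
      ae_restrict_of_ae (by simp [ae_iff])
    filter_upwards [hne 0, hne (N.length e), hne p.x, ae_restrict_mem measurableSet_Icc]
      with x h0 hℓ hp hx
    exact w.even_pressure hA hV₀ wR hk hε hkε hF hQp hIE
      ⟨lt_of_le_of_ne hx.1 h0.symm, lt_of_le_of_ne hx.2 hℓ⟩ fun _ => hp

end PipeNetwork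

end

open Classical in
theorem mainTheorem3 {V : Type*} [Finite V] (N : PipeNetwork V) (O : N.Outlet)
    (hA : N.AreaConstNearBoundary) (V₀ : ℝ) (hV₀ : 0 < V₀)
    (K : O.Port → O.Port → TimeDist) (hK : O.IsImpulseResponse V₀ K) :
    ∃ k : O.Port → O.Port → TimeDist,
      (∀ i j, K i j =
        (if i = j then (N.speed / (N.endArea i.pos * N.gravity)) • Distribution.delta 0 else 0) +
          k i j) ∧
      (∃ ε > 0, ∀ i j, Distribution.IsVanishingOn (k i j) (Iio ε)) ∧
      (∀ i j, Distribution.IsVanishingOn (k i j - k j i)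
        (Iio (N.nodeTT i O.vertex + N.nodeTT O.vertex j))) ∧
      ((∀ s t, O.α s * O.β t = O.α t * O.β s) → ∀ i j, k i j = k j i) ∧
      ∀ (p : N.InnerPoint) (τ h₀ : ℝ) (Qp : O.Port → ℝ → ℝ),
        (∀ j, O.actionTime p j ≤ τ) →
        (∀ j, LocallyIntegrable (Qp j)) →
        O.IntegralEquation k (O.actionTime p) τ h₀ Qp →
        (∀ j, ∀ t ∈ Icc 0 (τ - O.actionTime p j), Qp j t = 0) →
        ∀ H Q : N.Pipe → ℝ → ℝ → ℝ,
          O.IsFunctionWave H Q (fun j t => N.normal j.pos * Qp j t) →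
          ∀ e, ∀ᵐ x ∂(volume.restrict (Icc 0 (N.length e))),
            H e τ x = if (e, x) ∈ O.admissibleSet p then h₀ else 0 := by
  choose R P wR hR using hK
  choose ε' hε' hearly using fun j : O.Port => PipeNetwork.Outlet.exists_early hA j
  -- There are finitely many ports, so their delays have a common positive lower bound.
  obtain ⟨ε, hε, hεle⟩ := exists_pos_forall_le hε'
  let k : O.Port → O.Port → TimeDist := fun i j => K i j -
    if i = j then (N.speed / (N.endArea i.pos * N.gravity)) • Distribution.delta 0 else 0
  have hk : ∀ i j, K i j =
      (if i = j then (N.speed / (N.endArea i.pos * N.gravity)) • Distribution.delta 0 else 0) +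
        k i j := fun i j => (add_sub_cancel _ _).symm
  have hkε : ∀ i j, Distribution.IsVanishingOn (k i j) (Iio ε) := by
    intro i j (φ : TimeTest) hφ
    have h1 := hearly j _ _ _ (wR i) φ (hφ.trans (Iio_subset_Iio (hεle j)))
    have h2 : k i j φ = V₀⁻¹ * (R i j.pos.1 (N.coord j.pos) -
        (N.speed / (N.endArea j.pos * N.gravity)) •
          if j = i then V₀ • Distribution.delta 0 else 0 : TimeDist) φ := by
      simp only [k]
      rw [hR, TimeDist.sub_apply, TimeDist.sub_apply, TimeDist.smul_apply, TimeDist.smul_apply,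
        mul_sub]
      congr 1
      by_cases h : i = j
      · subst h
        rw [if_pos rfl, if_pos rfl, TimeDist.smul_apply, TimeDist.smul_apply]
        field_simp
      · rw [if_neg h, if_neg fun h' => h h'.symm, TimeDist.zero_apply]
        simp
    rw [h2, h1, mul_zero]
  -- The instantaneous terms are symmetric in `i` and `j` and cancel, so reciprocity of the full
  -- responses passes to `k`.
  have hsymm : ∀ i j, k i j - k j i = V₀⁻¹ • (R i j.pos.1 (N.coord j.pos) -
      R j i.pos.1 (N.coord i.pos)) := by
    intro i j
    simp only [k]
    rw [hR, hR, smul_sub]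
    by_cases h : i = j
    · subst h
      simp
    · rw [if_neg h, if_neg fun h' => h h'.symm, sub_zero, sub_zero]
  refine ⟨k, hk, ⟨ε, hε, hkε⟩, fun i j => ?_, fun hc i j => ?_, ?_⟩
  · intro (φ : TimeTest) hφ
    have := (wR i).reciprocity_early hV₀.ne' hA (wR j) φ hφ
    rw [hsymm, TimeDist.smul_apply, this, mul_zero]
  · rw [← sub_eq_zero, hsymm, (wR i).reciprocity_const hV₀.ne' (wR j) hc, sub_self, smul_zero]
  · intro p τ h₀ Qp hle hQp hIE hQ0 H Q w e
    exact w.focus hA hV₀.ne' wR (fun i j => (hR i j).symm.trans (hk i j)) hε hkε hle hQp hIE hQ0 e
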